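/- **Theorem.** All algorithms are deterministic programs for a word RAM, in which each of the usual operations on words (loading, storing, arithmetic, bitwise operations, shifts, comparisons, branching) takes one step. A graph is represented by its number of vertices, its number of edges, and a list of its edges in which each edge occurs once. An instance of $3$-OV consists of three families $A,B,C$ of $n\ge 1$ vectors in $\{0,1\}^d$, $d\ge 1$; a solution is a triple $a\in A$, $b\in B$, $c\in C$ with $\sum_{x=1}^d a[x]\,b[x]\,c[x]=0$. 1. There is an algorithm, using words of $O(\log(n+d))$ bits, that given a $3$-OV instance constructs in $O(n^2d^2)$ time an unweighted, undirected graph with $O(n^2+nd^2)$ vertices and $O(n^2d^2)$ edges such that - if the instance has no solution, then $d(u,v)\le 5$ for all pairs of vertices $u,v$; - if the instance has a solution, then there is a pair of vertices $u,v$ with $d(u,v)\ge 8$ (where $d(u,v)=\infty$ if $u$ and $v$ are not connected). 2. Assume the Strong Exponential Time Hypothesis (SETH): for every $\varepsilon>0$ there is a $K$ such that no algorithm, using words of $O(N)$ bits, decides the satisfiability of $K$-CNF formulas (at most $K$ literals per clause, no repeated clause) on $N$ variables in time $2^{(1-\varepsilon)N}\cdot\mathrm{poly}(N)$. Then for all $\varepsilon,\delta>0$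 no algorithm, using words of $O(\log n)$ bits, outputs in $O(n^{3/2-\delta})$ time an $(8/5-\varepsilon)$-approximation for the Diameter of sparse undirected unweighted graphs on $n$ vertices. This holds for connected graphs with at most $sn$ edges, for every constant $s>1$, and for both meanings of an $\alpha$-approximation of the Diameter $D$: a number $E$ with $D/\alpha\le E\le D$, or a number $E$ with $D\le E\le\alpha D$. -/

import Mathlib

/-! ## The word RAM

A machine has registers and a memory, both indexed by `ℕ` and holding natural numbers.  The word
length is a bound `B` (`B = 2 ^ b` for `b`-bit words): an operation whose result is not smaller
than `B` has no successor state, so a program is only credited with runs in which every number it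
ever produces, in particular every address, fits into a word.  Control flow is structured (`ite`
and `while`), which is the same as jumps up to constant factors. -/

namespace WordRAM

/-- The binary operations on words that take unit time. -/
inductive Op
  | add | sub | mul | div | mod | and | or | xor | shl | shr | lt | eq

/-- Subtraction is truncated at `0`, division by `0` gives `0`, and the two comparisons return `1`
for true and `0` for false. -/
def Op.eval : Op → ℕ → ℕ → ℕ
  | .add, a, b => a + b
  | .sub, a, b => a - b
  | .mul, a, b => a * b
  | .div, a, b => a / b
  | .mod, a, b => a % b
  | .and, a, b => a &&& b
  | .or, a, b => a ||| b
  | .xor, a, b => a ^^^ b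
  | .shl, a, b => a <<< b
  | .shr, a, b => a >>> b
  | .lt, a, b => if a < b then 1 else 0
  | .eq, a, b => if a = b then 1 else 0

/-- Programs.  All arguments of type `ℕ` are register names, except the constant `k`. -/
inductive Prog
  /-- do nothing -/
  | skip
  /-- `reg r := k` -/
  | const (r k : ℕ)
  /-- `reg r := reg a ∘ reg b` -/
  | op (o : Op) (r a b : ℕ)
  /-- `reg r := mem (reg a)` -/
  | load (r a : ℕ)
  /-- `mem (reg a) := reg r` -/
  | store (a r : ℕ)
  /-- run `p`, then `q` -/
  | seq (p q : Prog)
  /-- run `p` if `reg r ≠ 0`, otherwise run `q` -/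
  | ite (r : ℕ) (p q : Prog)
  /-- as long as `reg r ≠ 0`, run `p` -/
  | while (r : ℕ) (p : Prog)

/-- The contents of the registers and of the memory. -/
structure State where
  reg : ℕ → ℕ
  mem : ℕ → ℕ

def State.setReg (s : State) (r v : ℕ) : State := { s with reg := Function.update s.reg r v }

def State.setMem (s : State) (a v : ℕ) : State := { s with mem := Function.update s.mem a v }

/-- `Exec B p s s' t`: started in state `s`, the program `p` halts in state `s'` after exactly `t`
steps, and all numbers produced on the way are smaller than `B`.  Every elementary instruction and
every test of a branch or a loop costs one step. -/
inductive Exec (B : ℕ) : Prog → State → State → ℕ → Prop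
  | skip (s : State) : Exec B .skip s s 1
  | const (s : State) (r k : ℕ) (h : k < B) : Exec B (.const r k) s (s.setReg r k) 1
  | op (s : State) (o : Op) (r a b : ℕ) (h : o.eval (s.reg a) (s.reg b) < B) :
      Exec B (.op o r a b) s (s.setReg r (o.eval (s.reg a) (s.reg b))) 1
  | load (s : State) (r a : ℕ) (h : s.mem (s.reg a) < B) :
      Exec B (.load r a) s (s.setReg r (s.mem (s.reg a))) 1
  | store (s : State) (a r : ℕ) : Exec B (.store a r) s (s.setMem (s.reg a) (s.reg r)) 1
  | seq {p q : Prog} {s₀ s₁ s₂ : State} {t₁ t₂ : ℕ} (hp : Exec B p s₀ s₁ t₁)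
      (hq : Exec B q s₁ s₂ t₂) : Exec B (.seq p q) s₀ s₂ (t₁ + t₂)
  | ite_true {r : ℕ} {p : Prog} (q : Prog) {s s' : State} {t : ℕ} (hr : s.reg r ≠ 0)
      (hp : Exec B p s s' t) : Exec B (.ite r p q) s s' (t + 1)
  | ite_false {r : ℕ} (p : Prog) {q : Prog} {s s' : State} {t : ℕ} (hr : s.reg r = 0)
      (hq : Exec B q s s' t) : Exec B (.ite r p q) s s' (t + 1)
  | while_done {r : ℕ} (p : Prog) {s : State} (hr : s.reg r = 0) : Exec B (.while r p) s s 1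
  | while_step {r : ℕ} {p : Prog} {s₀ s₁ s₂ : State} {t₁ t₂ : ℕ} (hr : s₀.reg r ≠ 0)
      (hp : Exec B p s₀ s₁ t₁) (hw : Exec B (.while r p) s₁ s₂ t₂) :
      Exec B (.while r p) s₀ s₂ (t₁ + t₂ + 1)

/-- The initial state on input `xs`: the input is in the first memory cells, all else is `0`. -/
def State.init (xs : List ℕ) : State where
  reg := fun _ => 0
  mem := fun i => xs.getD i 0

/-- On input `xs`, using only numbers below `B`, the program `p` halts within `T` steps with a
memory that satisfies `good`. -/
def RunsWithin (p : Prog) (xs : List ℕ) (B : ℕ) (T : ℝ) (good : (ℕ → ℕ) → Prop) : Prop :=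
  ∃ (s : State) (t : ℕ), Exec B p (State.init xs) s t ∧ (t : ℝ) ≤ T ∧ good s.mem

end WordRAM

/-! ## Satisfiability and the Strong Exponential Time Hypothesis -/

/-- A formula in conjunctive normal form in the variables `0, …, N - 1`: a list of clauses, each a
list of literals; the literal `(i, b)` says that variable `i` has the value `b`. -/
abbrev CNF (N : ℕ) := List (List (Fin N × Bool))

def CNF.Satisfiable {N : ℕ} (φ : CNF N) : Prop :=
  ∃ σ : Fin N → Bool, ∀ C ∈ φ, ∃ l ∈ C, σ l.1 = l.2

/-- An instance of `K`-SAT: every clause has at most `K` literals, and no clause is repeated. -/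
def CNF.IsKCNF {N : ℕ} (K : ℕ) (φ : CNF N) : Prop :=
  (∀ C ∈ φ, C.length ≤ K) ∧ φ.Nodup

/-- `N`, the number of clauses, and then for each clause its length followed by its literals, where
`(i, b)` is written as `2 * i + b`. -/
def CNF.encode {N : ℕ} (φ : CNF N) : List ℕ :=
  N :: φ.length ::
    φ.flatMap fun C => C.length :: C.map fun l => 2 * (l.1 : ℕ) + l.2.toNat

/-- Some program decides `K`-SAT on `N` variables in time `2 ^ ((1 - ε) N) · poly(N)`, on a word RAM
with words of `O(N)` bits. -/
def KSATSolvable (K : ℕ) (ε : ℝ) : Prop :=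
  ∃ (p : WordRAM.Prog) (c : ℕ), ∀ (N : ℕ) (φ : CNF N), φ.IsKCNF K →
    WordRAM.RunsWithin p φ.encode (2 ^ (c * (N + 1)))
      (c * (2 : ℝ) ^ ((1 - ε) * (N : ℝ)) * ((N : ℝ) + 1) ^ c)
      fun mem => mem 0 = 1 ↔ φ.Satisfiable

/-- The Strong Exponential Time Hypothesis. -/
def SETH : Prop :=
  ∀ ε : ℝ, 0 < ε → ∃ K : ℕ, ¬ KSATSolvable K ε

/-! ## Graphs as inputs and outputs of programs -/

/-- `xs` is an edge-list representation of the graph `G` on `0, …, n - 1`: the number of vertices,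
the number of edges, and the two endpoints of each edge, where each edge is listed exactly once
(the order of the edges and of the endpoints of an edge is arbitrary). -/
def EncodesGraph {n : ℕ} (G : SimpleGraph (Fin n)) (xs : List ℕ) : Prop :=
  ∃ es : List (Fin n × Fin n),
    (es.map fun e => s(e.1, e.2)).Nodup ∧
    (∀ e : Sym2 (Fin n), e ∈ G.edgeSet ↔ e ∈ es.map fun e => s(e.1, e.2)) ∧
    xs = n :: es.length :: es.flatMap fun e => [(e.1 : ℕ), (e.2 : ℕ)]

/-! ## Three orthogonal vectors -/

/-- Three families of `n` vectors in `{0,1}^d`. -/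
structure OV3 (n d : ℕ) where
  A : Fin n → Fin d → Bool
  B : Fin n → Fin d → Bool
  C : Fin n → Fin d → Bool

/-- There are `a ∈ A`, `b ∈ B`, `c ∈ C` whose generalized inner product is `0`. -/
def OV3.HasSolution {n d : ℕ} (I : OV3 n d) : Prop :=
  ∃ i j k : Fin n, ∑ x : Fin d, (I.A i x).toNat * (I.B j x).toNat * (I.C k x).toNat = 0

/-- The entries of a family of vectors, vector by vector. -/
def encodeVectors {n d : ℕ} (V : Fin n → Fin d → Bool) : List ℕ :=
  (List.ofFn fun i => List.ofFn fun x => (V i x).toNat).flatten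

def OV3.encode {n d : ℕ} (I : OV3 n d) : List ℕ :=
  n :: d :: (encodeVectors I.A ++ encodeVectors I.B ++ encodeVectors I.C)

/-! ## Approximating the diameter -/

/-- `E` is an `α`-approximation of `D` from below: `D / α ≤ E ≤ D`. -/
def IsApproxBelow (α : ℝ) (D E : ℕ) : Prop :=
  (E : ℝ) ≤ D ∧ (D : ℝ) ≤ α * E

/-- `E` is an `α`-approximation of `D` from above: `D ≤ E ≤ α D`. -/
def IsApproxAbove (α : ℝ) (D E : ℕ) : Prop :=
  (D : ℝ) ≤ E ∧ (E : ℝ) ≤ α * D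

/-- Some program, on a word RAM with words of `O(log n)` bits, computes in time `O(n ^ r)`, for every
connected graph with `n` vertices and at most `s * n` edges, a number `E` that is related by `approx`
to the diameter of the graph.  (For approximations from below or above it is no restriction that
`E` is an integer, since any other estimate can be rounded up or down, respectively.) -/
def SparseDiameterComputable (approx : ℕ → ℕ → Prop) (s r : ℝ) : Prop :=
  ∃ (p : WordRAM.Prog) (c : ℕ), ∀ (n : ℕ) (G : SimpleGraph (Fin n)) (xs : List ℕ),
    G.Connected → (G.edgeSet.ncard : ℝ) ≤ s * n → EncodesGraph G xs →
      WordRAM.RunsWithin p xs ((n + 2) ^ c) (c * (n : ℝ) ^ r) fun mem => approx G.diam (mem 0)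

/-! ## Distances in graphs: two general facts -/

/-! The reduction. Append an all-ones vector to each family; this creates no solution. The graph has
a side 0 for A and a side 1 for C. The vertex `pair σ i j` stands for vector i of the side's family
together with vector j of B. Pairs on one side are at distance at most 3 through a clique of hubs.
The sides meet only through coordinates: `pair σ i j` is joined to `coord σ i x y` if B_j[x] = 1,
and `coord 0 i x y` is joined to `coord 1 k y x` if A_i and C_k are both 1 at x and at y. Without a
solution, i, j, k share a one at some x, and i, j', k share a one at some y. Hence `pair 0 i j`,
`coord 0 i x y`, `coord 1 k y x`, `pair 1 k j'` is a path of length 3. Every vertex is at distance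
at most 1 from a pair, so all distances are at most 1 + 3 + 1 (`edist_le_five`). With a solution (a,
b, c), an integer function that changes by at most 1 along every edge takes the value 0 at `leaf 0 a
b` and 8 at `leaf 1 c b` (`Step.potential_lipschitz`, `exists_eight_le_edist`).

Programs. A small command language is compiled to the word RAM and equipped with Hoare-style rules
(`Triple`) that track time, word size and memory at once. Loops are never nested: each family of
edges is emitted by a single loop whose counter is decoded by division with remainder. The running
time is therefore a constant times the largest loop length.

The lower bound. Split the N variables of a K-CNF into three groups of g, about N/3 each. The 2^g
partial assignments of a group become vectors whose ones mark the clauses they fail to satisfy, so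
orthogonal triples are satisfying assignments (`hasSolution_toOV3`). Since clauses are distinct and
K is fixed, the dimension is polynomial in N. The graph therefore has size X = 2^(2N/3) · poly(N),
and pendant vertices make it as sparse as desired. An approximation better than 8/5 separates
diameter at most 5 from at least 8. In time X^r with r < 3/2 it would decide satisfiability in time
2^(2rN/3) · poly(N), with 2r/3 < 1, against SETH. -/

theorem SimpleGraph.edist_map_le {V W : Type*} {G : SimpleGraph V} {H : SimpleGraph W}
    (φ : G →g H) (u v : V) : H.edist (φ u) (φ v) ≤ G.edist u v := by
  by_cases h : G.edist u v = ⊤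
  · simp [h]
  · obtain ⟨p, hp⟩ := SimpleGraph.exists_walk_of_edist_ne_top h
    rw [← hp]
    exact (SimpleGraph.edist_le (p.map φ)).trans (by simp)

theorem SimpleGraph.Iso.edist_eq {V W : Type*} {G : SimpleGraph V} {H : SimpleGraph W}
    (φ : G ≃g H) (u v : V) : H.edist (φ u) (φ v) = G.edist u v := by
  refine le_antisymm (SimpleGraph.edist_map_le φ.toHom u v) ?_
  simpa using SimpleGraph.edist_map_le φ.symm.toHom (φ u) (φ v)

/-- Along a walk `f` grows by at most the length of the walk. The bound holds for every walk, so the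
case of infinite distance needs no separate hypothesis. -/
theorem SimpleGraph.le_edist_of_lipschitz {V : Type*} {G : SimpleGraph V} (f : V → ℕ)
    (hf : ∀ u v, G.Adj u v → f v ≤ f u + 1) (u v : V) (k : ℕ) (h : f u + k ≤ f v) :
    (k : ℕ∞) ≤ G.edist u v := by
  have key : ∀ {u v : V} (p : G.Walk u v), f v ≤ f u + p.length := by
    intro u v p
    induction p with
    | nil => simp
    | cons hadj p ih =>
      have := hf _ _ hadj
      simp only [SimpleGraph.Walk.length_cons]
      omega
  by_cases ht : G.edist u v = ⊤
  · simp [ht]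
  · obtain ⟨p, hp⟩ := SimpleGraph.exists_walk_of_edist_ne_top ht
    rw [← hp]
    have := key p
    exact_mod_cast (by omega : k ≤ p.length)

/-! ## The graph of a 3-OV instance -/

namespace OV3

variable {n d : ℕ}

/-- The instance with an all-ones vector appended to each family. -/
def extend (I : OV3 n d) : OV3 (n + 1) d where
  A := fun i x => if h : (i : ℕ) < n then I.A ⟨i, h⟩ x else true
  B := fun i x => if h : (i : ℕ) < n then I.B ⟨i, h⟩ x else true
  C := fun i x => if h : (i : ℕ) < n then I.C ⟨i, h⟩ x else true

theorem hasSolution_iff (I : OV3 n d) : I.HasSolution ↔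
    ∃ i j k, ∀ x, ¬ (I.A i x = true ∧ I.B j x = true ∧ I.C k x = true) := by
  unfold HasSolution
  refine exists_congr fun i => exists_congr fun j => exists_congr fun k => ?_
  rw [Finset.sum_eq_zero_iff]
  refine ⟨fun h x => ?_, fun h x _ => ?_⟩
  · have := h x (Finset.mem_univ x)
    revert this
    cases I.A i x <;> cases I.B j x <;> cases I.C k x <;> simp
  · have := h x
    revert this
    cases I.A i x <;> cases I.B j x <;> cases I.C k x <;> simp

/-- An all-ones vector in a solution can be replaced by any vector of its family, because this only
removes ones. The map `r` does so with the vector `0`, which exists as `1 ≤ n`. -/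
theorem hasSolution_extend (hn : 1 ≤ n) (I : OV3 n d) :
    I.extend.HasSolution ↔ I.HasSolution := by
  rw [hasSolution_iff, hasSolution_iff]
  constructor
  · rintro ⟨i, j, k, h⟩
    let r : Fin (n + 1) → Fin n := fun i => if h : (i : ℕ) < n then ⟨i, h⟩ else ⟨0, hn⟩
    have key : ∀ (X : Fin n → Fin d → Bool) (i : Fin (n + 1)) (x : Fin d), X (r i) x = true →
        (if h : (i : ℕ) < n then X ⟨i, h⟩ x else true) = true := by
      intro X i x hX
      by_cases hi : (i : ℕ) < n
      · simpa [r, hi] using hX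
      · simp [hi]
    exact ⟨r i, r j, r k, fun x ⟨h1, h2, h3⟩ => h x ⟨key _ _ _ h1, key _ _ _ h2, key _ _ _ h3⟩⟩
  · rintro ⟨i, j, k, h⟩
    exact ⟨i.castSucc, j.castSucc, k.castSucc, fun x => by simpa [extend] using h x⟩

/-- The vertices of the graph of an instance with `m` vectors per family, with `Q` extra leaves.
The two sides are indexed by `Fin 2`. -/
inductive Vertex (m d Q : ℕ)
  | leaf (σ : Fin 2) (i j : Fin m)
  | pair (σ : Fin 2) (i j : Fin m)
  | hub (σ : Fin 2) (i : Fin m)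
  | coord (σ : Fin 2) (i : Fin m) (x y : Fin d)
  | pad (t : Fin Q)

/-- The edges of the graph, each in one direction. -/
inductive Step (J : OV3 (n + 1) d) (Q : ℕ) : Vertex (n + 1) d Q → Vertex (n + 1) d Q → Prop
  | leaf (σ i j) : Step J Q (.leaf σ i j) (.pair σ i j)
  | hub (σ i j) : Step J Q (.hub σ i) (.pair σ i j)
  | hubs (σ i j) (h : i < j) : Step J Q (.hub σ i) (.hub σ j)
  | coord (σ i j x y) (h : J.B j x = true) : Step J Q (.pair σ i j) (.coord σ i x y)
  | cross (i k x y) (hx : J.A i x = true) (hy : J.A i y = true) (hx' : J.C k x = true)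
      (hy' : J.C k y = true) : Step J Q (.coord 0 i x y) (.coord 1 k y x)
  | pad (t) : Step J Q (.pad t) (.pair 0 0 0)

/-- The graph of an instance. -/
def graph (J : OV3 (n + 1) d) (Q : ℕ) : SimpleGraph (Vertex (n + 1) d Q) :=
  SimpleGraph.fromRel (Step J Q)

variable {J : OV3 (n + 1) d} {Q : ℕ}

theorem Step.ne {u v : Vertex (n + 1) d Q} (h : Step J Q u v) : u ≠ v := by
  cases h <;> simp
  rename_i h
  exact h.ne

theorem graph_adj {u v : Vertex (n + 1) d Q} :
    (graph J Q).Adj u v ↔ Step J Q u v ∨ Step J Q v u := by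
  rw [graph, SimpleGraph.fromRel_adj]
  exact ⟨fun h => h.2, fun h => ⟨h.elim Step.ne fun h => h.ne.symm, h⟩⟩

theorem Step.edist_le {u v : Vertex (n + 1) d Q} (h : Step J Q u v) :
    (graph J Q).edist u v ≤ 1 :=
  SimpleGraph.edist_le_one_iff_adj_or_eq.2 (.inl (graph_adj.2 (.inl h)))

theorem Step.edist_le' {u v : Vertex (n + 1) d Q} (h : Step J Q u v) :
    (graph J Q).edist v u ≤ 1 :=
  SimpleGraph.edist_comm.trans_le h.edist_le

theorem edist_le_add {V : Type*} {G : SimpleGraph V} {u v w : V} {a b c : ℕ∞}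
    (h₁ : G.edist u v ≤ a) (h₂ : G.edist v w ≤ b) (h : a + b = c) : G.edist u w ≤ c :=
  (SimpleGraph.edist_triangle.trans (add_le_add h₁ h₂)).trans h.le

/-- Every vertex is at distance at most `1` from a vertex of the form `pair σ i j`. -/
theorem exists_pair_near (hJ : ∀ x, J.B (Fin.last n) x = true) (u : Vertex (n + 1) d Q) :
    ∃ σ i j, (graph J Q).edist u (.pair σ i j) ≤ 1 := by
  cases u with
  | leaf σ i j => exact ⟨σ, i, j, (Step.leaf σ i j).edist_le⟩
  | pair σ i j => exact ⟨σ, i, j, by simp⟩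
  | hub σ i => exact ⟨σ, i, 0, (Step.hub σ i 0).edist_le⟩
  -- The all-ones vector of B makes every coordinate vertex a neighbour of a pair.
  | coord σ i x y => exact ⟨σ, i, Fin.last n, (Step.coord σ i _ x y (hJ x)).edist_le'⟩
  | pad t => exact ⟨0, 0, 0, (Step.pad t).edist_le⟩

theorem edist_pair_pair (σ : Fin 2) (i j i' j' : Fin (n + 1)) :
    (graph J Q).edist (.pair σ i j) (.pair σ i' j') ≤ 3 := by
  have h1 : (graph J Q).edist (.hub σ i) (.hub σ i') ≤ 1 := by
    rcases lt_trichotomy i i' with h | h | h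
    · exact (Step.hubs σ i i' h).edist_le
    · simp [h]
    · exact (Step.hubs σ i' i h).edist_le'
  exact edist_le_add (edist_le_add (Step.hub σ i j).edist_le' h1 rfl)
    (Step.hub σ i' j').edist_le (by norm_num)

/-- A pair sees only the first coordinate of a `coord` vertex. As a cross edge swaps the
coordinates, `x` can serve for `j` and an independent `y` for `j'`. -/
theorem edist_pair_zero_one {i j k j' : Fin (n + 1)} {x y : Fin d}
    (hx : J.A i x = true ∧ J.B j x = true ∧ J.C k x = true)
    (hy : J.A i y = true ∧ J.B j' y = true ∧ J.C k y = true) :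
    (graph J Q).edist (.pair 0 i j) (.pair 1 k j') ≤ 3 :=
  edist_le_add (edist_le_add (Step.coord 0 i j x y hx.2.1).edist_le
    (Step.cross i k x y hx.1 hy.1 hx.2.2 hy.2.2).edist_le rfl)
    (Step.coord 1 k j' y x hy.2.1).edist_le' (by norm_num)

theorem edist_le_five (hJ : ∀ x, J.B (Fin.last n) x = true) (hs : ¬ J.HasSolution)
    (u v : Vertex (n + 1) d Q) : (graph J Q).edist u v ≤ 5 := by
  have hs' : ∀ i j k, ∃ x, J.A i x = true ∧ J.B j x = true ∧ J.C k x = true := by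
    rw [hasSolution_iff] at hs
    push Not at hs
    simpa using hs
  have key : ∀ σ i j σ' i' j', (graph J Q).edist (.pair σ i j) (.pair σ' i' j') ≤ 3 := by
    intro σ i j σ' i' j'
    by_cases h : σ = σ'
    · subst h
      exact edist_pair_pair ..
    -- The two coordinates are common ones of `i`, `j`, `i'` and of `i`, `j'`, `i'`, respectively.
    · have : ∀ i j i' j', (graph J Q).edist (.pair 0 i j) (.pair 1 i' j') ≤ 3 := fun i j i' j' =>
        edist_pair_zero_one (hs' i j i').choose_spec (hs' i j' i').choose_spec
      have h' : σ = 0 ∧ σ' = 1 ∨ σ = 1 ∧ σ' = 0 := by omega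
      rcases h' with ⟨rfl, rfl⟩ | ⟨rfl, rfl⟩
      · exact this ..
      · exact SimpleGraph.edist_comm.trans_le (this ..)
  obtain ⟨σ, i, j, h1⟩ := exists_pair_near (Q := Q) hJ u
  obtain ⟨σ', i', j', h2⟩ := exists_pair_near (Q := Q) hJ v
  exact edist_le_add (edist_le_add h1 (key σ i j σ' i' j') rfl)
    (SimpleGraph.edist_comm.trans_le h2) (by norm_num)

/-- The pairs of all-ones vectors link the two sides whether or not there is a solution. This makes
the diameter finite in both cases. -/
theorem graph_connected (hd : 0 < d) (hA : ∀ x, J.A (Fin.last n) x = true)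
    (hB : ∀ x, J.B (Fin.last n) x = true) (hC : ∀ x, J.C (Fin.last n) x = true) :
    (graph J Q).Connected := by
  let x : Fin d := ⟨0, hd⟩
  let l := Fin.last n
  have hcross : (graph J Q).edist (.pair 0 l l) (.pair 1 l l) ≤ 3 :=
    edist_pair_zero_one (x := x) (y := x) ⟨hA x, hB x, hC x⟩ ⟨hA x, hB x, hC x⟩
  have reach : ∀ {u v : Vertex (n + 1) d Q} {k : ℕ}, (graph J Q).edist u v ≤ k →
      (graph J Q).Reachable u v := fun h =>
    SimpleGraph.reachable_of_edist_ne_top (ne_top_of_le_ne_top (ENat.natCast_ne_top _) h)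
  have key : ∀ u, (graph J Q).Reachable u (.pair 0 l l) := by
    intro u
    obtain ⟨σ, i, j, h1⟩ := exists_pair_near (Q := Q) hB u
    refine (reach (k := 1) h1).trans ((reach (k := 3) (edist_pair_pair σ i j l l)).trans ?_)
    have h' : σ = 0 ∨ σ = 1 := by omega
    rcases h' with rfl | rfl
    · exact .refl _
    · exact (reach (k := 3) hcross).symm
  exact { preconnected := fun u v => (key u).trans (key v).symm, nonempty := ⟨.pair 0 l l⟩ }

/-- A function that changes by at most one along edges if `(a, b, c)` is a solution. -/
def potential (J : OV3 (n + 1) d) (a b c : Fin (n + 1)) : Vertex (n + 1) d Q → ℕ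
  | .leaf σ i j =>
    if σ = 0 then if i = a then (if j = b then 0 else 3) else 4
    else if i = c then (if j = b then 8 else 6) else 4
  | .pair σ i j =>
    if σ = 0 then if i = a then (if j = b then 1 else 3) else 4
    else if i = c then (if j = b then 7 else 6) else 4
  | .hub σ i => if σ = 0 then if i = a then 2 else 3 else if i = c then 6 else 5
  | .coord σ i x y =>
    if σ = 0 then
      if i = a then (if J.B b x then 2 else 4) else (if J.A a x && J.B b x then 4 else 5)
    else
      if i = c then (if J.B b x then 6 else 5) else (if J.A a y && J.B b y then 3 else 5)
  | .pad _ => if a = 0 then (if b = 0 then 1 else 3) else 4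

/-- Only the cross edges use that (a, b, c) is a solution. For `i = a` and `k = c`, the edge forces
a and c to be 1 at `x` and `y`, so b vanishes at both and the values are 4 and 5. For `i = a` and `k
≠ c` the values are 2, 3 or 4, 5, according to b at `x`. For `i ≠ a` and `k = c`, c is 1 at `x`, so
a and b are not both 1 there and side 0 has the value 5, while side 1 has 5 or 6. If both differ,
the values are 4, 3 or 5, 5, according to whether a and b are both 1 at `x`. -/
theorem Step.potential_lipschitz {a b c : Fin (n + 1)}
    (hs : ∀ x, ¬ (J.A a x = true ∧ J.B b x = true ∧ J.C c x = true))
    {u v : Vertex (n + 1) d Q} (h : Step J Q u v) :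
    potential J a b c u ≤ potential J a b c v + 1 ∧
      potential J a b c v ≤ potential J a b c u + 1 := by
  cases h with
  | leaf σ i j => simp only [potential]; split_ifs <;> simp
  | hub σ i j => simp only [potential]; split_ifs <;> simp
  | hubs σ i j h => simp only [potential]; split_ifs <;> simp
  | coord σ i j x y h =>
    simp only [potential]
    split_ifs <;> simp_all
  | cross i k x y hx hy hx' hy' =>
    have h1 := hs x
    have h2 := hs y
    simp only [potential]
    by_cases hi : i = a <;> by_cases hk : k = c <;> simp_all <;> split_ifs <;> simp_all
  | pad t =>
    simp only [potential, eq_comm (a := (0 : Fin (n + 1)))]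
    split_ifs <;> simp

theorem exists_eight_le_edist (hs : J.HasSolution) :
    ∃ u v : Vertex (n + 1) d Q, 8 ≤ (graph J Q).edist u v := by
  obtain ⟨a, b, c, h⟩ := (hasSolution_iff J).1 hs
  -- The same vector b is used on both sides; the leaves contribute one step each at the two ends.
  refine ⟨.leaf 0 a b, .leaf 1 c b, ?_⟩
  refine SimpleGraph.le_edist_of_lipschitz (potential J a b c) (fun u v hadj => ?_) _ _ 8
    (by simp [potential])
  rcases graph_adj.1 hadj with h' | h'
  · exact (h'.potential_lipschitz h).2
  · exact (h'.potential_lipschitz h).1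

end OV3

namespace OV3

/-! ## Numbering the vertices and listing the edges -/

/-- The number of vertices of the graph. -/
def vertexCount (m d Q : ℕ) : ℕ := 2 * (m * m) + (2 * (m * m) + (2 * m + (2 * (m * (d * d)) + Q)))

/-- The number of a vertex. -/
def Vertex.code {m d Q : ℕ} : Vertex m d Q → ℕ
  | .leaf σ i j => σ * (m * m) + i * m + j
  | .pair σ i j => 2 * (m * m) + (σ * (m * m) + i * m + j)
  | .hub σ i => 4 * (m * m) + (σ * m + i)
  | .coord σ i x y => 4 * (m * m) + 2 * m + (σ * (m * (d * d)) + i * (d * d) + x * d + y)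
  | .pad t => 4 * (m * m) + 2 * m + 2 * (m * (d * d)) + t

/-- The vertices as a disjoint union. -/
def Vertex.equivSum (m d Q : ℕ) : Vertex m d Q ≃
    (Fin 2 × (Fin m × Fin m)) ⊕ ((Fin 2 × (Fin m × Fin m)) ⊕ ((Fin 2 × Fin m) ⊕
      ((Fin 2 × (Fin m × (Fin d × Fin d))) ⊕ Fin Q))) where
  toFun
    | .leaf σ i j => .inl (σ, i, j)
    | .pair σ i j => .inr (.inl (σ, i, j))
    | .hub σ i => .inr (.inr (.inl (σ, i)))
    | .coord σ i x y => .inr (.inr (.inr (.inl (σ, i, x, y))))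
    | .pad t => .inr (.inr (.inr (.inr t)))
  invFun
    | .inl (σ, i, j) => .leaf σ i j
    | .inr (.inl (σ, i, j)) => .pair σ i j
    | .inr (.inr (.inl (σ, i))) => .hub σ i
    | .inr (.inr (.inr (.inl (σ, i, x, y)))) => .coord σ i x y
    | .inr (.inr (.inr (.inr t))) => .pad t
  left_inv u := by cases u <;> rfl
  right_inv u := by rcases u with u | u | u | u | u <;> rfl

/-- `Fin l × X` is numbered lexicographically. -/
def prodNumbering {X : Type*} {T : ℕ} (l : ℕ) (e : X ≃ Fin T) : Fin l × X ≃ Fin (l * T) :=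
  (Equiv.prodCongr (Equiv.refl _) e).trans finProdFinEquiv

/-- `X ⊕ Y` is numbered starting with `X`. -/
def sumNumbering {X Y : Type*} {S T : ℕ} (e : X ≃ Fin S) (f : Y ≃ Fin T) : X ⊕ Y ≃ Fin (S + T) :=
  (Equiv.sumCongr e f).trans finSumFinEquiv

/-- The numbering of pairs of vectors on one of the two sides. -/
def pairNumbering (m : ℕ) : Fin 2 × (Fin m × Fin m) ≃ Fin (2 * (m * m)) :=
  prodNumbering 2 (prodNumbering m (Equiv.refl (Fin m)))

/-- The numbering of a vector together with two coordinates. -/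
def coordNumbering (m d : ℕ) : Fin m × (Fin d × Fin d) ≃ Fin (m * (d * d)) :=
  prodNumbering m (prodNumbering d (Equiv.refl (Fin d)))

/-- The numbering of the vertices. -/
def Vertex.numbering (m d Q : ℕ) : Vertex m d Q ≃ Fin (vertexCount m d Q) :=
  (Vertex.equivSum m d Q).trans <| sumNumbering (pairNumbering m) <|
    sumNumbering (pairNumbering m) <| sumNumbering (prodNumbering 2 (Equiv.refl (Fin m))) <|
      sumNumbering (prodNumbering 2 (coordNumbering m d)) (Equiv.refl (Fin Q))

/-- The equivalence provides bijectivity for free, while `code` is the arithmetic that the program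
performs; this identity connects the two. -/
theorem Vertex.numbering_val {m d Q : ℕ} (u : Vertex m d Q) :
    (Vertex.numbering m d Q u : ℕ) = u.code := by
  cases u with
  | leaf σ i j => change (j : ℕ) + m * i + m * m * σ = _; rw [Vertex.code]; ring
  | pair σ i j => change 2 * (m * m) + ((j : ℕ) + m * i + m * m * σ) = _; rw [Vertex.code]; ring
  | hub σ i =>
    change 2 * (m * m) + (2 * (m * m) + ((i : ℕ) + m * σ)) = _; rw [Vertex.code]; ring
  | coord σ i x y =>
    change 2 * (m * m) + (2 * (m * m) + (2 * m +
      ((y : ℕ) + d * x + d * d * i + m * (d * d) * σ))) = _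
    rw [Vertex.code]; ring
  | pad t =>
    change 2 * (m * m) + (2 * (m * m) + (2 * m + (2 * (m * (d * d)) + (t : ℕ)))) = _
    rw [Vertex.code]; ring

/-- The images under `f` of the elements with property `p`, in the order of the numbering `e`. -/
def phase {I X : Type*} {T : ℕ} (e : I ≃ Fin T) (p : I → Bool) (f : I → X) : List X :=
  (((List.finRange T).map e.symm).filter p).map f

theorem mem_phase {I X : Type*} {T : ℕ} {e : I ≃ Fin T} {p : I → Bool} {f : I → X} {x : X} :
    x ∈ phase e p f ↔ ∃ i, p i = true ∧ f i = x := by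
  simp only [phase, List.mem_map, List.mem_filter, List.mem_finRange, true_and]
  exact exists_congr fun i => and_congr_left fun _ =>
    ⟨fun h => h.2, fun h => ⟨⟨e i, by simp⟩, h⟩⟩

theorem nodup_phase {I X : Type*} {T : ℕ} {e : I ≃ Fin T} {p : I → Bool} {f : I → X}
    (hf : Function.Injective f) : (phase e p f).Nodup :=
  (((List.nodup_finRange T).map e.symm.injective).filter _).map hf

theorem length_phase_le {I X : Type*} {T : ℕ} {e : I ≃ Fin T} {p : I → Bool} {f : I → X} :
    (phase e p f).length ≤ T := by
  simp only [phase, List.length_map]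
  exact (List.length_filter_le _ _).trans (by simp)

variable {n d : ℕ}

/-- All edges of the graph, each in one direction. -/
def edges (J : OV3 (n + 1) d) (Q : ℕ) : List (Vertex (n + 1) d Q × Vertex (n + 1) d Q) :=
  phase (pairNumbering (n + 1)) (fun _ => true) (fun p => (.leaf p.1 p.2.1 p.2.2,
    .pair p.1 p.2.1 p.2.2)) ++
  (phase (pairNumbering (n + 1)) (fun _ => true) (fun p => (.hub p.1 p.2.1,
    .pair p.1 p.2.1 p.2.2)) ++
  (phase (pairNumbering (n + 1)) (fun p => decide (p.2.1 < p.2.2)) (fun p => (.hub p.1 p.2.1,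
    .hub p.1 p.2.2)) ++
  (phase (prodNumbering 2 (prodNumbering (n + 1) (coordNumbering (n + 1) d)))
    (fun p => J.B p.2.2.1 p.2.2.2.1) (fun p => (.pair p.1 p.2.1 p.2.2.1,
      .coord p.1 p.2.1 p.2.2.2.1 p.2.2.2.2)) ++
  (phase (prodNumbering (n + 1) (coordNumbering (n + 1) d))
    (fun p => J.A p.1 p.2.2.1 && J.A p.1 p.2.2.2 && J.C p.2.1 p.2.2.1 && J.C p.2.1 p.2.2.2)
    (fun p => (.coord 0 p.1 p.2.2.1 p.2.2.2, .coord 1 p.2.1 p.2.2.2 p.2.2.1)) ++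
  phase (Equiv.refl (Fin Q)) (fun _ => true) (fun t => (.pad t, .pair 0 0 0))))))

variable {J : OV3 (n + 1) d} {Q : ℕ}

theorem mem_edges {u v : Vertex (n + 1) d Q} : (u, v) ∈ edges J Q ↔ Step J Q u v := by
  simp only [edges, List.mem_append, mem_phase, Prod.exists, Prod.mk.injEq, Bool.and_eq_true,
    decide_eq_true_eq, true_and]
  constructor
  · rintro (⟨σ, i, j, rfl, rfl⟩ | ⟨σ, i, j, rfl, rfl⟩ | ⟨σ, i, j, h, rfl, rfl⟩ |
      ⟨σ, i, j, x, y, h, rfl, rfl⟩ | ⟨i, k, x, y, ⟨⟨⟨h1, h2⟩, h3⟩, h4⟩, rfl, rfl⟩ | ⟨t, rfl, rfl⟩)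
    · exact .leaf ..
    · exact .hub ..
    · exact .hubs _ _ _ h
    · exact .coord _ _ _ _ _ h
    · exact .cross _ _ _ _ h1 h2 h3 h4
    · exact .pad _
  · rintro (_ | _ | h | h | ⟨i, k, x, y, h1, h2, h3, h4⟩ | _) <;> simp_all

theorem nodup_edges : (edges J Q).Nodup := by
  unfold edges
  have dis : ∀ {X : Type} {l₁ l₂ : List X}, l₁.Nodup → l₂.Nodup → (∀ x ∈ l₁, x ∉ l₂) →
      (l₁ ++ l₂).Nodup := fun h1 h2 h => List.nodup_append'.2 ⟨h1, h2, h⟩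
  -- Within a phase the edge determines the index, and edges from different phases differ in the
  -- constructors of their endpoints.
  repeat' apply dis
  all_goals first
    | (apply nodup_phase; intro p q; simp [Prod.ext_iff]; done)
    | (apply nodup_phase; intro p q; simp [Prod.ext_iff]; tauto)
    | (rintro ⟨u, v⟩ h h'; simp only [List.mem_append, mem_phase, Prod.mk.injEq] at h h'
       obtain ⟨p, -, rfl, rfl⟩ := h; simp at h')

/-- Excludes that an undirected edge is listed twice, once in each direction. For hubs this is the
purpose of the condition `i < j`. -/
theorem Step.asymm {u v : Vertex (n + 1) d Q} (h : Step J Q u v) : ¬ Step J Q v u := by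
  rintro h'
  cases h <;> cases h'
  rename_i h1 h2
  exact lt_asymm h1 h2

/-- The first three phases have at most 2m² edges each, where m = n + 1; the two phases with
coordinates have at most 2m²d² and m²d². -/
theorem length_edges_le :
    (edges J Q).length ≤ 6 * ((n + 1) * (n + 1)) + 3 * ((n + 1) * ((n + 1) * (d * d))) + Q := by
  simp only [edges, List.length_append]
  have h := @length_phase_le
  refine (Nat.add_le_add (h ..) (Nat.add_le_add (h ..) (Nat.add_le_add (h ..)
    (Nat.add_le_add (h ..) (Nat.add_le_add (h ..) (h ..)))))).trans ?_
  apply le_of_eq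
  ring

/-- The graph on the numbers of the vertices. -/
def finGraph (J : OV3 (n + 1) d) (Q : ℕ) : SimpleGraph (Fin (vertexCount (n + 1) d Q)) :=
  (graph J Q).comap (Vertex.numbering (n + 1) d Q).symm

/-- The two graphs are isomorphic. -/
def finGraphIso (J : OV3 (n + 1) d) (Q : ℕ) : finGraph J Q ≃g graph J Q :=
  SimpleGraph.Iso.comap (Vertex.numbering (n + 1) d Q).symm (graph J Q)

/-- The endpoints of the edges, one edge after the other. -/
def edgeCodes (J : OV3 (n + 1) d) (Q : ℕ) : List ℕ :=
  (edges J Q).flatMap fun e => [e.1.code, e.2.code]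

/-- The representation of the graph as a list of numbers. -/
def graphCode (J : OV3 (n + 1) d) (Q : ℕ) : List ℕ :=
  vertexCount (n + 1) d Q :: (edges J Q).length :: edgeCodes J Q

theorem length_edgeCodes : (edgeCodes J Q).length = 2 * (edges J Q).length := by
  rw [edgeCodes, List.length_flatMap]
  simp [mul_comm]

theorem encodesGraph_graphCode : EncodesGraph (finGraph J Q) (graphCode J Q) := by
  let e := Vertex.numbering (n + 1) d Q
  refine ⟨(edges J Q).map (Prod.map e e), ?_, ?_, ?_⟩
  · rw [List.map_map]
    refine List.Nodup.map_on ?_ nodup_edges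
    rintro ⟨u, v⟩ h ⟨u', v'⟩ h' heq
    rw [mem_edges] at h h'
    simp only [Function.comp_apply, Prod.map_apply, Sym2.eq_iff, EmbeddingLike.apply_eq_iff_eq]
      at heq
    rcases heq with ⟨rfl, rfl⟩ | ⟨rfl, rfl⟩
    · rfl
    · exact absurd h' h.asymm
  · intro z
    induction z using Sym2.ind with
    | _ u v =>
      simp only [SimpleGraph.mem_edgeSet, List.mem_map, Prod.exists, Prod.map_apply,
        Prod.mk.injEq]
      rw [finGraph, SimpleGraph.comap_adj, graph_adj]
      constructor
      · rintro (h | h)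
        · exact ⟨u, v, ⟨_, _, mem_edges.2 h, by simp [e], by simp [e]⟩, rfl⟩
        · exact ⟨v, u, ⟨_, _, mem_edges.2 h, by simp [e], by simp [e]⟩, Sym2.eq_swap⟩
      · rintro ⟨a, b, ⟨a', b', h, rfl, rfl⟩, heq⟩
        rw [mem_edges] at h
        rcases Sym2.eq_iff.1 heq with ⟨rfl, rfl⟩ | ⟨rfl, rfl⟩
        · left; simpa [e] using h
        · right; simpa [e] using h
  · simp only [graphCode, List.length_map, edgeCodes, List.flatMap_map, Prod.map_fst, Prod.map_snd]
    simp [e, Vertex.numbering_val]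

theorem ncard_edgeSet_finGraph_le : (finGraph J Q).edgeSet.ncard ≤
    6 * ((n + 1) * (n + 1)) + 3 * ((n + 1) * ((n + 1) * (d * d))) + Q := by
  obtain ⟨es, -, h, hx⟩ := encodesGraph_graphCode (J := J) (Q := Q)
  have hlen : es.length = (edges J Q).length := by
    have := congrArg (fun l => l.getD 1 0) hx
    simpa [graphCode] using this.symm
  have : (finGraph J Q).edgeSet = ((es.map fun e => s(e.1, e.2)).toFinset : Set _) := by
    ext z
    simpa using h z
  rw [this, Set.ncard_coe_finset]
  exact (List.toFinset_card_le _).trans (by simpa [hlen] using length_edges_le)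

theorem finGraph_edist_le_five (hJ : ∀ x, J.B (Fin.last n) x = true) (hs : ¬ J.HasSolution)
    (u v : Fin (vertexCount (n + 1) d Q)) : (finGraph J Q).edist u v ≤ 5 := by
  rw [← (finGraphIso J Q).edist_eq]
  exact edist_le_five hJ hs _ _

theorem finGraph_exists_eight_le_edist (hs : J.HasSolution) :
    ∃ u v, 8 ≤ (finGraph J Q).edist u v := by
  obtain ⟨u, v, h⟩ := exists_eight_le_edist (Q := Q) hs
  exact ⟨(finGraphIso J Q).symm u, (finGraphIso J Q).symm v, by
    rwa [← (finGraphIso J Q).edist_eq, RelIso.apply_symm_apply, RelIso.apply_symm_apply]⟩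

theorem finGraph_connected (hd : 0 < d) (hA : ∀ x, J.A (Fin.last n) x = true)
    (hB : ∀ x, J.B (Fin.last n) x = true) (hC : ∀ x, J.C (Fin.last n) x = true) :
    (finGraph J Q).Connected :=
  (finGraphIso J Q).connected_iff.2 (graph_connected hd hA hB hC)

end OV3

namespace WordRAM

/-! ## Expressions and commands, and their compilation -/

/-- Allows the diameter program, whose words are bounded in terms of its own input, to run as part
of a program with longer words. -/
theorem Exec.mono {B B' : ℕ} (h : B ≤ B') {p : Prog} {s s' : State} {t : ℕ}
    (he : Exec B p s s' t) : Exec B' p s s' t := by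
  induction he with
  | skip s => exact .skip s
  | const s r k hk => exact .const s r k (hk.trans_le h)
  | op s o r a b hk => exact .op s o r a b (hk.trans_le h)
  | load s r a hk => exact .load s r a (hk.trans_le h)
  | store s a r => exact .store s a r
  | seq _ _ ih₁ ih₂ => exact .seq ih₁ ih₂
  | ite_true q hr _ ih => exact .ite_true q hr ih
  | ite_false p hr _ ih => exact .ite_false p hr ih
  | while_done p hr => exact .while_done p hr
  | while_step hr _ _ ih₁ ih₂ => exact .while_step hr ih₁ ih₂

/-- Expressions in registers, constants, operations and memory contents. -/
inductive Expr
  | reg (r : ℕ)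
  | lit (k : ℕ)
  | op (o : Op) (a b : Expr)
  | load (a : Expr)

namespace Expr

/-- The value of an expression in a state. -/
def eval (s : State) : Expr → ℕ
  | reg r => s.reg r
  | lit k => k
  | op o a b => o.eval (a.eval s) (b.eval s)
  | load a => s.mem (a.eval s)

/-- The expression uses only the registers below `100`, and no left shifts. -/
def wf : Expr → Bool
  | reg r => decide (r < 100)
  | lit _ => true
  | op o a b => (match o with | .shl => false | _ => true) && a.wf && b.wf
  | load a => a.wf

/-- An exponent that bounds all intermediate values, see `eval_le`. -/
def size : Expr → ℕ
  | reg _ => 1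
  | lit k => k + 1
  | op _ a b => a.size + b.size
  | load a => a.size

/-- The number of steps that the evaluation of an expression takes. -/
def cost : Expr → ℕ
  | reg _ => 1
  | lit _ => 1
  | op _ a b => a.cost + (b.cost + (1 + 1))
  | load a => a.cost + 1

/-- A program that evaluates an expression and writes the value to the register `k`.  It uses the
registers above `k` as a stack and leaves them with the value `0`. -/
def compile : Expr → ℕ → Prog
  | reg r, k => .op .and k r r
  | lit c, k => .const k c
  | op o a b, k =>
    .seq (a.compile k) (.seq (b.compile (k + 1)) (.seq (.op o k k (k + 1)) (.const (k + 1) 0)))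
  | load a, k => .seq (a.compile k) (.load k k)

theorem one_le_size (e : Expr) : 1 ≤ e.size := by
  induction e <;> simp only [size] <;> omega

end Expr

/-- All numbers in the registers and the memory are at most `V`. -/
def State.BoundedBy (V : ℕ) (s : State) : Prop := (∀ r, s.reg r ≤ V) ∧ ∀ a, s.mem a ≤ V

/-- Induction by removing the last binary digit. For `a = 0` halving does not decrease `a`, hence
the inner induction on `b`. -/
theorem bitwise_le_add {f : ℕ → ℕ → ℕ} (h0 : f 0 0 = 0) (hdiv : ∀ a b, f a b / 2 = f (a / 2) (b / 2))
    (hmod : ∀ a b, f a b % 2 ≤ a % 2 + b % 2) (a b : ℕ) : f a b ≤ a + b := by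
  induction a using Nat.strong_induction_on generalizing b with
  | _ a iha =>
    induction b using Nat.strong_induction_on with
    | _ b ihb =>
      have h1 := hdiv a b
      have h2 := hmod a b
      by_cases ha : a = 0
      · by_cases hb : b = 0
        · simp [ha, hb, h0]
        · have := ihb (b / 2) (by omega)
          have h3 : a / 2 = a := by omega
          rw [h3] at h1
          omega
      · have := iha (a / 2) (by omega) (b / 2)
        omega

theorem or_le_add (a b : ℕ) : a ||| b ≤ a + b :=
  bitwise_le_add (f := (· ||| ·)) rfl (fun _ _ => Nat.or_div_two)
    (fun a b => by
      have := Nat.or_mod_two_pow (a := a) (b := b) (n := 1)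
      rcases Nat.mod_two_eq_zero_or_one a with h | h <;>
        rcases Nat.mod_two_eq_zero_or_one b with h' | h' <;> simp_all <;> omega) a b

theorem xor_le_add (a b : ℕ) : a ^^^ b ≤ a + b :=
  bitwise_le_add (f := (· ^^^ ·)) rfl (fun _ _ => Nat.xor_div_two)
    (fun a b => by
      have := Nat.xor_mod_two_pow (a := a) (b := b) (n := 1)
      rcases Nat.mod_two_eq_zero_or_one a with h | h <;>
        rcases Nat.mod_two_eq_zero_or_one b with h' | h' <;> simp_all) a b

/-- Exponents add for products, and `2 ≤ V` makes the sum of two powers no larger than their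
product. A left shift has no such polynomial bound and is excluded. -/
theorem Op.eval_le_pow {V p q a b : ℕ} (hV : 2 ≤ V) (hp : 1 ≤ p) (hq : 1 ≤ q) (ha : a ≤ V ^ p)
    (hb : b ≤ V ^ q) (o : Op) (ho : o ≠ .shl) : o.eval a b ≤ V ^ (p + q) := by
  have hP : 2 ≤ V ^ p := hV.trans (Nat.le_self_pow (by omega) V)
  have hQ : 2 ≤ V ^ q := hV.trans (Nat.le_self_pow (by omega) V)
  have hadd : V ^ p + V ^ q ≤ V ^ (p + q) := by rw [pow_add]; nlinarith
  have hone : 1 ≤ V ^ (p + q) := by omega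
  cases o with
  | add => simp only [eval]; omega
  | sub => simp only [eval]; omega
  | mul => simp only [eval, pow_add]; exact Nat.mul_le_mul ha hb
  | div => simp only [eval]; exact (Nat.div_le_self a b).trans (by omega)
  | mod => simp only [eval]; exact (Nat.mod_le a b).trans (by omega)
  | and => simp only [eval]; exact Nat.and_le_left.trans (by omega)
  | or =>
    simp only [eval]
    exact (or_le_add a b).trans (by omega)
  | xor =>
    simp only [eval]
    exact (xor_le_add a b).trans (by omega)
  | shl => exact absurd rfl ho
  | shr => simp only [eval]; exact (Nat.shiftRight_le a b).trans (by omega)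
  | lt => simp only [eval]; split_ifs <;> omega
  | eq => simp only [eval]; split_ifs <;> omega

theorem Expr.eval_le {V : ℕ} (hV : 2 ≤ V) {s : State} (hs : s.BoundedBy V) :
    ∀ e : Expr, e.wf = true → e.eval s ≤ V ^ e.size
  | .reg r, _ => by simpa [eval, size] using hs.1 r
  | .lit k, _ => (Nat.lt_pow_self (n := k + 1) (by omega : 1 < V)).le.trans' (Nat.le_succ k)
  | .op o a b, h => by
    simp only [wf, Bool.and_eq_true] at h
    refine Op.eval_le_pow hV a.one_le_size b.one_le_size (a.eval_le hV hs h.1.2)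
      (b.eval_le hV hs h.2) o ?_
    rintro rfl
    simp at h
  | .load a, _ => (hs.2 _).trans (Nat.le_self_pow (by have := a.one_le_size; simp [size]; omega) V)

theorem State.setReg_setReg (s : State) (r v w : ℕ) :
    (s.setReg r v).setReg r w = s.setReg r w := by
  simp [State.setReg]

theorem State.setReg_eq_self (s : State) {r v : ℕ} (h : s.reg r = v) : s.setReg r v = s := by
  subst h
  simp [State.setReg]

theorem State.setReg_comm (s : State) {r r' : ℕ} (h : r ≠ r') (v w : ℕ) :
    (s.setReg r v).setReg r' w = (s.setReg r' w).setReg r v := by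
  simp [State.setReg, Function.update_comm h]

theorem Expr.eval_setReg {s : State} {k v : ℕ} (hk : 100 ≤ k) :
    ∀ e : Expr, e.wf = true → e.eval (s.setReg k v) = e.eval s
  | .reg r, h => by
    have : r < 100 := by simpa [wf] using h
    simp [eval, State.setReg, Function.update_of_ne (show r ≠ k by omega)]
  | .lit c, _ => rfl
  | .op o a b, h => by
    simp only [wf, Bool.and_eq_true] at h
    simp only [eval, a.eval_setReg hk h.1.2, b.eval_setReg hk h.2]
  | .load a, h => by
    simp only [wf] at h
    simp only [eval, a.eval_setReg hk h]
    rfl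

theorem State.BoundedBy.setReg {V v r : ℕ} {s : State} (hs : s.BoundedBy V) (hv : v ≤ V) :
    (s.setReg r v).BoundedBy V := by
  refine ⟨fun r' => ?_, hs.2⟩
  by_cases h : r' = r
  · subst h; simpa [State.setReg] using hv
  · simpa [State.setReg, h] using hs.1 r'

theorem State.BoundedBy.setMem {V v a : ℕ} {s : State} (hs : s.BoundedBy V) (hv : v ≤ V) :
    (s.setMem a v).BoundedBy V := by
  refine ⟨hs.1, fun r' => ?_⟩
  by_cases h : r' = a
  · subst h; simpa [State.setMem] using hv
  · simpa [State.setMem, h] using hs.2 r'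

/-- All intermediate values of the evaluation of an expression are below `B`. -/
def Expr.Fits (B : ℕ) (s : State) : Expr → Prop
  | .reg r => s.reg r < B
  | .lit k => k < B
  | .op o a b => a.Fits B s ∧ b.Fits B s ∧ o.eval (a.eval s) (b.eval s) < B
  | .load a => a.Fits B s ∧ s.mem (a.eval s) < B

theorem Expr.fits {V B : ℕ} (hV : 2 ≤ V) {s : State} (hs : s.BoundedBy V) :
    ∀ e : Expr, e.wf = true → V ^ e.size < B → e.Fits B s
  | .reg r, h, hB => ((Expr.reg r).eval_le hV hs h).trans_lt hB
  | .lit k, h, hB => ((Expr.lit k).eval_le hV hs h).trans_lt hB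
  | .op o a b, h, hB => by
    have h' := h
    simp only [wf, Bool.and_eq_true] at h
    have hmono : ∀ k ≤ (op o a b).size, V ^ k < B := fun k hk =>
      (Nat.pow_le_pow_right (by omega) hk).trans_lt hB
    exact ⟨a.fits hV hs h.1.2 (hmono _ (by simp [size])), b.fits hV hs h.2 (hmono _ (by simp [size])),
      ((Expr.op o a b).eval_le hV hs h').trans_lt hB⟩
  | .load a, h, hB => ⟨a.fits hV hs h hB, ((Expr.load a).eval_le hV hs h).trans_lt hB⟩

theorem Expr.Fits.setReg {B : ℕ} {s : State} {k v : ℕ} (hk : 100 ≤ k) : ∀ e : Expr, e.wf = true →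
    e.Fits B s → e.Fits B (s.setReg k v)
  | .reg r, h, hf => by
    have : r < 100 := by simpa [wf] using h
    change (s.setReg k v).reg r < B
    simpa [State.setReg, Function.update_of_ne (show r ≠ k by omega)] using
      (show s.reg r < B from hf)
  | .lit c, _, hf => hf
  | .op o a b, h, hf => by
    simp only [wf, Bool.and_eq_true] at h
    exact ⟨Fits.setReg hk a h.1.2 hf.1, Fits.setReg hk b h.2 hf.2.1, by
      rw [a.eval_setReg hk h.1.2, b.eval_setReg hk h.2]; exact hf.2.2⟩
  | .load a, h, hf => ⟨Fits.setReg hk a h hf.1, by rw [a.eval_setReg hk h]; exact hf.2⟩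

/-- Stack discipline: the left operand waits in register `k` while the right one is evaluated from
`k + 1` on. This does not disturb the evaluation, since well-formed expressions read only registers
below 100. -/
theorem Expr.exec_compile {B : ℕ} (hB : 0 < B) : ∀ (e : Expr) (k : ℕ) (s : State), e.wf = true →
    100 ≤ k → (∀ r, k < r → s.reg r = 0) → e.Fits B s →
      Exec B (e.compile k) s (s.setReg k (e.eval s)) e.cost
  | .reg r, k, s, _, _, _, hf => by
    -- The bitwise conjunction of a register with itself serves as a copy instruction.
    have := Exec.op (B := B) s .and k r r (by simpa [Op.eval] using (show s.reg r < B from hf))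
    simpa [Op.eval, Expr.compile, Expr.eval, Expr.cost] using this
  | .lit c, k, s, _, _, _, hf => Exec.const s k c hf
  | .load a, k, s, hw, hk, hs, hf => by
    refine Exec.seq (a.exec_compile hB k s hw hk hs hf.1) ?_
    have := Exec.load (B := B) (s.setReg k (a.eval s)) k k
      (by simpa [State.setReg] using hf.2)
    rw [State.setReg_setReg] at this
    simpa [State.setReg, Expr.eval] using this
  | .op o a b, k, s, hw, hk, hs, hf => by
    simp only [wf, Bool.and_eq_true] at hw
    have h1 := a.exec_compile hB k s hw.1.2 hk hs hf.1
    have hfb : b.Fits B (s.setReg k (a.eval s)) := Fits.setReg hk b hw.2 hf.2.1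
    have h2 := b.exec_compile hB (k + 1) (s.setReg k (a.eval s)) hw.2 (by omega)
      (fun r hr => by
        simpa [State.setReg, Function.update_of_ne (show r ≠ k by omega)] using hs r (by omega)) hfb
    rw [b.eval_setReg hk hw.2] at h2
    refine Exec.seq h1 (Exec.seq h2 ?_)
    have h3 := Exec.op (B := B) ((s.setReg k (a.eval s)).setReg (k + 1) (b.eval s)) o k k (k + 1)
      (by simpa [State.setReg] using hf.2.2)
    have h4 := Exec.const (B := B) (((s.setReg k (a.eval s)).setReg (k + 1) (b.eval s)).setReg k
      (o.eval (a.eval s) (b.eval s))) (k + 1) 0 hB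
    refine Exec.seq (by simpa [State.setReg] using h3) ?_
    have hk1 := hs (k + 1) (by omega)
    -- Resetting register `k + 1` restores its original content, which was 0, so the net effect is
    -- confined to register `k`.
    suffices h : s.setReg k ((Expr.op o a b).eval s) = _ by rw [h]; exact h4
    simp only [State.setReg, State.mk.injEq, and_true]
    funext r
    by_cases hr : r = k + 1
    · subst hr; simp [hk1]
    · by_cases hr' : r = k
      · subst hr'; simp [Expr.eval]
      · simp [hr, hr']

/-- Commands. -/
inductive Cmd
  /-- `reg r := e` -/
  | assign (r : ℕ) (e : Expr)
  /-- `mem a := v` -/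
  | store (a v : Expr)
  | seq (c₁ c₂ : Cmd)
  /-- run the command if the value of `e` is not `0` -/
  | when (e : Expr) (c : Cmd)
  /-- run the command for the values `0, …, reg n - 1` of the register `r` -/
  | loop (r n : ℕ) (c : Cmd)

namespace Cmd

/-- The increment of the counter of a loop and the test whether it has reached its end. -/
def next (r n : ℕ) : Prog := .seq ((Expr.op .add (.reg r) (.lit 1)).compile 100)
  (.seq (.op .and r 100 100) ((Expr.op .lt (.reg r) (.reg n)).compile 100))

/-- The program of a command. -/
def compile : Cmd → Prog
  | assign r e => .seq (e.compile 100) (.seq (.op .and r 100 100) (.const 100 0))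
  | store a v => .seq (a.compile 100) (.seq (v.compile 101) (.seq (.store 100 101)
      (.seq (.const 100 0) (.const 101 0))))
  | seq c₁ c₂ => .seq c₁.compile c₂.compile
  | when e c => .seq (e.compile 100) (.ite 100 (.seq (.const 100 0) c.compile) .skip)
  | loop r n c => .seq (.const r 0) (.seq ((Expr.op .lt (.reg r) (.reg n)).compile 100)
      (.while 100 (.seq (.const 100 0) (.seq c.compile (next r n)))))

/-- An upper bound for the exponents `Expr.size` of the expressions in a command. -/
def size : Cmd → ℕ
  | assign _ e => e.size
  | store a v => a.size + v.size
  | seq c₁ c₂ => c₁.size + c₂.size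
  | when e c => e.size + c.size
  | loop _ _ c => c.size + 3

/-- A factor for the running time of a command, see `Triple`. -/
def cost : Cmd → ℕ
  | assign _ e => e.cost + 2
  | store a v => a.cost + v.cost + 3
  | seq c₁ c₂ => c₁.cost + c₂.cost
  | when e c => e.cost + c.cost + 2
  | loop _ _ c => c.cost + 15

end Cmd

/-! ### Rules for correctness, running time and word size of commands -/

/-- The registers that serve for the evaluation of expressions are `0`. -/
def State.Clean (s : State) : Prop := ∀ r, 100 ≤ r → s.reg r = 0

/-- Started in the state `s`, the command `c` halts in a state that satisfies `Q`, within
`(U + 1) * c.cost` steps and without a number that exceeds `V ^ c.size`.  The registers and the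
memory stay bounded by `V`. -/
def Triple (U V : ℕ) (c : Cmd) (s : State) (Q : State → Prop) : Prop :=
  s.Clean → s.BoundedBy V → 2 ≤ V → ∀ B, V ^ c.size < B → ∃ s' t, Exec B c.compile s s' t ∧
    t ≤ (U + 1) * c.cost ∧ s'.Clean ∧ s'.BoundedBy V ∧ Q s'

variable {U V : ℕ} {s : State} {Q : State → Prop}

theorem State.Clean.setReg (h : s.Clean) {r v : ℕ} (hr : r < 100) : (s.setReg r v).Clean := by
  intro r' hr'
  simpa [State.setReg, Function.update_of_ne (show r' ≠ r by omega)] using h r' hr'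

theorem State.Clean.exec {B : ℕ} (h : s.Clean) (hs : s.BoundedBy V) (hV : 2 ≤ V) {e : Expr}
    (he : e.wf = true) (hB : V ^ e.size < B) :
    Exec B (e.compile 100) s (s.setReg 100 (e.eval s)) e.cost :=
  e.exec_compile (by omega) 100 s he le_rfl (fun r hr => h r hr.le) (e.fits hV hs he hB)

theorem Triple.assign {r : ℕ} {e : Expr} (hr : r < 100) (he : e.wf = true) (hv : e.eval s ≤ V)
    (hQ : Q (s.setReg r (e.eval s))) : Triple U V (.assign r e) s Q := by
  intro hc hb hV B hB
  have h0 : 0 < B := by omega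
  have hev : e.eval s < B := (e.eval_le hV hb he).trans_lt hB
  refine ⟨_, _, .seq (hc.exec hb hV he hB) (.seq (.op _ .and r 100 100 ?_) (.const _ 100 0 h0)), ?_,
    ?_⟩
  · simpa [Op.eval, State.setReg] using hev
  · simp only [Cmd.cost]
    nlinarith
  · have : (((s.setReg 100 (e.eval s)).setReg r (Op.and.eval ((s.setReg 100 (e.eval s)).reg 100)
        ((s.setReg 100 (e.eval s)).reg 100))).setReg 100 0) = s.setReg r (e.eval s) := by
      rw [State.setReg_comm _ (by omega : (100 : ℕ) ≠ r), State.setReg_setReg, State.setReg_eq_self]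
      · simp [State.setReg, Op.eval]
      · simpa [State.setReg, Function.update_of_ne (show 100 ≠ r by omega)] using hc 100 le_rfl
    rw [this]
    exact ⟨hc.setReg hr, hb.setReg hv, hQ⟩

theorem Triple.store {a v : Expr} (ha : a.wf = true) (hv : v.wf = true) (hle : v.eval s ≤ V)
    (hQ : Q (s.setMem (a.eval s) (v.eval s))) : Triple U V (.store a v) s Q := by
  intro hc hb hV B hB
  have h0 : 0 < B := by omega
  have hmono : ∀ k ≤ (Cmd.store a v).size, V ^ k < B := fun k hk =>
      (Nat.pow_le_pow_right (by omega) hk).trans_lt hB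
  have h1 := hc.exec hb hV ha (hmono _ (by simp [Cmd.size]))
  have hfit : v.Fits B (s.setReg 100 (a.eval s)) :=
    Expr.Fits.setReg le_rfl v hv (v.fits hV hb hv (hmono _ (by simp [Cmd.size])))
  have h2 := v.exec_compile h0 101 (s.setReg 100 (a.eval s)) hv (by omega) (fun r hr => by
    simpa [State.setReg, Function.update_of_ne (show r ≠ 100 by omega)] using hc r (by omega)) hfit
  rw [v.eval_setReg le_rfl hv] at h2
  refine ⟨_, _, .seq h1 (.seq h2 (.seq (.store _ 100 101) (.seq (.const _ 100 0 h0)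
    (.const _ 101 0 h0)))), ?_, ?_⟩
  · simp only [Cmd.cost]
    nlinarith
  · have : (((((s.setReg 100 (a.eval s)).setReg 101 (v.eval s)).setMem
        (((s.setReg 100 (a.eval s)).setReg 101 (v.eval s)).reg 100)
        (((s.setReg 100 (a.eval s)).setReg 101 (v.eval s)).reg 101)).setReg 100 0).setReg 101 0) =
        s.setMem (a.eval s) (v.eval s) := by
      have h100 := hc 100 le_rfl
      have h101 := hc 101 (by omega)
      simp only [State.setMem, State.setReg, State.mk.injEq]
      constructor
      · funext r
        by_cases hr : r = 101
        · subst hr; simp [h101]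
        · by_cases hr' : r = 100
          · subst hr'; simp [h100]
          · simp [hr, hr']
      · simp
    rw [this]
    exact ⟨hc, hb.setMem hle, hQ⟩

theorem Triple.seq {c₁ c₂ : Cmd} {P : State → Prop} (h₁ : Triple U V c₁ s P)
    (h₂ : ∀ s', P s' → Triple U V c₂ s' Q) : Triple U V (.seq c₁ c₂) s Q := by
  intro hc hb hV B hB
  have hmono : ∀ k ≤ (Cmd.seq c₁ c₂).size, V ^ k < B := fun k hk =>
      (Nat.pow_le_pow_right (by omega) hk).trans_lt hB
  obtain ⟨s₁, t₁, e₁, ht₁, hc₁, hb₁, hP⟩ := h₁ hc hb hV B (hmono _ (by simp [Cmd.size]))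
  obtain ⟨s₂, t₂, e₂, ht₂, hc₂, hb₂, hQ⟩ := h₂ s₁ hP hc₁ hb₁ hV B (hmono _ (by simp [Cmd.size]))
  exact ⟨s₂, t₁ + t₂, .seq e₁ e₂, by simp only [Cmd.cost]; linarith, hc₂, hb₂, hQ⟩

theorem Triple.mono {U' : ℕ} (hU : U ≤ U') {c : Cmd} {P : State → Prop} (h : Triple U V c s P)
    (hPQ : ∀ s', P s' → Q s') : Triple U' V c s Q := by
  intro hc hb hV B hB
  obtain ⟨s₁, t₁, e₁, ht₁, hc₁, hb₁, hP⟩ := h hc hb hV B hB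
  exact ⟨s₁, t₁, e₁, ht₁.trans (Nat.mul_le_mul_right _ (by omega)), hc₁, hb₁, hPQ _ hP⟩

theorem Triple.when {e : Expr} {c : Cmd} (he : e.wf = true)
    (h₁ : e.eval s ≠ 0 → Triple U V c s Q) (h₂ : e.eval s = 0 → Q s) :
    Triple U V (.when e c) s Q := by
  intro hc hb hV B hB
  have h0 : 0 < B := by omega
  have hmono : ∀ k ≤ (Cmd.when e c).size, V ^ k < B := fun k hk =>
      (Nat.pow_le_pow_right (by omega) hk).trans_lt hB
  have h1 := hc.exec hb hV he (hmono _ (by simp [Cmd.size]))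
  have hclean : (s.setReg 100 (e.eval s)).setReg 100 0 = s := by
    rw [State.setReg_setReg, State.setReg_eq_self _ (hc 100 le_rfl)]
  by_cases hz : e.eval s = 0
  · have h2 := Exec.ite_false (B := B) (r := 100) (s := s.setReg 100 (e.eval s))
      (.seq (.const 100 0) c.compile) (by simpa [State.setReg] using hz) (.skip _)
    refine ⟨_, _, .seq h1 h2, ?_, ?_⟩
    · simp only [Cmd.cost]
      nlinarith
    · rw [hz, State.setReg_eq_self _ (hc 100 le_rfl)]
      exact ⟨hc, hb, h₂ hz⟩
  · obtain ⟨s₁, t₁, e₁, ht₁, hc₁, hb₁, hQ⟩ := h₁ hz hc hb hV B (hmono _ (by simp [Cmd.size]))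
    have h2 := Exec.const (B := B) (s.setReg 100 (e.eval s)) 100 0 h0
    rw [hclean] at h2
    refine ⟨_, _, .seq h1 (.ite_true _ (by simpa [State.setReg] using hz) (.seq h2 e₁)), ?_,
      hc₁, hb₁, hQ⟩
    simp only [Cmd.cost]
    nlinarith

/-- The body is required to satisfy its triple with `U = 0`, that is, to run in at most `c.cost`
steps; so loops in the body are effectively ruled out and `N ≤ U` iterations give the linear bound.
The invariant `I t` describes the state in which the counter has already been set to `t`. -/
theorem Triple.loop {r n N : ℕ} {c : Cmd} (hr : r < 100) (hn : n < 100) (hN : s.reg n = N)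
    (hU : N ≤ U) (I : ℕ → State → Prop) (h0 : I 0 (s.setReg r 0))
    (hI : ∀ t s', I t s' → s'.reg r = t ∧ s'.reg n = N)
    (hstep : ∀ t s', t < N → I t s' →
      Triple 0 V c s' fun s'' => s''.reg r = t ∧ I (t + 1) (s''.setReg r (t + 1)))
    (hQ : ∀ s', I N s' → Q s') : Triple U V (.loop r n c) s Q := by
  intro hc hb hV B hB
  have hB0 : 0 < B := by omega
  have hmono : ∀ k ≤ (Cmd.loop r n c).size, V ^ k < B := fun k hk =>
      (Nat.pow_le_pow_right (by omega) hk).trans_lt hB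
  have hNV : N ≤ V := hN ▸ hb.1 n
  set test := Expr.op .lt (.reg r) (.reg n) with htest
  have wtest : test.wf = true := by simp [htest, Expr.wf, hr, hn]
  -- At the head of the loop the result of the test is in register 100 and `k` iterations remain.
  -- Counter, test and branch cost 11 steps per iteration, which the constant 15 covers.
  have key : ∀ k t s', t + k = N → I t s' → s'.Clean → s'.BoundedBy V →
      ∃ s'' T, Exec B (.while 100 (.seq (.const 100 0) (.seq c.compile (Cmd.next r n))))
        (s'.setReg 100 (test.eval s')) s'' T ∧ T ≤ k * (c.cost + 15) + 1 ∧ s''.Clean ∧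
        s''.BoundedBy V ∧ I N s'' := by
    intro k
    induction k with
    | zero =>
      intro t s' ht hIs hc' hb'
      obtain ⟨h1, h2⟩ := hI t s' hIs
      have hz : test.eval s' = 0 := by simp [htest, Expr.eval, Op.eval, h1, h2]; omega
      have : s'.setReg 100 0 = s' := State.setReg_eq_self _ (hc' 100 le_rfl)
      rw [hz, this]
      refine ⟨s', 1, .while_done _ (hc' 100 le_rfl), by omega, hc', hb', ?_⟩
      have : t = N := by omega
      exact this ▸ hIs
    | succ k ih =>
      intro t s' ht hIs hc' hb'
      obtain ⟨h1, h2⟩ := hI t s' hIs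
      have hz : test.eval s' = 1 := by simp [htest, Expr.eval, Op.eval, h1, h2]; omega
      obtain ⟨s₁, t₁, e₁, ht₁, hc₁, hb₁, hr₁, hI₁⟩ := hstep t s' (by omega) hIs hc' hb' hV B
        (hmono _ (by simp [Cmd.size]))
      have hinc : (Expr.op .add (.reg r) (.lit 1)).eval s₁ = t + 1 := by
        simp [Expr.eval, Op.eval, hr₁]
      have e₂ := hc₁.exec hb₁ hV (e := .op .add (.reg r) (.lit 1)) (by simp [Expr.wf, hr])
        (hmono _ (by simp [Expr.size, Cmd.size]))
      rw [hinc] at e₂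
      have hc₂ : (s₁.setReg r (t + 1)).Clean := hc₁.setReg hr
      have hb₂ : (s₁.setReg r (t + 1)).BoundedBy V := hb₁.setReg (by omega)
      have e₃ := Exec.op (B := B) (s₁.setReg 100 (t + 1)) .and r 100 100 (by
        have : V ^ 1 < B := hmono 1 (by simp [Cmd.size])
        rw [pow_one] at this
        simp only [Op.eval, State.setReg, Function.update_self, Nat.and_self]
        omega)
      have e₄ := Expr.exec_compile hB0 test 100 ((s₁.setReg r (t + 1)).setReg 100 (t + 1)) wtest
        le_rfl (fun r' hr' => by
            simpa [State.setReg, Function.update_of_ne (show r' ≠ 100 by omega)]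
              using hc₂ r' hr'.le)
        (Expr.Fits.setReg le_rfl test wtest
          (test.fits hV hb₂ wtest (hmono _ (by simp [Expr.size, Cmd.size, htest]))))
      rw [State.setReg_setReg, test.eval_setReg le_rfl wtest] at e₄
      obtain ⟨s₅, t₅, e₅, ht₅, hc₅, hb₅, hI₅⟩ := ih (t + 1) _ (by omega) hI₁ hc₂ hb₂
      have e₀ : Exec B c.compile ((s'.setReg 100 (test.eval s')).setReg 100 0) s₁ t₁ := by
        rw [State.setReg_setReg, State.setReg_eq_self _ (hc' 100 le_rfl)]
        exact e₁
      have e₃' : Exec B (.op .and r 100 100) (s₁.setReg 100 (t + 1))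
          ((s₁.setReg r (t + 1)).setReg 100 (t + 1)) 1 := by
        rw [State.setReg_comm _ (by omega : r ≠ 100)]
        simpa [State.setReg, Op.eval] using e₃
      refine ⟨s₅, _, .while_step (by simp [State.setReg, hz]) (.seq (.const _ 100 0 hB0)
        (.seq e₀ (.seq e₂ (.seq e₃' e₄)))) e₅, ?_, hc₅, hb₅, hI₅⟩
      · simp only [Expr.cost, htest]
        have : (k + 1) * (c.cost + 15) = k * (c.cost + 15) + (c.cost + 15) := by ring
        omega
  have hb1 : (s.setReg r 0).BoundedBy V := hb.setReg (by omega)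
  have e₁ := (hc.setReg (v := 0) hr).exec hb1 hV wtest (hmono _ (by simp [Expr.size, Cmd.size, htest]))
  obtain ⟨s₂, t₂, e₂, ht₂, hc₂, hb₂, hI₂⟩ := key N 0 _ (by omega) h0 (hc.setReg hr) hb1
  refine ⟨s₂, _, .seq (.const _ r 0 hB0) (.seq e₁ e₂), ?_, hc₂, hb₂, hQ _ hI₂⟩
  simp only [Expr.cost, htest, Cmd.cost]
  nlinarith

end WordRAM

namespace WordRAM

/-! ## Two kinds of loops -/

/-- The memory `mem` after `f 0, …, f (t - 1)` have been written to the addresses from `b` on. -/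
def fill (mem : ℕ → ℕ) (b t : ℕ) (f : ℕ → ℕ) : ℕ → ℕ :=
  fun a => if b ≤ a ∧ a < b + t then f (a - b) else mem a

theorem fill_zero (mem : ℕ → ℕ) (b : ℕ) (f : ℕ → ℕ) : fill mem b 0 f = mem := by
  funext a
  simp only [fill]
  rw [if_neg (by omega)]

theorem fill_succ (mem : ℕ → ℕ) (b t : ℕ) (f : ℕ → ℕ) :
    fill mem b (t + 1) f = Function.update (fill mem b t f) (b + t) (f t) := by
  funext a
  by_cases h : a = b + t
  · subst h; simp [fill]
  · simp only [fill, Function.update_of_ne h]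
    have : (b ≤ a ∧ a < b + (t + 1)) ↔ (b ≤ a ∧ a < b + t) := by omega
    simp [this]

theorem fill_of_lt {mem : ℕ → ℕ} {b t : ℕ} {f : ℕ → ℕ} {k : ℕ} (h : k < t) :
    fill mem b t f (b + k) = f k := by
  simp [fill, h]

theorem fill_of_not {mem : ℕ → ℕ} {b t : ℕ} {f : ℕ → ℕ} {a : ℕ} (h : a < b ∨ b + t ≤ a) :
    fill mem b t f a = mem a := by
  simp only [fill]
  rw [if_neg (by omega)]

/-- Write the values of `e` for the values `0, …, reg n - 1` of the register `r` to the addresses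
from `b` on. -/
def Cmd.tabulate (r n : ℕ) (b e : Expr) : Cmd := .loop r n (.store (.op .add b (.reg r)) e)

/-- The expressions are evaluated after the first `t` entries have been written, so an entry may be
computed from earlier ones. -/
theorem Triple.tabulate {U V : ℕ} {s : State} {r n N : ℕ} {be e : Expr} (b : ℕ) (f : ℕ → ℕ)
    (hr : r < 100) (hn : n < 100) (hrn : n ≠ r) (hN : s.reg n = N) (hU : N ≤ U)
    (hbe : be.wf = true) (he : e.wf = true)
    (heval : ∀ t < N, be.eval ⟨Function.update s.reg r t, fill s.mem b t f⟩ = b ∧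
      e.eval ⟨Function.update s.reg r t, fill s.mem b t f⟩ = f t ∧ f t ≤ V) :
    Triple U V (.tabulate r n be e) s
      (fun s' => s' = ⟨Function.update s.reg r N, fill s.mem b N f⟩) := by
  refine Triple.loop hr hn hN hU
    (fun t s' => s' = ⟨Function.update s.reg r t, fill s.mem b t f⟩) ?_ ?_ ?_ fun _ h => h
  · rw [fill_zero]; rfl
  · rintro t s' rfl
    simp [hrn, hN]
  · rintro t s' ht rfl
    obtain ⟨h1, h2, h3⟩ := heval t ht
    refine Triple.store (by simp [Expr.wf, hbe, hr]) he (by rw [h2]; exact h3) ?_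
    simp only [Expr.eval, h1, h2, Op.eval, State.setMem, State.setReg, Function.update_self,
      Function.update_idem, fill_succ, and_self]

/-- The memory `mem` after the list `l` has been written to the addresses from `p` on. -/
def writeList (mem : ℕ → ℕ) (p : ℕ) (l : List ℕ) : ℕ → ℕ :=
  fun a => if p ≤ a ∧ a < p + l.length then l.getD (a - p) 0 else mem a

theorem writeList_nil (mem : ℕ → ℕ) (p : ℕ) : writeList mem p [] = mem := by
  funext a
  simp only [writeList, List.length_nil]
  rw [if_neg (by omega)]

theorem writeList_append_pair (mem : ℕ → ℕ) (p : ℕ) (l : List ℕ) (u v : ℕ) :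
    writeList mem p (l ++ [u, v]) = Function.update (Function.update (writeList mem p l)
      (p + l.length) u) (p + l.length + 1) v := by
  funext a
  simp only [writeList, List.length_append, List.length_cons, List.length_nil]
  by_cases h1 : a = p + l.length + 1
  · subst h1
    have h2 : p + l.length + 1 - p = l.length + 1 := by omega
    rw [if_pos (by omega), h2]
    simp
  · by_cases h2 : a = p + l.length
    · subst h2
      have h2 : p + l.length - p = l.length := by omega
      rw [if_pos (by omega), h2]
      simp
    · rw [Function.update_of_ne h1, Function.update_of_ne h2, writeList]
      by_cases h3 : p ≤ a ∧ a < p + l.length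
      · rw [if_pos (by omega), if_pos h3, List.getD_append _ _ _ _ (by omega)]
      · rw [if_neg (by omega), if_neg h3]

theorem writeList_of_le {mem : ℕ → ℕ} {p : ℕ} {l : List ℕ} {a : ℕ} (h : p + l.length ≤ a) :
    writeList mem p l a = mem a := by
  simp only [writeList]
  rw [if_neg (by omega)]

/-- The pairs `u t, v t` for `t < T` with property `c`. -/
def emitted (T : ℕ) (c : ℕ → Bool) (u v : ℕ → ℕ) : List ℕ :=
  (List.range T).flatMap fun t => if c t then [u t, v t] else []

theorem emitted_succ (T : ℕ) (c : ℕ → Bool) (u v : ℕ → ℕ) :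
    emitted (T + 1) c u v = emitted T c u v ++ if c T then [u T, v T] else [] := by
  simp [emitted, List.range_succ, List.flatMap_append]

theorem length_emitted_mono {S T : ℕ} (h : S ≤ T) (c : ℕ → Bool) (u v : ℕ → ℕ) :
    (emitted S c u v).length ≤ (emitted T c u v).length := by
  induction h with
  | refl => rfl
  | step _ ih => exact ih.trans (by rw [emitted_succ]; simp)

/-- For the values `0, …, reg n - 1` of the register `r`, if the value of `c` is not `0`, write the
values of `u` and `v` to the address in the register `p` and the next one, and increase the
register `p` by `2`. -/
def Cmd.emit (r n p : ℕ) (c u v : Expr) : Cmd :=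
  .loop r n (.when c (.seq (.store (.reg p) u) (.seq (.store (.op .add (.reg p) (.lit 1)) v)
    (.assign p (.op .add (.reg p) (.lit 2))))))

/-- The address `F` lies beyond all output. The hypothesis on the expressions concerns every state
that agrees with `s` from `F` on and in the registers other than `r` and `p`; it thus applies
however much output has been written. -/
theorem Triple.emit {U V : ℕ} {s : State} {r n p N F : ℕ} {ce ue ve : Expr} (c : ℕ → Bool)
    (u v : ℕ → ℕ) (hr : r < 100) (hn : n < 100) (hp : p < 100) (hrn : n ≠ r) (hpn : n ≠ p)
    (hpr : p ≠ r) (hN : s.reg n = N) (hU : N ≤ U) (hc : ce.wf = true) (hu : ue.wf = true)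
    (hv : ve.wf = true) (hF : s.reg p + (emitted N c u v).length ≤ F) (hFV : F ≤ V)
    (heval : ∀ t < N, ∀ s' : State, (∀ q, q ≠ r → q ≠ p → s'.reg q = s.reg q) → s'.reg r = t →
      (∀ a, F ≤ a → s'.mem a = s.mem a) → (ce.eval s' ≠ 0 ↔ c t = true) ∧
        (c t = true → ue.eval s' = u t ∧ ve.eval s' = v t ∧ u t ≤ V ∧ v t ≤ V)) :
    Triple U V (.emit r n p ce ue ve) s (fun s' => s' =
      ⟨Function.update (Function.update s.reg p (s.reg p + (emitted N c u v).length)) r N,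
        writeList s.mem (s.reg p) (emitted N c u v)⟩) := by
  let st : ℕ → State := fun t =>
    ⟨Function.update (Function.update s.reg p (s.reg p + (emitted t c u v).length)) r t,
      writeList s.mem (s.reg p) (emitted t c u v)⟩
  refine Triple.loop hr hn hN hU (fun t s' => s' = st t) ?_ ?_ ?_ fun _ h => h
  · simp [st, emitted, writeList_nil, State.setReg]
  · rintro t s' rfl
    simp [st, hrn, hpn, hN]
  · rintro t s' ht rfl
    have hlen : ∀ S ≤ N, s.reg p + (emitted S c u v).length ≤ F := fun S hS =>
      (Nat.add_le_add_left (length_emitted_mono hS c u v) _).trans hF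
    have hlt := hlen (t + 1) ht
    rw [emitted_succ] at hlt
    have hmem : ∀ a, F ≤ a → (st t).mem a = s.mem a := fun a ha =>
      writeList_of_le ((hlen t ht.le).trans ha)
    obtain ⟨h1, h2⟩ := heval t ht (st t) (fun q h1 h2 => by simp [st, h1, h2]) (by simp [st]) hmem
    refine Triple.when hc (fun h => ?_) (fun h => ?_)
    · have hct := h1.1 h
      obtain ⟨hu1, hv1, huV, hvV⟩ := h2 hct
      rw [if_pos hct] at hlt
      simp only [List.length_append, List.length_cons, List.length_nil] at hlt
      have hptr : (st t).reg p = s.reg p + (emitted t c u v).length := by simp [st, hpr]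
      refine Triple.seq (P := fun s' => s' = (st t).setMem ((st t).reg p) (u t))
        (Triple.store (by simp [Expr.wf, hp]) hu (by rw [hu1]; exact huV)
          (by rw [hu1]; rfl)) ?_
      rintro _ rfl
      -- The second endpoint is evaluated when the first has already been stored, so the hypothesis
      -- is needed for this intermediate state too.
      obtain ⟨-, h4⟩ := heval t ht ((st t).setMem ((st t).reg p) (u t))
        (fun q h1 h2 => by simp [st, h1, h2, State.setMem]) (by simp [st, State.setMem])
        (fun a ha => by
          simp only [State.setMem]
          rw [Function.update_of_ne (by omega), hmem a ha])
      obtain ⟨-, hv2, -, -⟩ := h4 hct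
      refine Triple.seq (P := fun s' => s' = ((st t).setMem ((st t).reg p) (u t)).setMem
        ((st t).reg p + 1) (v t))
        (Triple.store (by simp [Expr.wf, hp]) hv (by rw [hv2]; exact hvV) (by rw [hv2]; rfl)) ?_
      rintro _ rfl
      refine Triple.assign hp (by simp [Expr.wf, hp]) ?_ ?_
      · simp only [Expr.eval, Op.eval, State.setMem, hptr]
        omega
      · simp only [Expr.eval, Op.eval, State.setMem, State.setReg, hptr, st, State.mk.injEq]
        refine ⟨by simp [hpr.symm], ?_, ?_⟩
        · rw [emitted_succ, if_pos hct]
          funext q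
          by_cases hq : q = r
          · subst hq; simp
          · by_cases hq' : q = p
            · subst hq'; simp [hq, add_assoc]
            · simp [hq, hq']
        · rw [emitted_succ, if_pos hct, writeList_append_pair, Function.update_of_ne hpr,
            Function.update_self]
    · have hct : c t = false := by
        by_contra hne
        exact h1.2 (by simpa using hne) h
      refine ⟨by simp [st], ?_⟩
      simp only [st, emitted_succ, hct, State.setReg, Function.update_idem]
      simp

end WordRAM

namespace WordRAM

/-! ## The program that builds the graph -/

namespace Expr

instance : Add Expr := ⟨.op .add⟩
instance : Sub Expr := ⟨.op .sub⟩
instance : Mul Expr := ⟨.op .mul⟩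
instance : Div Expr := ⟨.op .div⟩
instance : Mod Expr := ⟨.op .mod⟩
instance (k : ℕ) : OfNat Expr k := ⟨.lit k⟩

variable (s : State) (a b : Expr)

@[simp] theorem eval_add : (a + b).eval s = a.eval s + b.eval s := rfl
@[simp] theorem eval_sub : (a - b).eval s = a.eval s - b.eval s := rfl
@[simp] theorem eval_mul : (a * b).eval s = a.eval s * b.eval s := rfl
@[simp] theorem eval_div : (a / b).eval s = a.eval s / b.eval s := rfl
@[simp] theorem eval_mod : (a % b).eval s = a.eval s % b.eval s := rfl
@[simp] theorem eval_zero : eval s 0 = 0 := rfl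
@[simp] theorem eval_one : eval s 1 = 1 := rfl
@[simp] theorem eval_two : eval s 2 = 2 := rfl
@[simp] theorem eval_three : eval s 3 = 3 := rfl
@[simp] theorem eval_four : eval s 4 = 4 := rfl
@[simp] theorem eval_lit (k : ℕ) : (lit k).eval s = k := rfl
@[simp] theorem eval_reg (r : ℕ) : (reg r).eval s = s.reg r := rfl
@[simp] theorem eval_load : (load a).eval s = s.mem (a.eval s) := rfl
@[simp] theorem eval_lt : (op .lt a b).eval s = if a.eval s < b.eval s then 1 else 0 := rfl
@[simp] theorem eval_eq : (op .eq a b).eval s = if a.eval s = b.eval s then 1 else 0 := rfl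
@[simp] theorem eval_or : (op .or a b).eval s = a.eval s ||| b.eval s := rfl
@[simp] theorem eval_shr : (op .shr a b).eval s = a.eval s >>> b.eval s := rfl

/-- The registers for the number `m` of vectors per family, their length `d`, the first address of
the vectors, the number of extra leaves, the counter, the end of the list, and the length of the
loops. -/
def M : Expr := reg 0
/-- See `Expr.M`. -/
def D : Expr := reg 1
/-- See `Expr.M`. -/
def F : Expr := reg 2
/-- See `Expr.M`. -/
def L : Expr := reg 3
/-- See `Expr.M`. -/
def T : Expr := reg 4
/-- See `Expr.M`. -/
def P : Expr := reg 5

/-- The number of the vertex `leaf σ i j`. -/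
def leaf (σ i j : Expr) : Expr := σ * (M * M) + i * M + j
/-- The number of the vertex `pair σ i j`. -/
def pair (σ i j : Expr) : Expr := 2 * (M * M) + (σ * (M * M) + i * M + j)
/-- The number of the vertex `hub σ i`. -/
def hub (σ i : Expr) : Expr := 4 * (M * M) + (σ * M + i)
/-- The number of the vertex `coord σ i x y`. -/
def coord (σ i x y : Expr) : Expr :=
  4 * (M * M) + 2 * M + (σ * (M * (D * D)) + i * (D * D) + x * D + y)
/-- The number of the vertex `pad t`. -/
def pad (t : Expr) : Expr := 4 * (M * M) + 2 * M + 2 * (M * (D * D)) + t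
/-- The coordinate `x` of the `i`-th of all vectors. -/
def bit (i x : Expr) : Expr := load (F + (i * D + x))

end Expr

open WordRAM.Expr

theorem writeList_writeList (mem : ℕ → ℕ) (p : ℕ) (l l' : List ℕ) :
    writeList (writeList mem p l) (p + l.length) l' = writeList mem p (l ++ l') := by
  funext a
  simp only [writeList, List.length_append]
  by_cases h : p + l.length ≤ a ∧ a < p + l.length + l'.length
  · rw [if_pos h, if_pos (by omega), List.getD_append_right _ _ _ _ (by omega)]
    congr 1
    omega
  · rw [if_neg h]
    by_cases h' : p ≤ a ∧ a < p + l.length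
    · rw [if_pos h', if_pos (by omega), List.getD_append _ _ _ _ (by omega)]
    · rw [if_neg h', if_neg (by omega)]

/-- The words for a list of edges. -/
def edgeWords {m d Q : ℕ} (es : List (OV3.Vertex m d Q × OV3.Vertex m d Q)) : List ℕ :=
  es.flatMap fun e => [e.1.code, e.2.code]

theorem edgeWords_append {m d Q : ℕ} (es es' : List (OV3.Vertex m d Q × OV3.Vertex m d Q)) :
    edgeWords (es ++ es') = edgeWords es ++ edgeWords es' := List.flatMap_append

/-- The loop counter runs through the numbers of the indices under `e`, which is the order in which
`phase` lists them. -/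
theorem emitted_eq_edgeWords {m d Q N : ℕ} {I : Type*} (e : I ≃ Fin N) (p : I → Bool)
    (f : I → OV3.Vertex m d Q × OV3.Vertex m d Q) (c : ℕ → Bool) (u v : ℕ → ℕ)
    (h : ∀ t : Fin N, c t = p (e.symm t) ∧ u t = (f (e.symm t)).1.code ∧
      v t = (f (e.symm t)).2.code) :
    emitted N c u v = edgeWords (OV3.phase e p f) := by
  have key : ∀ l : List I, edgeWords ((l.filter p).map f) =
      l.flatMap fun i => if p i then [(f i).1.code, (f i).2.code] else [] := by
    intro l
    induction l with
    | nil => rfl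
    | cons i l ih =>
      rw [List.flatMap_cons, ← ih]
      cases hp : p i <;> simp [hp, edgeWords]
  rw [OV3.phase, key, emitted, ← List.map_coe_finRange_eq_range, List.flatMap_map, List.flatMap_map]
  congr 1
  funext t
  simp [h t]

/-- The state while the list of edges is being built. -/
structure Building (m d F Q : ℕ) (R mem₀ : ℕ → ℕ) (l : List ℕ) (s : State) : Prop where
  reg0 : s.reg 0 = m
  reg1 : s.reg 1 = d
  reg2 : s.reg 2 = F
  reg3 : s.reg 3 = Q
  reg5 : s.reg 5 = 2 + l.length
  other : ∀ r, 7 ≤ r → s.reg r = R r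
  mem : s.mem = writeList mem₀ 2 l

/-- Emit `cnt` pairs. -/
def Cmd.emitPhase (cnt c u v : Expr) : Cmd := .seq (.assign 6 cnt) (.emit 4 6 5 c u v)

theorem Triple.emitPhase {U V m d F Q N : ℕ} {R mem₀ : ℕ → ℕ} {l : List ℕ} {s : State}
    {cnt ce ue ve : Expr} {I : Type*} (e : I ≃ Fin N) (p : I → Bool)
    (f : I → OV3.Vertex m d Q × OV3.Vertex m d Q) (hs : Building m d F Q R mem₀ l s)
    (hcnt : s.reg 0 = m → s.reg 1 = d → s.reg 3 = Q → cnt.eval s = N) (hN : N ≤ F)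
    (hFU : F ≤ U) (hFV : F ≤ V) (hV : ∀ w : OV3.Vertex m d Q, w.code ≤ V)
    (hw : cnt.wf = true ∧ ce.wf = true ∧ ue.wf = true ∧ ve.wf = true)
    (hF : 2 + (l ++ edgeWords (OV3.phase e p f)).length ≤ F)
    (heval : ∀ t : Fin N, ∀ s' : State, s'.reg 0 = m → s'.reg 1 = d → s'.reg 2 = F →
      s'.reg 4 = t → (∀ a, F ≤ a → s'.mem a = mem₀ a) →
        (ce.eval s' ≠ 0 ↔ p (e.symm t) = true) ∧ ue.eval s' = (f (e.symm t)).1.code ∧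
          ve.eval s' = (f (e.symm t)).2.code) :
    Triple U V (.emitPhase cnt ce ue ve) s
      (Building m d F Q R mem₀ (l ++ edgeWords (OV3.phase e p f))) := by
  -- Extended arbitrarily beyond `N`; only counters below `N` occur.
  let c : ℕ → Bool := fun t => if h : t < N then p (e.symm ⟨t, h⟩) else false
  let u : ℕ → ℕ := fun t => if h : t < N then (f (e.symm ⟨t, h⟩)).1.code else 0
  let v : ℕ → ℕ := fun t => if h : t < N then (f (e.symm ⟨t, h⟩)).2.code else 0
  have hL : emitted N c u v = edgeWords (OV3.phase e p f) :=
    emitted_eq_edgeWords e p f c u v fun t => by simp [c, u, v]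
  have hev := hcnt hs.reg0 hs.reg1 hs.reg3
  simp only [List.length_append] at hF
  refine Triple.seq (P := fun s' => s' = s.setReg 6 N)
    (Triple.assign (by omega) hw.1 (by omega) (by rw [hev])) ?_
  rintro _ rfl
  refine (Triple.emit (F := F) (N := N) c u v (by omega) (by omega) (by omega) (by omega)
    (by omega) (by omega) (by simp [State.setReg]) (hN.trans hFU) hw.2.1 hw.2.2.1 hw.2.2.2
    ?_ hFV ?_).mono le_rfl ?_
  · rw [hL]
    simp only [State.setReg]
    rw [Function.update_of_ne (by omega), hs.reg5]
    omega
  · intro t ht s' hreg hr4 hmem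
    have hr : ∀ q, q ≠ 4 → q ≠ 5 → q ≠ 6 → s'.reg q = s.reg q := fun q h4 h5 h6 => by
      rw [hreg q h4 h5]
      simp [State.setReg, h6]
    obtain ⟨h1, h2, h3⟩ := heval ⟨t, ht⟩ s' ((hr 0 (by omega) (by omega) (by omega)).trans hs.reg0)
      ((hr 1 (by omega) (by omega) (by omega)).trans hs.reg1)
      ((hr 2 (by omega) (by omega) (by omega)).trans hs.reg2) hr4 (fun a ha => by
        rw [hmem a ha]
        simp only [State.setReg, hs.mem]
        exact writeList_of_le (by omega))
    simp only [c, u, v, ht, dif_pos]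
    exact ⟨h1, fun _ => ⟨h2, h3, hV _, hV _⟩⟩
  · rintro _ rfl
    rw [hL]
    have h5 : (s.setReg 6 N).reg 5 = 2 + l.length := by simp [State.setReg, hs.reg5]
    refine ⟨?_, ?_, ?_, ?_, ?_, ?_, ?_⟩
    · simp [State.setReg, hs.reg0]
    · simp [State.setReg, hs.reg1]
    · simp [State.setReg, hs.reg2]
    · simp [State.setReg, hs.reg3]
    · simp [State.setReg, hs.reg5, add_assoc]
    · intro r hr
      simp only [State.setReg]
      rw [Function.update_of_ne (by omega), Function.update_of_ne (by omega),
        Function.update_of_ne (by omega), hs.other r hr]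
    · rw [h5]
      simp only [State.setReg, hs.mem]
      exact writeList_writeList ..

/-- Build the graph of the instance in the memory from the address `F` on. -/
def Cmd.buildGraph : Cmd :=
  .seq (.tabulate 4 2 0 0) <| .seq (.assign 5 2) <|
  .seq (.emitPhase (2 * (M * M)) 1
    (leaf (T / (M * M)) (T % (M * M) / M) (T % (M * M) % M))
    (pair (T / (M * M)) (T % (M * M) / M) (T % (M * M) % M))) <|
  .seq (.emitPhase (2 * (M * M)) 1
    (hub (T / (M * M)) (T % (M * M) / M))
    (pair (T / (M * M)) (T % (M * M) / M) (T % (M * M) % M))) <|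
  .seq (.emitPhase (2 * (M * M)) (.op .lt (T % (M * M) / M) (T % (M * M) % M))
    (hub (T / (M * M)) (T % (M * M) / M))
    (hub (T / (M * M)) (T % (M * M) % M))) <|
  .seq (.emitPhase (2 * (M * (M * (D * D))))
    (bit (M + T % (M * (M * (D * D))) % (M * (D * D)) / (D * D))
      (T % (M * (M * (D * D))) % (M * (D * D)) % (D * D) / D))
    (pair (T / (M * (M * (D * D)))) (T % (M * (M * (D * D))) / (M * (D * D)))
      (T % (M * (M * (D * D))) % (M * (D * D)) / (D * D)))
    (coord (T / (M * (M * (D * D)))) (T % (M * (M * (D * D))) / (M * (D * D)))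
      (T % (M * (M * (D * D))) % (M * (D * D)) % (D * D) / D)
      (T % (M * (M * (D * D))) % (M * (D * D)) % (D * D) % D))) <|
  .seq (.emitPhase (M * (M * (D * D)))
    (bit (T / (M * (D * D))) (T % (M * (D * D)) % (D * D) / D) *
      bit (T / (M * (D * D))) (T % (M * (D * D)) % (D * D) % D) *
      bit (2 * M + T % (M * (D * D)) / (D * D)) (T % (M * (D * D)) % (D * D) / D) *
      bit (2 * M + T % (M * (D * D)) / (D * D)) (T % (M * (D * D)) % (D * D) % D))
    (coord 0 (T / (M * (D * D))) (T % (M * (D * D)) % (D * D) / D)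
      (T % (M * (D * D)) % (D * D) % D))
    (coord 1 (T % (M * (D * D)) / (D * D)) (T % (M * (D * D)) % (D * D) % D)
      (T % (M * (D * D)) % (D * D) / D))) <|
  .seq (.emitPhase L 1 (pad T) (pair 0 0 0)) <|
  .seq (.store 0 (2 * (M * M) + (2 * (M * M) + (2 * M + (2 * (M * (D * D)) + L))))) <|
  .store 1 ((P - 2) / 2)

/-- The memory contains the vectors of the instance from the address `F` on. -/
structure HoldsVectors {m d : ℕ} (J : OV3 m d) (F : ℕ) (mem : ℕ → ℕ) : Prop where
  A : ∀ (i : Fin m) (x : Fin d), mem (F + (i * d + x)) = (J.A i x).toNat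
  B : ∀ (i : Fin m) (x : Fin d), mem (F + ((m + i) * d + x)) = (J.B i x).toNat
  C : ∀ (i : Fin m) (x : Fin d), mem (F + ((2 * m + i) * d + x)) = (J.C i x).toNat

/-- The address `F` divides the memory: the output, and all intermediate output, stays below it, and
the vectors lie above it. That the registers from 7 on and the memory from `F` on survive is what
later permits the scratch space to be cleared. -/
theorem Triple.buildGraph {U V n d F Q : ℕ} {J : OV3 (n + 1) d} {s : State}
    (h0 : s.reg 0 = n + 1) (h1 : s.reg 1 = d) (h2 : s.reg 2 = F) (h3 : s.reg 3 = Q)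
    (hJ : HoldsVectors J F s.mem) (hF : (OV3.graphCode J Q).length ≤ F)
    (hF1 : 2 * ((n + 1) * (n + 1)) ≤ F) (hF2 : 2 * ((n + 1) * ((n + 1) * (d * d))) ≤ F)
    (hFU : F ≤ U) (hFV : F ≤ V) (hV : OV3.vertexCount (n + 1) d Q ≤ V) :
    Triple U V .buildGraph s fun s' => (∀ a < F, s'.mem a = (OV3.graphCode J Q).getD a 0) ∧
      (∀ a, F ≤ a → s'.mem a = s.mem a) ∧ ∀ r, 7 ≤ r → s'.reg r = s.reg r := by
  have hcode : ∀ w : OV3.Vertex (n + 1) d Q, w.code ≤ V := fun w => by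
    rw [← OV3.Vertex.numbering_val]
    exact (Fin.is_lt _).le.trans hV
  have hQ : Q ≤ F := by
    have : Q ≤ (OV3.edges J Q).length := by
      simp only [OV3.edges, List.length_append]
      have : (OV3.phase (Equiv.refl (Fin Q)) (fun _ => true) (fun t =>
          ((.pad t, .pair 0 0 0) : OV3.Vertex (n + 1) d Q × OV3.Vertex (n + 1) d Q))).length = Q := by
        simp [OV3.phase]
      omega
    simp only [OV3.graphCode, List.length_cons, OV3.length_edgeCodes] at hF
    omega
  have hlen : 2 + (edgeWords (OV3.edges J Q)).length ≤ F := by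
    have : (OV3.graphCode J Q).length = (edgeWords (OV3.edges J Q)).length + 2 := rfl
    omega
  have hF0 : 2 ≤ F := by omega
  set mem₀ := fill s.mem 0 F (fun _ => 0) with hmem₀
  have hmem₀F : ∀ a, F ≤ a → mem₀ a = s.mem a := fun a ha => fill_of_not (by omega)
  have hlen' := hlen
  simp only [OV3.edges, edgeWords_append, List.length_append] at hlen'
  refine Triple.seq (Triple.tabulate 0 (fun _ => 0) (by omega) (by omega) (by omega) h2 hFU rfl rfl
    fun t _ => ⟨rfl, rfl, by omega⟩) ?_
  rintro _ rfl
  refine Triple.seq (P := Building (n + 1) d F Q s.reg mem₀ []) (Triple.assign (by omega) rfl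
    (by simp; omega) ?_) ?_
  · refine ⟨?_, ?_, ?_, ?_, ?_, ?_, ?_⟩
    · simp [State.setReg, h0]
    · simp [State.setReg, h1]
    · simp [State.setReg, h2]
    · simp [State.setReg, h3]
    · simp [State.setReg]
    · intro r hr
      simp only [State.setReg]
      rw [Function.update_of_ne (by omega), Function.update_of_ne (by omega)]
    · simp [State.setReg, writeList_nil, hmem₀]
  have hbit : ∀ b : Bool, b.toNat ≠ 0 ↔ b = true := by decide
  have hvec : ∀ s' : State, (∀ a, F ≤ a → s'.mem a = mem₀ a) → HoldsVectors J F s'.mem := by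
    intro s' hm
    refine ⟨fun i x => ?_, fun i x => ?_, fun i x => ?_⟩ <;>
      rw [hm _ (Nat.le_add_right _ _), hmem₀F _ (Nat.le_add_right _ _)]
    exacts [hJ.A i x, hJ.B i x, hJ.C i x]
  intro s₁ hs₁
  refine Triple.seq (Triple.emitPhase (OV3.pairNumbering (n + 1)) (fun _ => true)
    (fun p => (.leaf p.1 p.2.1 p.2.2, .pair p.1 p.2.1 p.2.2)) hs₁
    (by intro h0 h1 h3; simp [M, h0]) hF1 hFU hFV hcode (by decide)
    (by simp only [List.length_append, List.length_nil]; omega) ?_) ?_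
  · intro t s' e0 e1 e2 e4 hm
    simp only [leaf, pair, M, T, eval_add, eval_mul, eval_div, eval_mod, eval_one, eval_two, eval_reg, e0,
      e4]
    -- The quotients and remainders computed by the program are by definition the components of the
    -- inverse numbering; the same holds in the other phases.
    exact ⟨by simp, rfl, rfl⟩
  intro s₂ hs₂
  refine Triple.seq (Triple.emitPhase (OV3.pairNumbering (n + 1)) (fun _ => true)
    (fun p => (.hub p.1 p.2.1, .pair p.1 p.2.1 p.2.2)) hs₂
    (by intro h0 h1 h3; simp [M, h0]) hF1 hFU hFV hcode (by decide)
    (by simp only [List.length_append, List.length_nil]; omega) ?_) ?_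
  · intro t s' e0 e1 e2 e4 hm
    simp only [hub, pair, M, T, eval_add, eval_mul, eval_div, eval_mod, eval_one, eval_two, eval_four, eval_reg, e0,
      e4]
    exact ⟨by simp, rfl, rfl⟩
  intro s₃ hs₃
  refine Triple.seq (Triple.emitPhase (OV3.pairNumbering (n + 1))
    (fun p => decide (p.2.1 < p.2.2)) (fun p => (.hub p.1 p.2.1, .hub p.1 p.2.2)) hs₃
    (by intro h0 h1 h3; simp [M, h0]) hF1 hFU hFV hcode (by decide)
    (by simp only [List.length_append, List.length_nil]; omega) ?_) ?_
  · intro t s' e0 e1 e2 e4 hm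
    simp only [hub, M, T, eval_add, eval_mul, eval_div, eval_mod, eval_four, eval_reg, e0,
      e4, eval_lt]
    refine ⟨?_, rfl, rfl⟩
    rw [decide_eq_true_eq]
    simp only [ne_eq, ite_eq_right_iff, one_ne_zero, imp_false, not_not]
    exact Iff.rfl
  intro s₄ hs₄
  refine Triple.seq (Triple.emitPhase
    (OV3.prodNumbering 2 (OV3.prodNumbering (n + 1) (OV3.coordNumbering (n + 1) d)))
    (fun p => J.B p.2.2.1 p.2.2.2.1) (fun p => (.pair p.1 p.2.1 p.2.2.1,
      .coord p.1 p.2.1 p.2.2.2.1 p.2.2.2.2)) hs₄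
    (by intro h0 h1 h3; simp [M, D, h0, h1]) hF2 hFU hFV hcode (by decide)
    (by simp only [List.length_append, List.length_nil]; omega) ?_) ?_
  · intro t s' e0 e1 e2 e4 hm
    simp only [coord, pair, bit, M, D, Expr.F, T, eval_add, eval_mul, eval_div, eval_mod, eval_two, eval_four,
      eval_reg, eval_load, e0, e1, e2, e4]
    refine ⟨?_, rfl, rfl⟩
    -- With `i` the decoded counter, the address computed by the program is that of an entry of B.
    let i := (OV3.prodNumbering 2 (OV3.prodNumbering (n + 1) (OV3.coordNumbering (n + 1) d))).symm t
    exact (iff_of_eq (congrArg (· ≠ 0) ((hvec s' hm).B i.2.2.1 i.2.2.2.1))).trans (hbit _)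
  intro s₅ hs₅
  refine Triple.seq (Triple.emitPhase
    (OV3.prodNumbering (n + 1) (OV3.coordNumbering (n + 1) d))
    (fun p => J.A p.1 p.2.2.1 && J.A p.1 p.2.2.2 && J.C p.2.1 p.2.2.1 && J.C p.2.1 p.2.2.2)
    (fun p => (.coord 0 p.1 p.2.2.1 p.2.2.2, .coord 1 p.2.1 p.2.2.2 p.2.2.1)) hs₅
    (by intro h0 h1 h3; simp [M, D, h0, h1]) (by omega) hFU hFV hcode (by decide)
    (by simp only [List.length_append, List.length_nil]; omega) ?_) ?_
  · intro t s' e0 e1 e2 e4 hm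
    simp only [coord, bit, M, D, Expr.F, T, eval_add, eval_mul, eval_div, eval_mod, eval_zero, eval_one, eval_two, eval_four,
      eval_reg, eval_load, e0, e1, e2, e4]
    refine ⟨?_, rfl, rfl⟩
    simp only [Bool.and_eq_true, mul_ne_zero_iff]
    let i := (OV3.prodNumbering (n + 1) (OV3.coordNumbering (n + 1) d)).symm t
    have h := hvec s' hm
    refine and_congr (and_congr (and_congr ?_ ?_) ?_) ?_
    · exact (iff_of_eq (congrArg (· ≠ 0) (h.A i.1 i.2.2.1))).trans (hbit _)
    · exact (iff_of_eq (congrArg (· ≠ 0) (h.A i.1 i.2.2.2))).trans (hbit _)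
    · exact (iff_of_eq (congrArg (· ≠ 0) (h.C i.2.1 i.2.2.1))).trans (hbit _)
    · exact (iff_of_eq (congrArg (· ≠ 0) (h.C i.2.1 i.2.2.2))).trans (hbit _)
  intro s₆ hs₆
  refine Triple.seq (Triple.emitPhase (Equiv.refl (Fin Q)) (fun _ => true)
    (fun t => (.pad t, .pair 0 0 0)) hs₆
    (by intro h0 h1 h3; simp [L, h3]) hQ hFU hFV hcode (by decide)
    (by simp only [List.length_append, List.length_nil]; omega) ?_) ?_
  · intro t s' e0 e1 e2 e4 hm
    simp only [pad, pair, M, D, T, eval_add, eval_mul, eval_zero, eval_one, eval_two, eval_four, eval_reg, e0, e1, e4]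
    exact ⟨by simp, rfl, by simp [OV3.Vertex.code]⟩
  intro s₇ hs₇
  replace hs₇ : Building (n + 1) d F Q s.reg mem₀ (OV3.edgeCodes J Q) s₇ := by
    have h : OV3.edgeCodes J Q = edgeWords (OV3.edges J Q) := rfl
    rw [h, OV3.edges]
    simpa only [List.nil_append, List.append_assoc, edgeWords_append] using hs₇
  have hcnt : (2 * (M * M) + (2 * (M * M) + (2 * M + (2 * (M * (D * D)) + L)))).eval s₇ =
      OV3.vertexCount (n + 1) d Q := by
    simp [M, D, L, hs₇.reg0, hs₇.reg1, hs₇.reg3, OV3.vertexCount]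
  refine Triple.seq (P := fun s' => s' = s₇.setMem 0 (OV3.vertexCount (n + 1) d Q))
    (Triple.store rfl (by decide) (by rw [hcnt]; exact hV) (by rw [hcnt]; rfl)) ?_
  rintro _ rfl
  -- The output pointer started at 2 and moved by 2 for each edge.
  have hhalf : ((P - 2) / 2).eval (s₇.setMem 0 (OV3.vertexCount (n + 1) d Q)) =
      (OV3.edges J Q).length := by
    simp only [P, eval_div, eval_sub, eval_reg, eval_two, State.setMem, hs₇.reg5,
      OV3.length_edgeCodes]
    omega
  have hlenE : (OV3.edgeCodes J Q).length + 2 ≤ F := by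
    have h : (OV3.graphCode J Q).length = (OV3.edgeCodes J Q).length + 2 := rfl
    omega
  refine Triple.store rfl (by decide) ?_ ⟨?_, ?_, ?_⟩
  · rw [hhalf]
    rw [OV3.length_edgeCodes] at hlenE
    omega
  · intro a ha
    rw [hhalf]
    simp only [State.setMem, eval_one, hs₇.mem, OV3.graphCode]
    rcases a with _ | _ | a
    · simp
    · simp
    · rw [Function.update_of_ne (by omega), Function.update_of_ne (by omega)]
      simp only [List.getD_cons_succ, writeList]
      by_cases hlt : a < (OV3.edgeCodes J Q).length
      · rw [if_pos (by omega)]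
        congr 1
      · rw [if_neg (by omega), List.getD_eq_default _ _ (by omega)]
        -- Behind the list the cells below `F` still hold the zeros written at the start, in
        -- agreement with the default of `getD`.
        simp only [hmem₀, fill]
        rw [if_pos (by omega)]
  · intro a ha
    simp only [State.setMem, eval_one, hs₇.mem]
    rw [Function.update_of_ne (by omega), Function.update_of_ne (by omega), writeList_of_le (by omega),
      hmem₀F a ha]
  · exact fun r hr => hs₇.other r hr

end WordRAM

/-! ### The entries of an instance in its encoding -/

namespace OV3

/-- The three families of an instance, indexed by `0`, `1`, `2`. -/
def family {n d : ℕ} (I : OV3 n d) (σ : ℕ) : Fin n → Fin d → Bool :=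
  if σ = 0 then I.A else if σ = 1 then I.B else I.C

theorem family_extend {n d : ℕ} (I : OV3 n d) (σ : ℕ) (i : Fin (n + 1)) (x : Fin d) :
    I.extend.family σ i x = if h : (i : ℕ) < n then I.family σ ⟨i, h⟩ x else true := by
  unfold family extend
  split_ifs <;> simp [*]

end OV3

theorem encodeVectors_eq_ofFn {n d : ℕ} (V : Fin n → Fin d → Bool) :
    encodeVectors V = List.ofFn fun k : Fin (n * d) => (V k.divNat k.modNat).toNat := by
  rw [List.ofFn_mul, encodeVectors]
  congr 2
  funext i
  congr 1
  funext x
  have h : finProdFinEquiv (i, x) = (⟨i * d + x, by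
      calc (i : ℕ) * d + x < i * d + d := by omega
        _ = (i + 1) * d := by ring
        _ ≤ n * d := Nat.mul_le_mul_right _ i.2⟩ : Fin (n * d)) := by
    ext
    simp [finProdFinEquiv]
    ring
  have h1 := congrArg Prod.fst (finProdFinEquiv.symm_apply_apply (i, x))
  have h2 := congrArg Prod.snd (finProdFinEquiv.symm_apply_apply (i, x))
  rw [h] at h1 h2
  simp only [finProdFinEquiv, Equiv.coe_fn_symm_mk] at h1 h2
  rw [h1, h2]

theorem length_encodeVectors {n d : ℕ} (V : Fin n → Fin d → Bool) :
    (encodeVectors V).length = n * d := by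
  rw [encodeVectors_eq_ofFn, List.length_ofFn]

theorem index_lt {m d i x : ℕ} (hi : i < m) (hx : x < d) : i * d + x < m * d :=
  calc i * d + x < i * d + d := by omega
    _ = (i + 1) * d := by ring
    _ ≤ m * d := Nat.mul_le_mul_right _ hi

theorem index_div {d i x : ℕ} (hx : x < d) : (i * d + x) / d = i := by
  rw [mul_comm, Nat.mul_add_div (by omega), Nat.div_eq_of_lt hx, add_zero]

theorem index_mod {d i x : ℕ} (hx : x < d) : (i * d + x) % d = x := by
  rw [mul_comm, Nat.mul_add_mod, Nat.mod_eq_of_lt hx]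

theorem getD_encodeVectors {n d : ℕ} (V : Fin n → Fin d → Bool) (i : Fin n) (x : Fin d) :
    (encodeVectors V).getD (i * d + x) 0 = (V i x).toNat := by
  rw [encodeVectors_eq_ofFn, List.getD_eq_getElem _ _ (by simpa using index_lt i.2 x.2),
    List.getElem_ofFn]
  have h1 : (⟨i * d + x, index_lt i.2 x.2⟩ : Fin (n * d)).divNat = i := by
    ext; exact index_div x.2
  have h2 : (⟨i * d + x, index_lt i.2 x.2⟩ : Fin (n * d)).modNat = x := by
    ext; exact index_mod x.2
  rw [h1, h2]

namespace OV3

variable {n d : ℕ}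

theorem getD_encode (I : OV3 n d) {σ : ℕ} (hσ : σ < 3) (i : Fin n) (x : Fin d) :
    I.encode.getD (2 + ((σ * n + i) * d + x)) 0 = (I.family σ i x).toNat := by
  have hlt := index_lt i.2 x.2
  rw [add_comm 2, encode, List.getD_cons_succ, List.getD_cons_succ]
  have hσ' : σ = 0 ∨ σ = 1 ∨ σ = 2 := by omega
  rcases hσ' with rfl | rfl | rfl
  · rw [List.getD_append _ _ _ _ (by rw [List.length_append, length_encodeVectors]; simp; omega),
      List.getD_append _ _ _ _ (by rw [length_encodeVectors]; simpa using hlt)]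
    simpa [family] using getD_encodeVectors I.A i x
  · have h : (1 * n + (i : ℕ)) * d + x = n * d + (i * d + x) := by ring
    rw [h, List.getD_append _ _ _ _ (by simp only [List.length_append, length_encodeVectors]; omega),
      List.getD_append_right _ _ _ _ (by rw [length_encodeVectors]; omega), length_encodeVectors,
      Nat.add_sub_cancel_left]
    simpa [family] using getD_encodeVectors I.B i x
  · have h : (2 * n + (i : ℕ)) * d + x = (n * d + n * d) + (i * d + x) := by ring
    rw [h, List.getD_append_right _ _ _ _ (by
      simp only [List.length_append, length_encodeVectors]; omega), List.length_append,
      length_encodeVectors, length_encodeVectors, Nat.add_sub_cancel_left]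
    simpa [family] using getD_encodeVectors I.C i x

theorem le_of_mem_encode (I : OV3 n d) {a : ℕ} (ha : a ∈ I.encode) : a ≤ n + d + 1 := by
  have key : ∀ (V : Fin n → Fin d → Bool), a ∈ encodeVectors V → a ≤ 1 := by
    intro V h
    rw [encodeVectors_eq_ofFn, List.mem_ofFn] at h
    obtain ⟨k, rfl⟩ := h
    exact Bool.toNat_le _
  simp only [encode, List.mem_cons, List.mem_append] at ha
  rcases ha with rfl | rfl | (h | h) | h
  · omega
  · omega
  all_goals have := key _ h; omega

end OV3

/-! ### From the encoding of an instance to its graph -/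

namespace WordRAM

open WordRAM.Expr

theorem getD_le {l : List ℕ} {V : ℕ} (h : ∀ a ∈ l, a ≤ V) (i : ℕ) : l.getD i 0 ≤ V := by
  by_cases hi : i < l.length
  · rw [List.getD_eq_getElem _ _ hi]
    exact h _ (List.getElem_mem hi)
  · rw [List.getD_eq_default _ _ (by omega)]
    exact Nat.zero_le V

theorem State.init_clean (xs : List ℕ) : (State.init xs).Clean := fun _ _ => rfl

theorem State.init_boundedBy {xs : List ℕ} {V : ℕ} (h : ∀ a ∈ xs, a ≤ V) :
    (State.init xs).BoundedBy V := ⟨fun _ => Nat.zero_le V, getD_le h⟩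

theorem holdsVectors_of_family {m d F : ℕ} {J : OV3 m d} {mem : ℕ → ℕ}
    (h : ∀ σ < 3, ∀ (i : Fin m) (x : Fin d),
      mem (F + ((σ * m + i) * d + x)) = (J.family σ i x).toNat) : HoldsVectors J F mem where
  A i x := by simpa [OV3.family] using h 0 (by omega) i x
  B i x := by simpa [OV3.family] using h 1 (by omega) i x
  C i x := by simpa [OV3.family] using h 2 (by omega) i x

/-- The value to be stored for the vectors `i` of the family `σ`, where `T` runs through all
positions: `1` for the additional vector, otherwise the value of `e`. -/
def Expr.orLast (e : Expr) : Expr :=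
  .op .or (.op .eq (T % (M * D) / D) (.reg 7)) (.op .lt (T % (M * D) / D) (.reg 7) * e)

/-- Copy the input to the memory from address `F` on, with the additional vectors, and build the
graph. -/
def Cmd.graphOfInstance : Cmd :=
  .seq (.assign 7 (.load 0)) <| .seq (.assign 1 (.load 1)) <| .seq (.assign 0 (.reg 7 + 1)) <|
  .seq (.assign 2 (.lit 20 * (M * M * (D * D)))) <| .seq (.assign 6 (3 * (M * D))) <|
  .seq (.tabulate 4 6 Expr.F (Expr.orLast (.load (2 + ((T / (M * D) * .reg 7 + T % (M * D) / D) * D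
    + T % (M * D) % D))))) <|
  .buildGraph

/-- With X = (n + 1)²d² there are at most 9X + Q edges of two words each, and the two header words
are at most 2X. -/
theorem length_graphCode_le {n d Q : ℕ} (hd : 1 ≤ d) {J : OV3 (n + 1) d} :
    (OV3.graphCode J Q).length ≤ 20 * ((n + 1) * (n + 1) * (d * d)) + 2 * Q := by
  have h1 := OV3.length_edges_le (J := J) (Q := Q)
  have h2 : (OV3.graphCode J Q).length = 2 * (OV3.edges J Q).length + 2 := by
    simp [OV3.graphCode, OV3.length_edgeCodes]
  have h3 : (n + 1) * ((n + 1) * (d * d)) = (n + 1) * (n + 1) * (d * d) := by ring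
  have h4 : (n + 1) * (n + 1) * 1 ≤ (n + 1) * (n + 1) * (d * d) :=
    Nat.mul_le_mul_left _ (Nat.mul_pos hd hd)
  have h5 : 1 ≤ (n + 1) * (n + 1) := Nat.mul_pos (by omega) (by omega)
  rw [h3] at h1
  omega

theorem vertexCount_le {n d Q : ℕ} (hd : 1 ≤ d) :
    OV3.vertexCount (n + 1) d Q ≤ 8 * ((n + 1) * (n + 1) * (d * d)) + Q := by
  have h4 : (n + 1) * (n + 1) * 1 ≤ (n + 1) * (n + 1) * (d * d) :=
    Nat.mul_le_mul_left _ (Nat.mul_pos hd hd)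
  have h5 : (n + 1) * 1 ≤ (n + 1) * (n + 1) := Nat.mul_le_mul_left _ (by omega)
  have h6 : (n + 1) * (d * d) ≤ (n + 1) * (n + 1) * (d * d) := Nat.mul_le_mul_right _ (by omega)
  unfold OV3.vertexCount
  omega

/-- The single number `U` bounds the loop lengths and all stored values, and is also the address
from which the vectors are stored, since it exceeds the lengths of both the input and the output. -/
theorem Triple.graphOfInstance {n d U : ℕ} (hn : 1 ≤ n) (hd : 1 ≤ d) (I : OV3 n d)
    (hU : 20 * ((n + 1) * (n + 1) * (d * d)) = U) :
    Triple U U .graphOfInstance (State.init I.encode) fun s' =>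
      ∀ a < U, s'.mem a = (OV3.graphCode I.extend 0).getD a 0 := by
  have h4 : (n + 1) * (n + 1) * 1 ≤ (n + 1) * (n + 1) * (d * d) :=
    Nat.mul_le_mul_left _ (Nat.mul_pos hd hd)
  have h5 : (n + 1) * 1 ≤ (n + 1) * (n + 1) := Nat.mul_le_mul_left _ (by omega)
  have h6 : 1 * d ≤ (n + 1) * (n + 1) * (d * d) :=
    Nat.mul_le_mul (Nat.mul_pos (by omega) (by omega)) (Nat.le_mul_of_pos_left _ hd)
  have h7 : (n + 1) * d ≤ (n + 1) * (n + 1) * (d * d) :=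
    Nat.mul_le_mul (Nat.le_mul_of_pos_left _ (by omega)) (Nat.le_mul_of_pos_left _ hd)
  have h8 : (n + 1) * ((n + 1) * (d * d)) = (n + 1) * (n + 1) * (d * d) := by ring
  have hlen : I.encode.length ≤ U := by
    have h9 : n * d ≤ (n + 1) * d := Nat.mul_le_mul_right _ (by omega)
    simp only [OV3.encode, List.length_cons, List.length_append, length_encodeVectors]
    omega
  have hbound : ∀ a, I.encode.getD a 0 ≤ U :=
    getD_le fun a ha => (I.le_of_mem_encode ha).trans (by omega)
  set s₀ := State.init I.encode with hs₀
  have hm0 : s₀.mem 0 = n := rfl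
  have hm1 : s₀.mem 1 = d := rfl
  refine Triple.seq (P := fun s => s = s₀.setReg 7 n)
    (Triple.assign (by omega) rfl (by simp [hm0]; omega) rfl) ?_
  rintro _ rfl
  refine Triple.seq (P := fun s => s = (s₀.setReg 7 n).setReg 1 d)
    (Triple.assign (by omega) rfl (by simp [State.setReg, hm1]; omega) rfl) ?_
  rintro _ rfl
  refine Triple.seq (P := fun s => s = ((s₀.setReg 7 n).setReg 1 d).setReg 0 (n + 1))
    (Triple.assign (by omega) rfl (by simp [State.setReg]; omega) (by simp [State.setReg])) ?_
  rintro _ rfl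
  refine Triple.seq (P := fun s => s = (((s₀.setReg 7 n).setReg 1 d).setReg 0 (n + 1)).setReg 2 U)
    (Triple.assign (by omega) rfl (by simp [State.setReg, M, D]; omega)
      (by simp [State.setReg, M, D, hU])) ?_
  rintro _ rfl
  refine Triple.seq (P := fun s => s = ((((s₀.setReg 7 n).setReg 1 d).setReg 0 (n + 1)).setReg 2
    U).setReg 6 (3 * ((n + 1) * d)))
    (Triple.assign (by omega) rfl (by simp [State.setReg, M, D]; omega)
      (by simp [State.setReg, M, D])) ?_
  rintro _ rfl
  -- For the additional vector the address points to unrelated data, which the factor 0 suppresses.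
  let f : ℕ → ℕ := fun t => (if t % ((n + 1) * d) / d = n then 1 else 0) |||
    ((if t % ((n + 1) * d) / d < n then 1 else 0) *
      I.encode.getD (2 + ((t / ((n + 1) * d) * n + t % ((n + 1) * d) / d) * d +
        t % ((n + 1) * d) % d)) 0)
  refine Triple.seq (Triple.tabulate (N := 3 * ((n + 1) * d)) U f (by omega) (by omega) (by omega) rfl (by omega) rfl
    (by decide) ?_) ?_
  · intro t ht
    have hd0 : 0 < d := hd
    have hmd : 0 < (n + 1) * d := Nat.mul_pos (by omega) hd
    have hσ : t / ((n + 1) * d) < 3 := (Nat.div_lt_iff_lt_mul hmd).2 ht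
    have hi : t % ((n + 1) * d) / d < n + 1 := (Nat.div_lt_iff_lt_mul hd0).2 (Nat.mod_lt _ hmd)
    have hx : t % ((n + 1) * d) % d < d := Nat.mod_lt _ hd0
    refine ⟨rfl, ?_, ?_⟩
    -- The input is read below `U`, so it is not affected by the copy that is being written.
    · have haddr : 2 + ((t / ((n + 1) * d) * n + t % ((n + 1) * d) / d) * d +
          t % ((n + 1) * d) % d) < U := by
        have h9 : t / ((n + 1) * d) * n ≤ 2 * n := Nat.mul_le_mul_right _ (by omega)
        have h10 : (t / ((n + 1) * d) * n + t % ((n + 1) * d) / d) * d ≤ (3 * (n + 1)) * d :=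
          Nat.mul_le_mul_right _ (by omega)
        rw [mul_assoc] at h10
        omega
      simp only [Expr.orLast, M, D, T, eval_or, eval_eq, eval_lt, eval_mul, eval_load, eval_add,
        eval_div, eval_mod, eval_reg, eval_two]
      change (if t % ((n + 1) * d) / d = n then 1 else 0) |||
        ((if t % ((n + 1) * d) / d < n then 1 else 0) * fill s₀.mem U t f
          (2 + ((t / ((n + 1) * d) * n + t % ((n + 1) * d) / d) * d + t % ((n + 1) * d) % d))) = _
      rw [fill_of_not (.inl haddr)]
      rfl
    · refine (or_le_add _ _).trans ?_
      by_cases h : t % ((n + 1) * d) / d = n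
      · simp only [h, if_true, lt_irrefl, if_false, zero_mul]
        omega
      · rw [if_neg h, zero_add]
        split_ifs
        · rw [one_mul]
          exact hbound _
        · omega
  rintro _ rfl
  refine (Triple.buildGraph (J := I.extend) (Q := 0) (F := U) rfl rfl rfl rfl
    (holdsVectors_of_family fun σ hσ i x => ?_) ?_ (by omega) (by omega) le_rfl le_rfl ?_).mono
    le_rfl fun s' h => h.1
  · have hix := index_lt i.2 x.2
    have e1 : (σ * (n + 1) + (i : ℕ)) * d + x = σ * ((n + 1) * d) + (i * d + x) := by ring
    have hlt : (σ * (n + 1) + (i : ℕ)) * d + x < 3 * ((n + 1) * d) := by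
      rw [e1]
      exact index_lt hσ hix
    simp only []
    rw [fill_of_lt hlt, e1]
    simp only [f]
    rw [index_div hix, index_mod hix, index_div x.2, index_mod x.2, OV3.family_extend]
    by_cases h : (i : ℕ) < n
    · rw [if_neg (by omega), if_pos h, dif_pos h, one_mul, Nat.zero_or]
      exact I.getD_encode hσ ⟨i, h⟩ x
    · rw [if_pos (by omega), if_neg h, dif_neg h, zero_mul]
      rfl
  · exact (length_graphCode_le hd).trans (by omega)
  · exact (vertexCount_le hd).trans (by omega)

end WordRAM

/-- The reduction from three orthogonal vectors to distinguishing diameter `5` from diameter `8`. -/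
theorem exists_reduction_to_diameter :
    ∃ (p : WordRAM.Prog) (c : ℕ), ∀ (n d : ℕ), 1 ≤ n → 1 ≤ d → ∀ I : OV3 n d,
      ∃ (N : ℕ) (G : SimpleGraph (Fin N)) (xs : List ℕ),
        EncodesGraph G xs ∧
        WordRAM.RunsWithin p I.encode ((n + d + 2) ^ c) (c * ((n : ℝ) ^ 2 * (d : ℝ) ^ 2))
          (fun mem => ∀ i : Fin xs.length, mem i = xs.get i) ∧
        N ≤ c * (n ^ 2 + n * d ^ 2) ∧
        G.edgeSet.ncard ≤ c * (n ^ 2 * d ^ 2) ∧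
        (¬ I.HasSolution → ∀ u v : Fin N, G.edist u v ≤ 5) ∧
        (I.HasSolution → ∃ u v : Fin N, 8 ≤ G.edist u v) := by
  set p := WordRAM.Cmd.graphOfInstance with hp
  -- With U = 20(n+1)²d², U + 1 is at most 84n²d², and U is at most (n+d+2)^7, where 20 < 4³
  -- accounts for three of the seven factors. The 36 bounds the numbers of vertices and edges.
  refine ⟨p.compile, 84 * p.cost + 7 * p.size + 36, fun n d hn hd I => ?_⟩
  have hsol := OV3.hasSolution_extend hn I
  have hB : ∀ x, I.extend.B (Fin.last n) x = true := fun x => by simp [OV3.extend]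
  have hm : (n + 1) * (n + 1) ≤ 4 * n ^ 2 := by nlinarith
  have hmd : (n + 1) * (n + 1) * (d * d) ≤ 4 * (n ^ 2 * d ^ 2) := by
    calc (n + 1) * (n + 1) * (d * d) ≤ 4 * n ^ 2 * (d * d) := Nat.mul_le_mul_right _ hm
      _ = 4 * (n ^ 2 * d ^ 2) := by ring
  have hd2 : 1 ≤ d ^ 2 := Nat.pow_pos hd
  have hn2 : 1 ≤ n ^ 2 := Nat.pow_pos hn
  have hnd : 1 ≤ n ^ 2 * d ^ 2 := Nat.mul_pos hn2 hd2
  refine ⟨_, OV3.finGraph I.extend 0, OV3.graphCode I.extend 0, OV3.encodesGraph_graphCode, ?_, ?_,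
    ?_, fun h => OV3.finGraph_edist_le_five hB (fun h' => h (hsol.1 h')),
    fun h => OV3.finGraph_exists_eight_le_edist (hsol.2 h)⟩
  · set U := 20 * ((n + 1) * (n + 1) * (d * d)) with hU
    have hpos : 1 ≤ (n + 1) * (n + 1) * (d * d) :=
      Nat.mul_pos (Nat.mul_pos (by omega) (by omega)) (Nat.mul_pos hd hd)
    have hle : n + d + 1 ≤ U := by
      have h1 : n + 1 ≤ (n + 1) * (n + 1) * (d * d) := by
        calc n + 1 ≤ (n + 1) * (n + 1) := Nat.le_mul_of_pos_left _ (by omega)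
          _ ≤ _ := Nat.le_mul_of_pos_right _ (Nat.mul_pos hd hd)
      have h2 : d ≤ (n + 1) * (n + 1) * (d * d) := by
        calc d ≤ d * d := Nat.le_mul_of_pos_left _ hd
          _ ≤ _ := Nat.le_mul_of_pos_left _ (by positivity)
      omega
    have hVB : U ^ p.size < (n + d + 2) ^ (84 * p.cost + 7 * p.size + 36) := by
      have h1 : U ≤ (n + d + 2) ^ 7 := by
        have h2 : 4 ^ 3 ≤ (n + d + 2) ^ 3 := Nat.pow_le_pow_left (by omega) 3
        calc U ≤ (n + d + 2) ^ 3 * ((n + d + 2) * (n + d + 2) * ((n + d + 2) * (n + d + 2))) := by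
              refine Nat.mul_le_mul (by omega) (Nat.mul_le_mul ?_ ?_) <;>
                exact Nat.mul_le_mul (by omega) (by omega)
          _ = (n + d + 2) ^ 7 := by ring
      calc U ^ p.size ≤ ((n + d + 2) ^ 7) ^ p.size := Nat.pow_le_pow_left h1 _
        _ = (n + d + 2) ^ (7 * p.size) := (pow_mul ..).symm
        _ < _ := Nat.pow_lt_pow_right (by omega) (by omega)
    obtain ⟨s, t, he, ht, -, -, hs⟩ := WordRAM.Triple.graphOfInstance hn hd I hU.symm
      (WordRAM.State.init_clean _)
      (WordRAM.State.init_boundedBy fun a ha => (I.le_of_mem_encode ha).trans hle) (by omega) _ hVB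
    refine ⟨s, t, he, ?_, fun i => ?_⟩
    · have h1 : t ≤ (84 * p.cost + 7 * p.size + 36) * (n ^ 2 * d ^ 2) := by
        calc t ≤ (U + 1) * p.cost := ht
          _ ≤ (84 * (n ^ 2 * d ^ 2)) * p.cost := Nat.mul_le_mul_right _ (by omega)
          _ = 84 * p.cost * (n ^ 2 * d ^ 2) := by ring
          _ ≤ _ := Nat.mul_le_mul_right _ (by omega)
      exact_mod_cast h1
    · rw [hs i (i.2.trans_le ((WordRAM.length_graphCode_le hd).trans (by omega)))]
      rw [List.getD_eq_getElem _ _ i.2]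
      rfl
  · have h1 : (n + 1) * (d * d) ≤ 2 * (n * d ^ 2) := by
      calc (n + 1) * (d * d) ≤ (2 * n) * (d * d) := Nat.mul_le_mul_right _ (by omega)
        _ = 2 * (n * d ^ 2) := by ring
    have h2 : n + 1 ≤ 2 * n ^ 2 := by nlinarith
    refine (?_ : _ ≤ 36 * (n ^ 2 + n * d ^ 2)).trans (Nat.mul_le_mul_right _ (by omega))
    unfold OV3.vertexCount
    omega
  · refine OV3.ncard_edgeSet_finGraph_le.trans ?_
    have h1 : n ^ 2 * 1 ≤ n ^ 2 * d ^ 2 := Nat.mul_le_mul_left _ hd2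
    have h2 : (n + 1) * ((n + 1) * (d * d)) = (n + 1) * (n + 1) * (d * d) := by ring
    rw [h2]
    refine (?_ : _ ≤ 36 * (n ^ 2 * d ^ 2)).trans (Nat.mul_le_mul_right _ (by omega))
    omega

/-! ## From satisfiability to three orthogonal vectors -/

namespace CNF

variable {N : ℕ}

/-- The number of variables per group. -/
def groupSize (N : ℕ) : ℕ := (N + 2) / 3

/-- The vector of the partial assignment `i` of the variables in the group `σ`: its entries are
`true` for the clauses that are not satisfied, and there is one additional entry `false`. -/
def groupVector (φ : CNF N) (σ : ℕ) (i : Fin (2 ^ groupSize N)) (x : Fin (φ.length + 1)) : Bool :=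
  if h : (x : ℕ) < φ.length then
    !φ[(x : ℕ)].any fun l => decide ((l.1 : ℕ) / groupSize N = σ) &&
      ((i : ℕ).testBit (l.1 % groupSize N) == l.2)
  else false

/-- The vectors of the partial assignments of the three groups of variables. -/
def toOV3 (φ : CNF N) : OV3 (2 ^ groupSize N) (φ.length + 1) where
  A := φ.groupVector 0
  B := φ.groupVector 1
  C := φ.groupVector 2

theorem family_toOV3 (φ : CNF N) {σ : ℕ} (hσ : σ < 3) : φ.toOV3.family σ = φ.groupVector σ := by
  interval_cases σ <;> rfl

/-- A product of entries is 1 exactly when none of the three partial assignments satisfies the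
clause, and every literal belongs to exactly one group. The additional entry `false` is harmless and
keeps the dimension positive for the empty formula. -/
theorem hasSolution_toOV3 (φ : CNF N) : φ.toOV3.HasSolution ↔ φ.Satisfiable := by
  rw [OV3.hasSolution_iff]
  constructor
  · rintro ⟨i, j, k, h⟩
    refine ⟨fun v => Nat.testBit (if (v : ℕ) / groupSize N = 0 then (i : ℕ) else
      if (v : ℕ) / groupSize N = 1 then j else k) (v % groupSize N), fun C hC => ?_⟩
    obtain ⟨x, hx, rfl⟩ := List.getElem_of_mem hC
    have key : ∀ (σ : ℕ) (i : Fin (2 ^ groupSize N)),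
        ¬ φ.groupVector σ i ⟨x, by omega⟩ = true → ∃ l ∈ φ[x], (l.1 : ℕ) / groupSize N = σ ∧
          (i : ℕ).testBit (l.1 % groupSize N) = l.2 := by
      intro σ i h
      simp only [groupVector, hx, dif_pos, Bool.not_eq_true, Bool.not_eq_false', List.any_eq_true,
        Bool.and_eq_true, decide_eq_true_eq, beq_iff_eq] at h
      exact h
    have := h ⟨x, by omega⟩
    rw [not_and_or, not_and_or] at this
    rcases this with h | h | h
    · obtain ⟨l, hl, h1, h2⟩ := key 0 i h
      exact ⟨l, hl, by simp only [h1, if_true]; exact h2⟩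
    · obtain ⟨l, hl, h1, h2⟩ := key 1 j h
      exact ⟨l, hl, by simpa only [h1, one_ne_zero, if_false, if_true] using h2⟩
    · obtain ⟨l, hl, h1, h2⟩ := key 2 k h
      exact ⟨l, hl, by simpa [h1] using h2⟩
  · rintro ⟨τ, h⟩
    -- The groups may have more room than there are variables; the surplus bits are `false`.
    let a : ℕ → Fin (2 ^ groupSize N) := fun σ => ⟨Nat.ofBits fun b : Fin (groupSize N) =>
      if h : σ * groupSize N + b < N then τ ⟨_, h⟩ else false, Nat.ofBits_lt_two_pow _⟩
    refine ⟨a 0, a 1, a 2, fun x ⟨h0, h1, h2⟩ => ?_⟩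
    have h0 : φ.groupVector 0 (a 0) x = true := h0
    have h1 : φ.groupVector 1 (a 1) x = true := h1
    have h2 : φ.groupVector 2 (a 2) x = true := h2
    by_cases hx : (x : ℕ) < φ.length
    · obtain ⟨l, hl, hτ⟩ := h _ (List.getElem_mem hx)
      have hN := l.1.2
      have hg : 0 < groupSize N := by unfold groupSize; omega
      have hσ : (l.1 : ℕ) / groupSize N < 3 :=
        (Nat.div_lt_iff_lt_mul hg).2 (by unfold groupSize; omega)
      have hbit : ((a (l.1 / groupSize N) : Fin _) : ℕ).testBit (l.1 % groupSize N) = l.2 := by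
        have h3 : (l.1 : ℕ) / groupSize N * groupSize N + l.1 % groupSize N = l.1 :=
          Nat.div_add_mod' _ _
        simp only [a]
        rw [Nat.testBit_ofBits_lt _ _ (Nat.mod_lt _ hg)]
        simp only [h3, hN, dif_pos]
        exact hτ
      have key : φ.groupVector (l.1 / groupSize N) (a (l.1 / groupSize N)) x = false := by
        simp only [groupVector, hx, dif_pos, Bool.not_eq_false', List.any_eq_true]
        exact ⟨l, hl, by simp [hbit]⟩
      generalize (l.1 : ℕ) / groupSize N = σ at *
      have hσ' : σ = 0 ∨ σ = 1 ∨ σ = 2 := by omega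
      rcases hσ' with rfl | rfl | rfl
      · simp [key] at h0
      · simp [key] at h1
      · simp [key] at h2
    · simp [groupVector, hx] at h0

/-- The position of a clause in the encoding of a formula. -/
def clausePos (φ : CNF N) (x : ℕ) : ℕ := 2 + ((φ.take x).map fun C => C.length + 1).sum

/-- The words for a clause. -/
def clauseWords (C : List (Fin N × Bool)) : List ℕ :=
  C.length :: C.map fun l => 2 * (l.1 : ℕ) + l.2.toNat

theorem length_flatMap_clauseWords (φ : CNF N) :
    (φ.flatMap clauseWords).length = (φ.map fun C => C.length + 1).sum := by
  simp [List.length_flatMap, clauseWords]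

theorem getD_encode_clausePos (φ : CNF N) {x : ℕ} (hx : x < φ.length) {k : ℕ}
    (hk : k ≤ φ[x].length) :
    φ.encode.getD (φ.clausePos x + k) 0 = (clauseWords φ[x]).getD k 0 := by
  have h1 : φ.encode = N :: φ.length :: φ.flatMap clauseWords := rfl
  have h2 : φ.clausePos x + k = ((φ.take x).flatMap clauseWords).length + k + 2 := by
    rw [clausePos, length_flatMap_clauseWords]
    omega
  have h3 : φ.flatMap clauseWords = (φ.take x).flatMap clauseWords ++
      (clauseWords φ[x] ++ (φ.drop (x + 1)).flatMap clauseWords) := by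
    conv_lhs => rw [← List.take_append_drop x φ, List.drop_eq_getElem_cons hx]
    rw [List.flatMap_append, List.flatMap_cons]
  rw [h1, h2, List.getD_cons_succ, List.getD_cons_succ, h3,
    List.getD_append_right _ _ _ _ (by omega), Nat.add_sub_cancel_left,
    List.getD_append _ _ _ _ (by simp [clauseWords]; omega)]

theorem getD_clausePos (φ : CNF N) {x : ℕ} (hx : x < φ.length) :
    φ.encode.getD (φ.clausePos x) 0 = φ[x].length :=
  φ.getD_encode_clausePos hx (Nat.zero_le _)

theorem getD_clausePos_add (φ : CNF N) {x : ℕ} (hx : x < φ.length) {k : ℕ}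
    (hk : k < φ[x].length) : φ.encode.getD (φ.clausePos x + 1 + k) 0 =
      2 * (φ[x][k].1 : ℕ) + φ[x][k].2.toNat := by
  rw [add_assoc, getD_encode_clausePos _ hx (by omega), add_comm 1, clauseWords,
    List.getD_cons_succ, List.getD_eq_getElem _ _ (by simpa using hk), List.getElem_map]

/-- Clauses have different lengths, so their positions must be tabulated; this is the recursion by
which one pass finds them all. -/
theorem clausePos_succ (φ : CNF N) {x : ℕ} (hx : x < φ.length) :
    φ.clausePos (x + 1) = φ.clausePos x + 1 + φ.encode.getD (φ.clausePos x) 0 := by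
  rw [getD_clausePos _ hx, clausePos, clausePos, List.take_succ_eq_append_getElem hx]
  simp only [List.map_append, List.sum_append, List.map_cons, List.map_nil, List.sum_cons,
    List.sum_nil]
  omega

theorem sum_length_le {K : ℕ} (φ : CNF N) (h : ∀ C ∈ φ, C.length ≤ K) :
    (φ.map fun C => C.length + 1).sum ≤ φ.length * (K + 1) := by
  have := List.sum_le_card_nsmul (φ.map fun C => C.length + 1) (K + 1) (by
    intro k hk
    obtain ⟨C, hC, rfl⟩ := List.mem_map.1 hk
    have := h C hC
    omega)
  simpa using this

theorem clausePos_le {K : ℕ} (φ : CNF N) (h : ∀ C ∈ φ, C.length ≤ K) (x : ℕ) :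
    φ.clausePos x ≤ 2 + φ.length * (K + 1) := by
  have h1 := sum_length_le (φ.take x) fun C hC => h C (List.mem_of_mem_take hC)
  have h2 : (φ.take x).length * (K + 1) ≤ φ.length * (K + 1) :=
    Nat.mul_le_mul_right _ (by simp)
  unfold clausePos
  omega

theorem length_encode_le {K : ℕ} (φ : CNF N) (h : ∀ C ∈ φ, C.length ≤ K) :
    φ.encode.length ≤ 2 + φ.length * (K + 1) := by
  have h1 := sum_length_le φ h
  have h2 : φ.encode.length = (φ.flatMap clauseWords).length + 2 := rfl
  rw [length_flatMap_clauseWords] at h2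
  omega

theorem le_of_mem_encode {K : ℕ} (φ : CNF N) (h : ∀ C ∈ φ, C.length ≤ K) {a : ℕ}
    (ha : a ∈ φ.encode) : a ≤ 2 * N + 1 + φ.length + K := by
  have h1 : φ.encode = N :: φ.length :: φ.flatMap clauseWords := rfl
  rw [h1] at ha
  simp only [List.mem_cons, List.mem_flatMap, clauseWords, List.mem_map] at ha
  rcases ha with rfl | rfl | ⟨C, hC, rfl | ⟨l, hl, rfl⟩⟩
  · omega
  · omega
  · have := h C hC; omega
  · have := l.1.2
    have := Bool.toNat_le l.2
    omega

/-- The entry `x` of the vector `i` of the family `σ`, computed from the words that represent the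
formula. -/
def entry (φ : CNF N) (K σ i x : ℕ) : Bool :=
  decide (x < φ.length) && !(List.range K).any fun k =>
    decide (k < φ.encode.getD (φ.clausePos x) 0) &&
      (decide (φ.encode.getD (φ.clausePos x + 1 + k) 0 / 2 / groupSize N = σ) &&
        decide ((i >>> (φ.encode.getD (φ.clausePos x + 1 + k) 0 / 2 % groupSize N)) % 2 =
          φ.encode.getD (φ.clausePos x + 1 + k) 0 % 2))

/-- Since `K` is a constant, the search through a clause becomes a fixed disjunction over `K` slots,
guarded by the length of the clause. It then fits into one expression and no nested loop is needed.
-/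
theorem groupVector_eq_entry {K : ℕ} (φ : CNF N) (hK : ∀ C ∈ φ, C.length ≤ K) (σ : ℕ)
    (i : Fin (2 ^ groupSize N)) (x : Fin (φ.length + 1)) :
    φ.groupVector σ i x = φ.entry K σ i x := by
  unfold groupVector entry
  by_cases hx : (x : ℕ) < φ.length
  · rw [dif_pos hx, decide_eq_true hx, Bool.true_and]
    congr 1
    rw [Bool.eq_iff_iff, List.any_eq_true, List.any_eq_true]
    -- The word 2v + b is decoded into the variable v and the sign b by division by 2.
    have hbit : ∀ k (hk : k < φ[(x : ℕ)].length),
        (decide (φ.encode.getD (φ.clausePos x + 1 + k) 0 / 2 / groupSize N = σ) &&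
          decide (((i : ℕ) >>> (φ.encode.getD (φ.clausePos x + 1 + k) 0 / 2 % groupSize N)) % 2 =
            φ.encode.getD (φ.clausePos x + 1 + k) 0 % 2)) =
        (decide ((φ[(x : ℕ)][k].1 : ℕ) / groupSize N = σ) &&
          ((i : ℕ).testBit (φ[(x : ℕ)][k].1 % groupSize N) == φ[(x : ℕ)][k].2)) := by
      intro k hk
      rw [getD_clausePos_add _ hx hk]
      generalize φ[(x : ℕ)][k] = l
      obtain ⟨v, b⟩ := l
      have h1 : (2 * (v : ℕ) + b.toNat) / 2 = v := by cases b <;> simp; omega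
      have h2 : (2 * (v : ℕ) + b.toNat) % 2 = b.toNat := by cases b <;> simp
      rw [h1, h2]
      congr 1
      rw [Nat.testBit_eq_decide_div_mod_eq, Nat.shiftRight_eq_div_pow]
      rcases Nat.mod_two_eq_zero_or_one ((i : ℕ) / 2 ^ ((v : ℕ) % groupSize N)) with h | h <;>
        cases b <;> simp [h]
    constructor
    · rintro ⟨l, hl, h⟩
      obtain ⟨k, hk, rfl⟩ := List.getElem_of_mem hl
      refine ⟨k, List.mem_range.2 (hk.trans_le (hK _ (List.getElem_mem hx))), ?_⟩
      rw [hbit k hk, h, getD_clausePos _ hx]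
      simpa using hk
    · rintro ⟨k, -, h⟩
      rw [Bool.and_eq_true, getD_clausePos _ hx, decide_eq_true_eq] at h
      rw [hbit k h.1] at h
      exact ⟨_, List.getElem_mem h.1, h.2⟩
  · simp [hx]

end CNF

namespace WordRAM

open WordRAM.Expr

/-! ## A program for the reduction from satisfiability -/

/-- The number of the literal with index `k` in the clause with index `T % (M * D) % D`, followed
by its sign. -/
def Expr.literal (k : ℕ) : Expr := .load (.load (.reg 11 + T % (M * D) % D) + 1 + .lit k)

/-- Whether one of the first `k` literals of the clause with index `T % (M * D) % D` is true. -/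
def Expr.anyLiteral : ℕ → Expr
  | 0 => 0
  | k + 1 => .op .or (anyLiteral k)
    (.op .lt (.lit k) (.load (.load (.reg 11 + T % (M * D) % D))) *
      (.op .eq (literal k / 2 / .reg 10) (T / (M * D)) *
        .op .eq (.op .shr (T % (M * D) / D) (literal k / 2 % .reg 10) % 2) (literal k % 2)))

theorem Expr.wf_anyLiteral (k : ℕ) : (anyLiteral k).wf = true := by
  induction k with
  | zero => rfl
  | succ k ih =>
    have h : (anyLiteral (k + 1)).wf = ((true && (anyLiteral k).wf) && true) := rfl
    rw [h, ih]
    rfl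

/-- The entry of a vector, where `T` runs through all positions. -/
def Expr.clauseEntry (K : ℕ) : Expr :=
  .op .lt (T % (M * D) % D) (.reg 9) * (1 - anyLiteral K)

theorem Expr.wf_clauseEntry (K : ℕ) : (Expr.clauseEntry K).wf = true := by
  change ((true && true && (true && true && (anyLiteral K).wf)) : Bool) = true
  rw [wf_anyLiteral]
  rfl

/-- On the values 0 and 1, products express conjunction, bitwise or expresses disjunction, and
subtraction from 1 expresses negation. -/
theorem Expr.eval_clauseEntry {N K : ℕ} (φ : CNF N) {s : State} {σ i x : ℕ}
    (hσ : (T / (M * D)).eval s = σ) (hi : (T % (M * D) / D).eval s = i)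
    (hx : (T % (M * D) % D).eval s = x) (h9 : s.reg 9 = φ.length)
    (h10 : s.reg 10 = CNF.groupSize N) (hpos : s.mem (s.reg 11 + x) = φ.clausePos x)
    (hmem : ∀ k ≤ K, s.mem (φ.clausePos x + k) = φ.encode.getD (φ.clausePos x + k) 0) :
    (Expr.clauseEntry K).eval s = (φ.entry K σ i x).toNat := by
  simp only [eval_div, eval_mod, eval_mul] at hσ hi hx
  have h1 : ∀ k ≤ K, (anyLiteral k).eval s = ((List.range k).any fun k =>
    decide (k < φ.encode.getD (φ.clausePos x) 0) &&
      (decide (φ.encode.getD (φ.clausePos x + 1 + k) 0 / 2 / CNF.groupSize N = σ) &&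
        decide ((i >>> (φ.encode.getD (φ.clausePos x + 1 + k) 0 / 2 % CNF.groupSize N)) % 2 =
          φ.encode.getD (φ.clausePos x + 1 + k) 0 % 2))).toNat := by
    intro k hk
    induction k with
    | zero => rfl
    | succ k ih =>
      rw [anyLiteral, eval_or, ih (by omega), List.range_succ, List.any_append]
      have h2 : (literal k).eval s = φ.encode.getD (φ.clausePos x + 1 + k) 0 := by
        simp only [literal, eval_load, eval_add, eval_mod, eval_mul, hx, eval_reg, hpos, eval_one,
          eval_lit]
        rw [add_assoc, hmem _ (by omega)]
      have h3 : (load (load (reg 11 + T % (M * D) % D))).eval s =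
          φ.encode.getD (φ.clausePos x) 0 := by
        simp only [eval_load, eval_add, eval_mod, eval_mul, hx, eval_reg, hpos]
        exact hmem 0 (by omega)
      simp only [eval_mul, eval_lt, eval_eq, eval_mod, eval_shr, eval_div, h2, h3, hσ, hi,
        eval_reg, h10, eval_lit, eval_two]
      generalize List.any (List.range k) _ = b
      simp only [List.any_cons, List.any_nil, Bool.or_false]
      by_cases a1 : k < φ.encode.getD (φ.clausePos x) 0 <;>
      by_cases a2 : φ.encode.getD (φ.clausePos x + 1 + k) 0 / 2 / CNF.groupSize N = σ <;>
      by_cases a3 : (i >>> (φ.encode.getD (φ.clausePos x + 1 + k) 0 / 2 % CNF.groupSize N)) % 2 =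
          φ.encode.getD (φ.clausePos x + 1 + k) 0 % 2 <;>
      cases b <;> simp only [a1, a2, a3, if_true, if_false, decide_true, decide_false] <;> rfl
  simp only [clauseEntry, eval_mul, eval_lt, eval_mod, hx, eval_reg, h9, eval_sub, h1 K le_rfl,
    eval_one, CNF.entry]
  generalize List.any (List.range K) _ = b
  by_cases a : x < φ.length <;> cases b <;> simp [a]

theorem Triple.assign_eq {U V : ℕ} {s : State} {r v : ℕ} {e : Expr} (hr : r < 100)
    (he : e.wf = true) (hev : e.eval s = v) (hv : v ≤ V) :
    Triple U V (.assign r e) s fun s' => s' = s.setReg r v :=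
  Triple.assign hr he (by rwa [hev]) (by rw [hev])

/-- The registers after the computation of the parameters of the graph. -/
structure Parameters {N : ℕ} (φ : CNF N) (q c : ℕ) (s : State) : Prop where
  reg0 : s.reg 0 = 2 ^ CNF.groupSize N + 1
  reg1 : s.reg 1 = φ.length + 1
  reg2 : s.reg 2 = c * ((2 ^ CNF.groupSize N + 1) * (2 ^ CNF.groupSize N + 1) *
    ((φ.length + 1) * (φ.length + 1)))
  reg3 : s.reg 3 = q * ((2 ^ CNF.groupSize N + 1) * (2 ^ CNF.groupSize N + 1) *
    ((φ.length + 1) * (φ.length + 1)))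
  reg6 : s.reg 6 = 3 * ((2 ^ CNF.groupSize N + 1) * (φ.length + 1))
  reg7 : s.reg 7 = 2 ^ CNF.groupSize N
  reg9 : s.reg 9 = φ.length
  reg10 : s.reg 10 = CNF.groupSize N
  reg11 : s.reg 11 = s.reg 2 + s.reg 6
  zero : ∀ r, 12 ≤ r → s.reg r = 0

/-- Compute the parameters of the graph. -/
def Cmd.parameters (q c : ℕ) : Cmd :=
  .seq (.assign 8 (.load 0)) <| .seq (.assign 9 (.load 1)) <|
  .seq (.assign 10 ((.reg 8 + 2) / 3)) <| .seq (.assign 7 1) <|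
  .seq (.loop 4 10 (.assign 7 (.reg 7 + .reg 7))) <|
  .seq (.assign 1 (.reg 9 + 1)) <| .seq (.assign 0 (.reg 7 + 1)) <|
  .seq (.assign 2 (.lit c * (M * M * (D * D)))) <|
  .seq (.assign 3 (.lit q * (M * M * (D * D)))) <| .seq (.assign 6 (3 * (M * D))) <|
  .assign 11 (Expr.F + .reg 6)

theorem Triple.parameters {N q c U V : ℕ} (φ : CNF N) (hU : CNF.groupSize N ≤ U)
    (hN : N ≤ V) (hg : CNF.groupSize N ≤ V)
    (hV : c * ((2 ^ CNF.groupSize N + 1) * (2 ^ CNF.groupSize N + 1) *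
      ((φ.length + 1) * (φ.length + 1))) + 3 * ((2 ^ CNF.groupSize N + 1) * (φ.length + 1)) ≤ V)
    (hqc : q ≤ c) :
    Triple U V (.parameters q c) (State.init φ.encode) fun s' =>
      Parameters φ q c s' ∧ s'.mem = (State.init φ.encode).mem := by
  have hX := Nat.mul_le_mul_right ((2 ^ CNF.groupSize N + 1) * (2 ^ CNF.groupSize N + 1) *
      ((φ.length + 1) * (φ.length + 1))) hqc
  have hm : (2 ^ CNF.groupSize N + 1) * 1 ≤ (2 ^ CNF.groupSize N + 1) * (φ.length + 1) :=
    Nat.mul_le_mul_left _ (by omega)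
  have hd : 1 * (φ.length + 1) ≤ (2 ^ CNF.groupSize N + 1) * (φ.length + 1) :=
    Nat.mul_le_mul_right _ (Nat.le_add_left 1 _)
  set s₀ := State.init φ.encode with hs₀
  have hm0 : s₀.mem 0 = N := rfl
  have hm1 : s₀.mem 1 = φ.length := rfl
  refine Triple.seq (Triple.assign_eq (v := N) (by omega) rfl rfl hN) ?_
  rintro _ rfl
  refine Triple.seq (Triple.assign_eq (v := φ.length) (by omega) rfl rfl (by omega)) ?_
  rintro _ rfl
  refine Triple.seq (Triple.assign_eq (v := CNF.groupSize N) (by omega) rfl rfl hg) ?_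
  rintro _ rfl
  refine Triple.seq (Triple.assign_eq (v := 1) (by omega) rfl rfl (by omega)) ?_
  rintro _ rfl
  generalize hs₁ : (((s₀.setReg 8 N).setReg 9 φ.length).setReg 10 (CNF.groupSize N)).setReg 7 1 = s₁
  have h4 : s₁.reg 10 = CNF.groupSize N := by subst hs₁; rfl
  -- The power of 2 is obtained by repeated doubling, as well-formed expressions contain no left
  -- shift.
  refine Triple.seq (P := fun s => s = (s₁.setReg 7 (2 ^ CNF.groupSize N)).setReg 4
    (CNF.groupSize N)) (Triple.loop (by omega) (by omega) h4 hU
      (fun t s => s = (s₁.setReg 7 (2 ^ t)).setReg 4 t) ?_ ?_ ?_ fun _ h => h) ?_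
  · subst hs₁; rw [pow_zero, State.setReg_setReg]
  · rintro t _ rfl
    exact ⟨by simp [State.setReg], by simp [State.setReg, h4]⟩
  · rintro t _ ht rfl
    have h5 : 2 ^ (t + 1) ≤ 2 ^ CNF.groupSize N := Nat.pow_le_pow_right (by omega) ht
    refine (Triple.assign_eq (v := 2 ^ (t + 1)) (by omega) rfl ?_ (by omega)).mono le_rfl ?_
    · simp [State.setReg, pow_succ, mul_two]
    · rintro _ rfl
      refine ⟨by simp [State.setReg], ?_⟩
      rw [State.setReg_comm _ (by omega : (4 : ℕ) ≠ 7), State.setReg_setReg, State.setReg_setReg]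
  rintro _ rfl
  subst hs₁
  refine Triple.seq (Triple.assign_eq (v := φ.length + 1) (by omega) rfl rfl (by omega)) ?_
  rintro _ rfl
  refine Triple.seq (Triple.assign_eq (v := 2 ^ CNF.groupSize N + 1) (by omega) rfl rfl
    (by omega)) ?_
  rintro _ rfl
  refine Triple.seq (Triple.assign_eq (by omega) rfl rfl ?_) ?_
  · simp [State.setReg, M, D]; omega
  rintro _ rfl
  refine Triple.seq (Triple.assign_eq (by omega) rfl rfl ?_) ?_
  · simp [State.setReg, M, D]; omega
  rintro _ rfl
  refine Triple.seq (Triple.assign_eq (by omega) rfl rfl ?_) ?_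
  · simp [State.setReg, M, D]; omega
  rintro _ rfl
  refine (Triple.assign_eq (by omega) rfl rfl ?_).mono le_rfl ?_
  · simp [State.setReg, M, D, Expr.F]; omega
  rintro _ rfl
  refine ⟨⟨rfl, rfl, rfl, rfl, rfl, rfl, rfl, rfl, rfl, fun r hr => ?_⟩, rfl⟩
  obtain ⟨r, rfl⟩ := Nat.exists_eq_add_of_le' hr
  rfl

/-- Compute the positions of the clauses, and write them to the memory from the address in the
register `11` on. -/
def Cmd.clauseTable : Cmd :=
  .seq (.store (.reg 11) 2) <| .tabulate 4 9 (.reg 11 + 1)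
    (.load (.reg 11 + T) + 1 + .load (.load (.reg 11 + T)))

theorem Triple.clauseTable {N K q c U V : ℕ} (φ : CNF N) (hK : ∀ C ∈ φ, C.length ≤ K) {s : State}
    (hs : Parameters φ q c s) (hmem : s.mem = (State.init φ.encode).mem)
    (hlen : 3 + φ.length * (K + 1) ≤ s.reg 11) (hU : φ.length ≤ U)
    (hV : 2 + φ.length * (K + 1) ≤ V) :
    Triple U V .clauseTable s fun s' => Parameters φ q c s' ∧
      (∀ x ≤ φ.length, s'.mem (s.reg 11 + x) = φ.clausePos x) ∧
      ∀ a, a < s.reg 11 ∨ s.reg 11 + φ.length < a → s'.mem a = s.mem a := by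
  refine Triple.seq (Triple.store (Q := fun s' => s' = s.setMem (s.reg 11) 2) rfl rfl
    (by simp; omega) rfl) ?_
  rintro _ rfl
  -- Position `t` is already in the table when position `t + 1` is computed from it; position 0 was
  -- stored beforehand.
  have key : ∀ t ≤ φ.length, fill (s.setMem (s.reg 11) 2).mem (s.reg 11 + 1) t
      (fun t => φ.clausePos (t + 1)) (s.reg 11 + t) = φ.clausePos t := by
    intro t ht
    cases t with
    | zero => rw [fill_zero]; simp [State.setMem, CNF.clausePos]
    | succ t =>
      rw [show s.reg 11 + (t + 1) = s.reg 11 + 1 + t by omega, fill_of_lt (by omega)]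
  refine Triple.mono le_rfl (Triple.tabulate (s.reg 11 + 1) (fun t => φ.clausePos (t + 1)) (by omega) (by omega)
    (by omega) (hs.reg9 : (s.setMem (s.reg 11) 2).reg 9 = _) hU rfl rfl ?_) ?_
  · intro t ht
    refine ⟨rfl, ?_, (φ.clausePos_le hK _).trans hV⟩
    simp only [eval_add, eval_load, eval_reg, eval_one, T]
    change fill (s.setMem (s.reg 11) 2).mem (s.reg 11 + 1) t (fun t => φ.clausePos (t + 1))
      (s.reg 11 + t) + 1 + fill (s.setMem (s.reg 11) 2).mem (s.reg 11 + 1) t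
        (fun t => φ.clausePos (t + 1)) (fill (s.setMem (s.reg 11) 2).mem (s.reg 11 + 1) t
      (fun t => φ.clausePos (t + 1)) (s.reg 11 + t)) = φ.clausePos (t + 1)
    have h1 := φ.clausePos_le hK t
    rw [key t ht.le, fill_of_not (.inl (by omega)), φ.clausePos_succ ht]
    simp only [State.setMem]
    rw [Function.update_of_ne (by omega), hmem]
    rfl
  · rintro _ rfl
    refine ⟨⟨hs.reg0, hs.reg1, hs.reg2, hs.reg3, hs.reg6, hs.reg7, hs.reg9, hs.reg10, hs.reg11,
      fun r hr => ?_⟩, ?_, ?_⟩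
    · simp only [State.setMem]
      rw [Function.update_of_ne (by omega), hs.zero r hr]
    · intro x hx
      cases x with
      | zero =>
        simp only [add_zero]
        rw [fill_of_not (.inl (by omega))]
        simp [State.setMem, CNF.clausePos]
      | succ x =>
        simp only []
        rw [show s.reg 11 + (x + 1) = s.reg 11 + 1 + x by omega, fill_of_lt (by omega)]
    · intro a ha
      simp only []
      rw [fill_of_not (by omega)]
      simp only [State.setMem]
      rw [Function.update_of_ne (by omega)]

end WordRAM

/-! ### From a formula to the graph -/

namespace WordRAM

open WordRAM.Expr

/-- Write the vectors of the instance to the memory from the address in the register `2` on. -/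
def Cmd.formulaVectors (K : ℕ) : Cmd := .tabulate 4 6 Expr.F (Expr.orLast (Expr.clauseEntry K))

theorem Triple.formulaVectors {N K q c U V : ℕ} (φ : CNF N) (hK : ∀ C ∈ φ, C.length ≤ K)
    {s : State} (hs : Parameters φ q c s)
    (htable : ∀ x ≤ φ.length, s.mem (s.reg 11 + x) = φ.clausePos x)
    (hmem : ∀ a < s.reg 2, s.mem a = φ.encode.getD a 0)
    (hF : 3 + φ.length * (K + 1) + K ≤ s.reg 2) (hU : s.reg 6 ≤ U) (hV : 2 ≤ V) :
    Triple U V (.formulaVectors K) s fun s' =>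
      HoldsVectors φ.toOV3.extend (s.reg 2) s'.mem ∧ (∀ r, r ≠ 4 → s'.reg r = s.reg r) ∧
      ∀ a, a < s.reg 2 ∨ s.reg 2 + s.reg 6 ≤ a → s'.mem a = s.mem a := by
  set n := 2 ^ CNF.groupSize N with hn
  set d := φ.length + 1 with hd
  have hd0 : 0 < d := by omega
  have hmd : 0 < (n + 1) * d := Nat.mul_pos (Nat.succ_pos n) hd0
  let f : ℕ → ℕ := fun t => (if t % ((n + 1) * d) / d = n then 1 else 0) |||
    ((if t % ((n + 1) * d) / d < n then 1 else 0) *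
      (φ.entry K (t / ((n + 1) * d)) (t % ((n + 1) * d) / d) (t % ((n + 1) * d) % d)).toNat)
  refine Triple.mono le_rfl (Triple.tabulate (s.reg 2) f (by omega) (by omega) (by omega) hs.reg6
    (by rw [← hs.reg6]; exact hU) rfl ?_ ?_) ?_
  · have h : (Expr.orLast (Expr.clauseEntry K)).wf =
      (true && true && (true && true && (Expr.clauseEntry K).wf)) := rfl
    rw [h, wf_clauseEntry]
    rfl
  · intro t ht
    have hx : t % ((n + 1) * d) % d < d := Nat.mod_lt _ hd0
    have hle := φ.clausePos_le hK (t % ((n + 1) * d) % d)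
    have h11 := hs.reg11
    refine ⟨rfl, ?_, ?_⟩
    · have hM : ∀ g, (T % (M * D) / D).eval ⟨Function.update s.reg 4 t, g⟩ =
          t % ((n + 1) * d) / d := fun g => by
        simp [T, M, D, hs.reg0, hs.reg1, ← hn, ← hd]
      rw [Expr.orLast, eval_or, eval_eq, eval_mul, eval_lt, hM, Expr.eval_clauseEntry φ
        (σ := t / ((n + 1) * d)) (x := t % ((n + 1) * d) % d) _ (hM _) _ hs.reg9 hs.reg10]
      · rw [eval_reg]
        simp only [Function.update_of_ne (show (7 : ℕ) ≠ 4 by omega), hs.reg7, ← hn]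
        rfl
      · simp only [Function.update_of_ne (show (11 : ℕ) ≠ 4 by omega)]
        -- The table of positions lies behind the space for the vectors, and the formula lies before
        -- it, so neither is overwritten.
        rw [fill_of_not (.inr (by rw [hs.reg6] at h11; omega)), htable _ (by omega)]
      · intro k hk
        simp only []
        rw [fill_of_not (.inl (by omega)), hmem _ (by omega)]
      · simp [T, M, D, hs.reg0, hs.reg1, ← hn, ← hd]
      · simp [T, M, D, hs.reg0, hs.reg1, ← hn, ← hd]
    · have h1 := Bool.toNat_le
        (φ.entry K (t / ((n + 1) * d)) (t % ((n + 1) * d) / d) (t % ((n + 1) * d) % d))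
      refine (or_le_add _ _).trans ?_
      split_ifs <;> omega
  rintro _ rfl
  refine ⟨holdsVectors_of_family fun σ hσ i x => ?_, fun r hr => by simp [hr], fun a ha => ?_⟩
  · have hix := index_lt i.2 x.2
    have e1 : (σ * (n + 1) + (i : ℕ)) * d + x = σ * ((n + 1) * d) + (i * d + x) := by ring
    have hlt : (σ * (n + 1) + (i : ℕ)) * d + x < 3 * ((n + 1) * d) := by
      rw [e1]
      exact index_lt hσ hix
    simp only []
    rw [fill_of_lt hlt, e1]
    simp only [f]
    rw [index_div hix, index_mod hix, index_div x.2, index_mod x.2, OV3.family_extend]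
    by_cases h : (i : ℕ) < n
    · rw [if_neg (by omega), if_pos h, dif_pos h, one_mul, Nat.zero_or, CNF.family_toOV3 _ hσ,
        CNF.groupVector_eq_entry _ hK]
    · rw [if_pos (by omega), if_neg h, dif_neg h, zero_mul]
      rfl
  · rw [hs.reg6] at ha
    simp only []
    rw [fill_of_not ha]

/-- Set the registers up to `k` to `0`. -/
def Cmd.clearRegs : ℕ → Cmd
  | 0 => .assign 0 0
  | k + 1 => .seq (clearRegs k) (.assign (k + 1) 0)

theorem Triple.clearRegs {U V : ℕ} {s : State} {k : ℕ} (hk : k < 100) :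
    Triple U V (.clearRegs k) s fun s' =>
      s'.mem = s.mem ∧ ∀ r, s'.reg r = if r ≤ k then 0 else s.reg r := by
  induction k with
  | zero =>
    refine Triple.assign hk rfl (Nat.zero_le V) ⟨rfl, fun r => ?_⟩
    by_cases hr : r = 0 <;> simp [State.setReg, hr]
  | succ k ih =>
    refine Triple.seq (ih (by omega)) fun s' hs' =>
      Triple.assign hk rfl (Nat.zero_le V) ⟨hs'.1, fun r => ?_⟩
    by_cases hr : r = k + 1
    · simp [State.setReg, hr]
    · have : r ≤ k + 1 ↔ r ≤ k := by omega
      simp [State.setReg, hr, hs'.2, this]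

/-- Turn the representation of a formula into the representation of the graph. -/
def Cmd.graphOfFormula (K q c : ℕ) : Cmd :=
  .seq (.parameters q c) <| .seq .clauseTable <| .seq (.formulaVectors K) <| .seq .buildGraph <|
  .seq (.assign 2 (.reg 11 - 3 * ((.reg 7 + 1) * (.reg 9 + 1)))) <|
  .seq (.assign 6 (3 * ((.reg 7 + 1) * (.reg 9 + 1)) + (.reg 9 + 1))) <|
  .seq (.tabulate 4 6 Expr.F 0) <| .clearRegs 11

theorem CNF.le_groupSize {N : ℕ} : N ≤ 3 * 2 ^ CNF.groupSize N := by
  have h : CNF.groupSize N < 2 ^ CNF.groupSize N := Nat.lt_two_pow_self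
  have : N ≤ 3 * CNF.groupSize N := by unfold CNF.groupSize; omega
  omega

/-- The final state has to be exactly the initial state on the code of the graph, because nothing is
known about the diameter program on other states. The space below the vectors has size (2q + 2K +
30)X: the code needs at most 2qX + 20X, and the terms with `K` accommodate the formula. Twice this
also covers the vectors and the table of positions. -/
theorem Triple.graphOfFormula {N K q X U : ℕ} (φ : CNF N) (hK : ∀ C ∈ φ, C.length ≤ K)
    (hX : (2 ^ CNF.groupSize N + 1) * (2 ^ CNF.groupSize N + 1) *
      ((φ.length + 1) * (φ.length + 1)) = X) (hU : 2 * ((2 * q + 2 * K + 30) * X) ≤ U) :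
    Triple U U (.graphOfFormula K q (2 * q + 2 * K + 30)) (State.init φ.encode) fun s' =>
      s' = State.init (OV3.graphCode φ.toOV3.extend (q * X)) := by
  have hlen := φ.length_encode_le hK
  have hN := CNF.le_groupSize (N := N)
  have hg : CNF.groupSize N < 2 ^ CNF.groupSize N := Nat.lt_two_pow_self
  set n := 2 ^ CNF.groupSize N with hn
  set d := φ.length + 1 with hd
  have hd0 : 1 ≤ d := by omega
  have h4 : (n + 1) * (n + 1) * 1 ≤ (n + 1) * (n + 1) * (d * d) :=
    Nat.mul_le_mul_left _ (Nat.mul_pos hd0 hd0)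
  have h5 : (n + 1) * 1 ≤ (n + 1) * (n + 1) := Nat.mul_le_mul_left _ (by omega)
  have h6 : 1 * d ≤ (n + 1) * d := Nat.mul_le_mul_right _ (by omega)
  have h7 : (n + 1) * d ≤ (n + 1) * (n + 1) * (d * d) :=
    Nat.mul_le_mul (Nat.le_mul_of_pos_left _ (by omega)) (Nat.le_mul_of_pos_left _ hd0)
  have h8 : (n + 1) * ((n + 1) * (d * d)) = (n + 1) * (n + 1) * (d * d) := by ring
  have hcode := length_graphCode_le (n := n) (Q := q * X) hd0 (J := φ.toOV3.extend)
  have hcount := vertexCount_le (n := n) (Q := q * X) hd0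
  rw [hX] at h4 h7 h8 hcode hcount
  have hF : (2 * q + 2 * K + 30) * X = 2 * (q * X) + 2 * (K * X) + 30 * X := by ring
  have h9 : φ.length * (K + 1) = φ.length * K + φ.length := by ring
  have h10 : φ.length * K ≤ X * K := Nat.mul_le_mul_right _ (by omega)
  have h11 : 1 * K ≤ X * K := Nat.mul_le_mul_right _ (by omega)
  rw [mul_comm X K] at h10 h11
  refine Triple.seq (Triple.parameters φ (by omega) (by omega) (by omega) ?_ (by omega)) ?_
  · rw [← hn, ← hd, hX]
    omega
  rintro s₁ ⟨p₁, m₁⟩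
  have e₁ := p₁.reg11
  have e₂ := p₁.reg2
  have e₆ := p₁.reg6
  rw [← hn, ← hd, hX] at e₂
  rw [← hn, ← hd] at e₆
  refine Triple.seq (Triple.clauseTable φ hK p₁ m₁ (by omega) (by omega) (by omega)) ?_
  rintro s₂ ⟨p₂, t₂, m₂⟩
  have f₁ := p₂.reg11
  have f₂ := p₂.reg2
  have f₆ := p₂.reg6
  rw [← hn, ← hd, hX] at f₂
  rw [← hn, ← hd] at f₆
  refine Triple.seq (Triple.formulaVectors φ hK p₂ (fun x hx => ?_) (fun a ha => ?_) (by omega)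
    (by omega) (by omega)) ?_
  · rw [f₁, f₂, f₆, ← e₂, ← e₆, ← e₁, t₂ x hx]
  · rw [m₂ _ (by omega), m₁]
    rfl
  rintro s₃ ⟨v₃, r₃, m₃⟩
  have g₂ : s₃.reg 2 = (2 * q + 2 * K + 30) * X := by rw [r₃ 2 (by omega), f₂]
  refine Triple.seq (Triple.buildGraph (J := φ.toOV3.extend) (n := n) (d := d) (Q := q * X)
    (F := s₂.reg 2) (by rw [r₃ 0 (by omega), p₂.reg0]) (by rw [r₃ 1 (by omega), p₂.reg1])
    (r₃ 2 (by omega)) (by rw [r₃ 3 (by omega), p₂.reg3, ← hn, ← hd, hX]) v₃ (by omega) (by omega)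
    (by omega) (by omega) (by omega) (by omega)) ?_
  rintro s₄ ⟨c₄, m₄, r₄⟩
  have k₇ : s₄.reg 7 = n := by rw [r₄ 7 (by omega), r₃ 7 (by omega), p₂.reg7]
  have k₉ : s₄.reg 9 = φ.length := by rw [r₄ 9 (by omega), r₃ 9 (by omega), p₂.reg9]
  have k₁₁ : s₄.reg 11 = s₂.reg 2 + 3 * ((n + 1) * d) := by
    rw [r₄ 11 (by omega), r₃ 11 (by omega), f₁, f₆]
  -- Register 2 is not among those known to survive the construction of the graph; the address is
  -- recovered from the preserved registers 7, 9 and 11.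
  refine Triple.seq (Triple.assign_eq (v := s₂.reg 2) (by omega) rfl ?_ (by omega)) ?_
  · simp only [eval_sub, eval_mul, eval_add, eval_three, eval_one, eval_reg, k₇, k₉, k₁₁, ← hd]
    omega
  rintro _ rfl
  refine Triple.seq (Triple.assign_eq (v := 3 * ((n + 1) * d) + d) (by omega) rfl ?_ (by omega)) ?_
  · simp only [eval_mul, eval_add, eval_three, eval_one, eval_reg, State.setReg,
      Function.update_of_ne (show (7 : ℕ) ≠ 2 by omega),
      Function.update_of_ne (show (9 : ℕ) ≠ 2 by omega), k₇, k₉, ← hd]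
  rintro _ rfl
  refine Triple.seq (Triple.tabulate (N := 3 * ((n + 1) * d) + d) (s₂.reg 2) (fun _ => 0)
    (by omega) (by omega) (by omega) rfl (by omega) rfl rfl
    fun t ht => ⟨rfl, rfl, Nat.zero_le U⟩) ?_
  rintro _ rfl
  refine (Triple.clearRegs (by omega)).mono le_rfl ?_
  rintro ⟨R, mem⟩ ⟨hmem, hreg⟩
  simp only [] at hmem hreg
  simp only [State.init, State.mk.injEq]
  constructor
  · funext r
    rw [hreg]
    split_ifs with hr
    · rfl
    · simp only [State.setReg]
      rw [Function.update_of_ne (by omega), Function.update_of_ne (by omega),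
        Function.update_of_ne (by omega), r₄ r (by omega), r₃ r (by omega), p₂.zero r (by omega)]
  · subst hmem
    funext a
    by_cases ha : a < s₂.reg 2
    · rw [fill_of_not (.inl ha)]
      exact c₄ a ha
    · have ha' := not_lt.1 ha
      rw [List.getD_eq_default _ _ (by omega)]
      by_cases hb : a < s₂.reg 2 + (3 * ((n + 1) * d) + d)
      · simp [fill, ha', hb]
      · rw [fill_of_not (.inr (by omega))]
        simp only [State.setReg]
        -- Cells behind the table were never written and lie beyond the formula.
        rw [m₄ a ha', m₃ a (.inr (by omega)), m₂ a (.inr (by omega)), m₁]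
        exact List.getD_eq_default _ _ (by omega)

end WordRAM

/-! ## The conditional lower bound -/

/-- A clause with at most K literals is determined by its first K places, each of which is empty or
holds one of 2N literals. -/
theorem CNF.IsKCNF.length_le {N K : ℕ} {φ : CNF N} (h : φ.IsKCNF K) :
    φ.length ≤ (2 * N + 1) ^ K := by
  let f : List (Fin N × Bool) → Fin K → Option (Fin N × Bool) := fun C k => C[(k : ℕ)]?
  have hf : (φ.map f).Nodup := by
    refine h.2.map_on fun C hC D hD hCD => List.ext_getElem? fun k => ?_
    by_cases hk : k < K
    · exact congrFun hCD ⟨k, hk⟩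
    · have hC' := h.1 C hC
      have hD' := h.1 D hD
      rw [List.getElem?_eq_none (by omega), List.getElem?_eq_none (by omega)]
  have := hf.length_le_card
  simpa [mul_comm] using this

/-- Guarantees that the output of the diameter program, at most twice the diameter, fits into a
word. -/
theorem SimpleGraph.diam_lt_card {V : Type*} [Fintype V] {G : SimpleGraph V} (hG : G.Connected) :
    G.diam < Fintype.card V := by
  have := hG.nonempty
  obtain ⟨u, v, h⟩ := G.exists_dist_eq_diam
  obtain ⟨p, hp, hl⟩ := (hG u v).exists_path_of_dist
  rw [← h, ← hl]
  exact hp.length_lt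

/-- The value `th` separates the approximations of diameters up to `5` from those of diameters
from `8` on. -/
structure Separates (approx : ℕ → ℕ → Prop) (th : ℕ) : Prop where
  le_of_le_five : ∀ {D E}, D ≤ 5 → approx D E → E ≤ th
  lt_of_eight_le : ∀ {D E}, 8 ≤ D → approx D E → th < E
  le_two_mul : ∀ {D E}, approx D E → E ≤ 2 * D

/-- If D ≥ 8 and E ≤ 5, then 8 ≤ (8/5 − ε)E, which is below 8: for E > 0 because of ε, and for E = 0
trivially. -/
theorem separates_isApproxBelow {ε : ℝ} (hε : 0 < ε) : Separates (IsApproxBelow (8 / 5 - ε)) 5 where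
  le_of_le_five {D E} hD h := by
    have : E ≤ D := by exact_mod_cast h.1
    omega
  lt_of_eight_le {D E} hD h := by
    by_contra! hE
    have h1 : (8 : ℝ) ≤ D := by exact_mod_cast hD
    have h2 : (E : ℝ) ≤ 5 := by exact_mod_cast hE
    have h3 := h.2
    have h4 : (0 : ℝ) ≤ E := Nat.cast_nonneg E
    rcases h4.eq_or_lt with h5 | h5
    · rw [← h5, mul_zero] at h3
      linarith
    · nlinarith [mul_pos hε h5]
  le_two_mul {D E} h := by
    have : E ≤ D := by exact_mod_cast h.1
    omega

/-- If D ≤ 5, then E ≤ (8/5 − ε)D < 8, and E is an integer; so here the threshold is 7. -/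
theorem separates_isApproxAbove {ε : ℝ} (hε : 0 < ε) : Separates (IsApproxAbove (8 / 5 - ε)) 7 where
  le_of_le_five {D E} hD h := by
    by_contra! hE
    have h1 : (D : ℝ) ≤ 5 := by exact_mod_cast hD
    have h2 : (8 : ℝ) ≤ E := by exact_mod_cast hE
    have h3 := h.2
    have h4 : (0 : ℝ) ≤ D := Nat.cast_nonneg D
    rcases h4.eq_or_lt with h5 | h5
    · rw [← h5, mul_zero] at h3
      linarith
    · nlinarith [mul_pos hε h5]
  lt_of_eight_le {D E} hD h := by
    have : D ≤ E := by exact_mod_cast h.1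
    omega
  le_two_mul {D E} h := by
    have h4 : (0 : ℝ) ≤ D := Nat.cast_nonneg D
    have : (E : ℝ) ≤ ((2 * D : ℕ) : ℝ) := by
      push_cast
      nlinarith [h.2, mul_nonneg hε.le h4]
    exact_mod_cast this

namespace WordRAM

/-- Replace the number in the memory cell `0` by `1` if it is larger than `th`, otherwise by `0`. -/
def compareProg (th : ℕ) : Prog :=
  .seq (.const 0 0) (.seq (.load 1 0) (.seq (.const 2 th) (.seq (.op .lt 1 2 1) (.store 0 1))))

theorem exec_compareProg {B th : ℕ} {s : State} (hB : 1 < B) (hth : th < B) (hs : s.mem 0 < B) :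
    ∃ s', Exec B (compareProg th) s s' 5 ∧ (s'.mem 0 = 1 ↔ th < s.mem 0) := by
  refine ⟨_, .seq (.const _ _ _ (by omega)) (.seq (.load _ _ _ ?_) (.seq (.const _ _ _ hth)
    (.seq (.op _ _ _ _ _ ?_) (.store _ _ _)))), ?_⟩
  · simpa [State.setReg] using hs
  · simp only [Op.eval]
    split_ifs <;> omega
  · simp [State.setReg, State.setMem, Op.eval]

/-- Decide satisfiability by means of the program `p` for the diameter. -/
def satProg (K q th : ℕ) (p : Prog) : Prog :=
  .seq (Cmd.graphOfFormula K q (2 * q + 2 * K + 30)).compile (.seq p (compareProg th))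

end WordRAM

theorem SimpleGraph.diam_le_of_edist_le {V : Type*} {G : SimpleGraph V} {k : ℕ}
    (h : ∀ u v, G.edist u v ≤ k) : G.diam ≤ k :=
  ENat.toNat_le_of_le_natCast (SimpleGraph.ediam_le_of_edist_le h)

/-- Connectedness matters: `diam` takes the value 0 when the extended diameter is infinite. -/
theorem SimpleGraph.le_diam_of_le_edist {V : Type*} [Finite V] {G : SimpleGraph V} {k : ℕ}
    (hG : G.Connected) {u v : V} (h : k ≤ G.edist u v) : k ≤ G.diam := by
  have := hG.nonempty
  have h1 : G.ediam ≠ ⊤ := SimpleGraph.connected_iff_ediam_ne_top.1 hG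
  have h2 : (k : ℕ∞) ≤ G.ediam := h.trans SimpleGraph.edist_le_ediam
  rw [SimpleGraph.diam, ← ENat.natCast_le_natCast, ENat.natCast_toNat h1]
  exact h2

namespace WordRAM

/-- A program that approximates the diameters of sparse graphs also decides whether an instance of
three orthogonal vectors has a solution. -/
theorem exec_seq_compareProg {approx : ℕ → ℕ → Prop} {s r : ℝ} {p : Prog} {c th : ℕ}
    (hp : ∀ (n : ℕ) (G : SimpleGraph (Fin n)) (xs : List ℕ),
      G.Connected → (G.edgeSet.ncard : ℝ) ≤ s * n → EncodesGraph G xs →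
        RunsWithin p xs ((n + 2) ^ c) (c * (n : ℝ) ^ r) fun mem => approx G.diam (mem 0))
    (hth : Separates approx th) (hr : 0 ≤ r) (hs : 1 ≤ s) {q : ℕ} (hq : 9 ≤ (s - 1) * q)
    {n d X B : ℕ} (hn : 1 ≤ n) (hd : 1 ≤ d) (I : OV3 n d)
    (hX : (n + 1) * (n + 1) * (d * d) = X) (hB₁ : ((8 + q) * X + 2) ^ c ≤ B)
    (hB₂ : 2 * ((8 + q) * X) < B) (hB₃ : th < B) :
    ∃ s' t, Exec B (.seq p (compareProg th)) (State.init (OV3.graphCode I.extend (q * X))) s' t ∧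
      (t : ℝ) ≤ c * ((8 + q) * X) ^ r + 5 ∧ (s'.mem 0 = 1 ↔ I.HasSolution) := by
  have hA : ∀ x, I.extend.A (Fin.last n) x = true := fun x => by simp [OV3.extend]
  have hB : ∀ x, I.extend.B (Fin.last n) x = true := fun x => by simp [OV3.extend]
  have hC : ∀ x, I.extend.C (Fin.last n) x = true := fun x => by simp [OV3.extend]
  have hconn : (OV3.finGraph I.extend (q * X)).Connected := OV3.finGraph_connected hd hA hB hC
  have hsol := OV3.hasSolution_extend hn I
  have hcount := vertexCount_le (n := n) (Q := q * X) hd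
  rw [hX, ← Nat.add_mul] at hcount
  have hX0 : 1 ≤ X := by
    rw [← hX]
    exact Nat.mul_pos (Nat.mul_pos n.succ_pos n.succ_pos) (Nat.mul_pos hd hd)
  have hX8 : 8 * 1 ≤ (8 + q) * X := Nat.mul_le_mul (by omega) hX0
  have h4 : (n + 1) * (n + 1) * 1 ≤ (n + 1) * (n + 1) * (d * d) :=
    Nat.mul_le_mul_left _ (Nat.mul_pos hd hd)
  have hedges : ((OV3.finGraph I.extend (q * X)).edgeSet.ncard : ℝ) ≤
      s * (OV3.vertexCount (n + 1) d (q * X) : ℕ) := by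
    -- The `q * X` pendant vertices add as many edges as vertices, so the ratio tends to 1 as `q`
    -- grows; the choice of `q` absorbs the other 9X edges.
    have h1 : (OV3.finGraph I.extend (q * X)).edgeSet.ncard ≤ 9 * X + q * X := by
      refine OV3.ncard_edgeSet_finGraph_le.trans ?_
      have h2 : (n + 1) * ((n + 1) * (d * d)) = (n + 1) * (n + 1) * (d * d) := by ring
      omega
    have h2 : q * X ≤ OV3.vertexCount (n + 1) d (q * X) := by unfold OV3.vertexCount; omega
    have h1' : ((OV3.finGraph I.extend (q * X)).edgeSet.ncard : ℝ) ≤ 9 * X + q * X := by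
      exact_mod_cast h1
    have h2' : (q : ℝ) * X ≤ (OV3.vertexCount (n + 1) d (q * X) : ℕ) := by exact_mod_cast h2
    calc ((OV3.finGraph I.extend (q * X)).edgeSet.ncard : ℝ) ≤ 9 * X + q * X := h1'
      _ ≤ (s - 1) * q * X + q * X := by gcongr
      _ = s * (q * X) := by ring
      _ ≤ _ := by gcongr
  obtain ⟨s₂, t₂, e₂, ht₂, h₂⟩ := hp _ _ _ hconn hedges OV3.encodesGraph_graphCode
  have hE : s₂.mem 0 < B := by
    have h1 := hth.le_two_mul h₂
    have h2 := SimpleGraph.diam_lt_card hconn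
    rw [Fintype.card_fin] at h2
    omega
  obtain ⟨s₃, e₃, h₃⟩ := exec_compareProg (by omega) hB₃ hE
  refine ⟨s₃, _, .seq (e₂.mono ((Nat.pow_le_pow_left (by omega) c).trans hB₁)) e₃, ?_,
    h₃.trans ⟨fun h => ?_, fun h => ?_⟩⟩
  · have h2 : ((OV3.vertexCount (n + 1) d (q * X) : ℕ) : ℝ) ^ r ≤ ((8 + q) * X) ^ r :=
      Real.rpow_le_rpow (Nat.cast_nonneg _) (by exact_mod_cast hcount) hr
    have h3 := mul_le_mul_of_nonneg_left h2 (Nat.cast_nonneg c : (0 : ℝ) ≤ c)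
    push_cast
    linarith
  · by_contra hns
    have := hth.le_of_le_five (SimpleGraph.diam_le_of_edist_le (k := 5)
      (OV3.finGraph_edist_le_five hB fun h => hns (hsol.1 h))) h₂
    omega
  · obtain ⟨u, v, huv⟩ := OV3.finGraph_exists_eight_le_edist (Q := q * X) (hsol.2 h)
    exact hth.lt_of_eight_le (SimpleGraph.le_diam_of_le_edist (k := 8) hconn huv) h₂

theorem runsWithin_satProg {approx : ℕ → ℕ → Prop} {s r : ℝ} {p : Prog} {c th : ℕ}
    (hp : ∀ (n : ℕ) (G : SimpleGraph (Fin n)) (xs : List ℕ),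
      G.Connected → (G.edgeSet.ncard : ℝ) ≤ s * n → EncodesGraph G xs →
        RunsWithin p xs ((n + 2) ^ c) (c * (n : ℝ) ^ r) fun mem => approx G.diam (mem 0))
    (hth : Separates approx th) (hr : 0 ≤ r) (hs : 1 ≤ s) {q : ℕ} (hq : 9 ≤ (s - 1) * q)
    {N K X B : ℕ} {φ : CNF N} (hK : ∀ C ∈ φ, C.length ≤ K)
    (hX : (2 ^ CNF.groupSize N + 1) * (2 ^ CNF.groupSize N + 1) *
      ((φ.length + 1) * (φ.length + 1)) = X)
    (hB₀ : (2 * ((2 * q + 2 * K + 30) * X)) ^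
      (Cmd.graphOfFormula K q (2 * q + 2 * K + 30)).size < B)
    (hB₁ : ((8 + q) * X + 2) ^ c ≤ B) (hB₂ : 2 * ((8 + q) * X) < B) (hB₃ : th < B) :
    RunsWithin (satProg K q th p) φ.encode B
      ((2 * ((2 * q + 2 * K + 30) * X) + 1) *
        (Cmd.graphOfFormula K q (2 * q + 2 * K + 30)).cost + c * ((8 + q) * X) ^ r + 5)
      fun mem => mem 0 = 1 ↔ φ.Satisfiable := by
  have h4 : 1 * (φ.length + 1) ≤ X := by
    rw [← hX]
    exact Nat.mul_le_mul (Nat.mul_pos (Nat.succ_pos _) (Nat.succ_pos _))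
      (Nat.le_mul_of_pos_left _ (Nat.succ_pos _))
  have h5 : 2 ^ CNF.groupSize N * 1 ≤ X := by
    rw [← hX]
    refine Nat.mul_le_mul ((Nat.le_succ _).trans (Nat.le_mul_of_pos_left _ (Nat.succ_pos _))) ?_
    exact Nat.mul_pos (Nat.succ_pos _) (Nat.succ_pos _)
  have h6 : K * 1 ≤ K * X := Nat.mul_le_mul_left _ (by omega)
  have h7 : (2 * q + 2 * K + 30) * X = 2 * (q * X) + 2 * (K * X) + 30 * X := by ring
  have hN := CNF.le_groupSize (N := N)
  obtain ⟨s₁, t₁, e₁, ht₁, -, -, rfl⟩ := Triple.graphOfFormula φ hK hX le_rfl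
    (State.init_clean _) (State.init_boundedBy fun a ha =>
      (φ.le_of_mem_encode hK ha).trans (by omega)) (by omega) _ hB₀
  obtain ⟨s₂, t₂, e₂, ht₂, h₂⟩ := exec_seq_compareProg hp hth hr hs hq Nat.one_le_two_pow
    (Nat.succ_pos _) φ.toOV3 hX hB₁ hB₂ hB₃
  refine ⟨s₂, _, .seq e₁ e₂, ?_, h₂.trans φ.hasSolution_toOV3⟩
  have h8 : (t₁ : ℝ) ≤ (2 * ((2 * q + 2 * K + 30) * X) + 1) *
      (Cmd.graphOfFormula K q (2 * q + 2 * K + 30)).cost := by exact_mod_cast ht₁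
  push_cast
  linarith

end WordRAM

/-! ### The size of the graph in terms of the number of variables -/

/-- The order of magnitude of the size of the graph for a formula. -/
def CNF.graphSize {N : ℕ} (φ : CNF N) : ℕ :=
  (2 ^ CNF.groupSize N + 1) * (2 ^ CNF.groupSize N + 1) * ((φ.length + 1) * (φ.length + 1))

theorem CNF.one_le_graphSize {N : ℕ} (φ : CNF N) : 1 ≤ φ.graphSize :=
  Nat.mul_pos (Nat.mul_pos (Nat.succ_pos _) (Nat.succ_pos _))
    (Nat.mul_pos (Nat.succ_pos _) (Nat.succ_pos _))

theorem CNF.IsKCNF.length_add_one_le {N K : ℕ} {φ : CNF N} (h : φ.IsKCNF K) :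
    φ.length + 1 ≤ 2 ^ (K + 1) * (N + 1) ^ K := by
  have h1 := h.length_le
  have h2 : (2 * N + 1) ^ K ≤ 2 ^ K * (N + 1) ^ K := by
    rw [← mul_pow]
    exact Nat.pow_le_pow_left (by omega) K
  have h3 : 1 ≤ 2 ^ K * (N + 1) ^ K := Nat.mul_pos (by positivity) (by positivity)
  rw [pow_succ]
  nlinarith

/-- Rounding the group size up costs a factor 2, so 2^g + 1 is at most 4 · 2^(N/3). It enters
squared, which gives the 16 and the exponent 2N/3. -/
theorem CNF.IsKCNF.graphSize_le_rpow {N K : ℕ} {φ : CNF N} (h : φ.IsKCNF K) :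
    (φ.graphSize : ℝ) ≤ 16 * 4 ^ (K + 1) * (2 : ℝ) ^ (2 / 3 * (N : ℝ)) * ((N : ℝ) + 1) ^ (2 * K) := by
  set y : ℝ := (2 : ℝ) ^ ((N : ℝ) / 3) with hy
  have hy1 : 1 ≤ y := Real.one_le_rpow (by norm_num) (by positivity)
  have h1 : ((2 ^ CNF.groupSize N + 1 : ℕ) : ℝ) ≤ 4 * y := by
    have h2 : ((CNF.groupSize N : ℕ) : ℝ) ≤ (N : ℝ) / 3 + 1 := by
      have : 3 * CNF.groupSize N ≤ N + 3 := by unfold CNF.groupSize; omega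
      have : (3 * CNF.groupSize N : ℝ) ≤ N + 3 := by exact_mod_cast this
      linarith
    have h3 : (2 : ℝ) ^ CNF.groupSize N ≤ y * 2 := by
      rw [← Real.rpow_natCast]
      refine (Real.rpow_le_rpow_of_exponent_le (by norm_num) h2).trans_eq ?_
      rw [Real.rpow_add (by norm_num), Real.rpow_one]
    push_cast
    linarith
  have h2 : ((φ.length + 1 : ℕ) : ℝ) ≤ 2 ^ (K + 1) * ((N : ℝ) + 1) ^ K := by
    exact_mod_cast h.length_add_one_le
  have h3 : (2 : ℝ) ^ (2 / 3 * (N : ℝ)) = y * y := by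
    rw [hy, ← Real.rpow_add (by norm_num)]
    congr 1
    ring
  have h4 : (4 : ℝ) ^ (K + 1) = 2 ^ (K + 1) * 2 ^ (K + 1) := by rw [← mul_pow]; norm_num
  rw [h3, h4, CNF.graphSize, Nat.cast_mul, Nat.cast_mul, Nat.cast_mul]
  calc _ ≤ (4 * y) * (4 * y) * ((2 ^ (K + 1) * ((N : ℝ) + 1) ^ K) *
        (2 ^ (K + 1) * ((N : ℝ) + 1) ^ K)) := by gcongr
    _ = _ := by ring

/-- A crude bound, used only for the word length: numbers polynomial in the size of the graph have
O(N) bits. -/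
theorem CNF.IsKCNF.graphSize_le_two_pow {N K : ℕ} {φ : CNF N} (h : φ.IsKCNF K) :
    φ.graphSize ≤ 2 ^ ((4 * K + 6) * (N + 1)) := by
  have hN : N + 1 ≤ 2 ^ (N + 1) := Nat.lt_two_pow_self.le
  have h1 : 2 ^ CNF.groupSize N + 1 ≤ 2 ^ (2 * (N + 1)) := by
    have h2 : 2 ^ CNF.groupSize N ≤ 2 ^ (N + 1) :=
      Nat.pow_le_pow_right (by omega) (by unfold CNF.groupSize; omega)
    have h3 : 2 ^ (2 * (N + 1)) = 2 ^ (N + 1) * 2 ^ (N + 1) := by rw [← pow_add]; congr 1; ring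
    have h4 : 2 ^ 1 ≤ 2 ^ (N + 1) := Nat.pow_le_pow_right (by omega) (by omega)
    nlinarith
  have h2 : φ.length + 1 ≤ 2 ^ ((2 * K + 1) * (N + 1)) := by
    refine h.length_add_one_le.trans ?_
    calc 2 ^ (K + 1) * (N + 1) ^ K ≤ 2 ^ (K + 1) * (2 ^ (N + 1)) ^ K :=
          Nat.mul_le_mul_left _ (Nat.pow_le_pow_left hN K)
      _ = 2 ^ (K + 1 + (N + 1) * K) := by rw [← pow_mul, ← pow_add]
      _ ≤ _ := Nat.pow_le_pow_right (by omega) (by nlinarith)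
  calc φ.graphSize ≤ 2 ^ (2 * (N + 1)) * 2 ^ (2 * (N + 1)) *
        (2 ^ ((2 * K + 1) * (N + 1)) * 2 ^ ((2 * K + 1) * (N + 1))) :=
        Nat.mul_le_mul (Nat.mul_le_mul h1 h1) (Nat.mul_le_mul h2 h2)
    _ = _ := by rw [← pow_add, ← pow_add, ← pow_add]; congr 1; ring

theorem CNF.IsKCNF.mul_graphSize_le {N K : ℕ} {φ : CNF N} (h : φ.IsKCNF K) (a : ℕ) :
    a * φ.graphSize ≤ 2 ^ ((a + (4 * K + 6)) * (N + 1)) := by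
  have h1 : a ≤ 2 ^ (a * (N + 1)) :=
    Nat.lt_two_pow_self.le.trans (Nat.pow_le_pow_right (by omega) (by nlinarith))
  rw [add_mul, pow_add]
  exact Nat.mul_le_mul h1 h.graphSize_le_two_pow

/-- Only the exponential factor must keep the exact exponent `r`; the constant and polynomial
factors are at least 1 and are simply squared. -/
theorem CNF.IsKCNF.graphSize_rpow_le {N K : ℕ} {φ : CNF N} (h : φ.IsKCNF K) {r : ℝ} (hr : 0 ≤ r)
    (hr2 : r ≤ 2) : (φ.graphSize : ℝ) ^ r ≤
      (16 * 4 ^ (K + 1)) ^ 2 * (2 : ℝ) ^ (2 / 3 * r * (N : ℝ)) * ((N : ℝ) + 1) ^ (4 * K) := by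
  have key : ∀ a : ℝ, 1 ≤ a → a ^ r ≤ a ^ 2 := fun a ha => by
    rw [← Real.rpow_natCast]
    exact Real.rpow_le_rpow_of_exponent_le ha (by simpa using hr2)
  refine (Real.rpow_le_rpow (Nat.cast_nonneg _) h.graphSize_le_rpow hr).trans ?_
  rw [Real.mul_rpow (by positivity) (by positivity), Real.mul_rpow (by positivity) (by positivity),
    ← Real.rpow_mul (by norm_num)]
  have h1 := key (16 * 4 ^ (K + 1)) (by
    have : (1 : ℝ) ≤ 4 ^ (K + 1) := one_le_pow₀ (by norm_num)
    linarith)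
  have h2 := key (((N : ℝ) + 1) ^ (2 * K)) (one_le_pow₀ (by
    have : (0 : ℝ) ≤ N := Nat.cast_nonneg N
    linarith))
  rw [← pow_mul, show 2 * K * 2 = 4 * K by ring] at h2
  rw [show 2 / 3 * (N : ℝ) * r = 2 / 3 * r * N by ring]
  gcongr

/-- Since X ≥ 1 and `r ≥ 1`, the linear time for building the graph is absorbed by X^r. -/
theorem CNF.IsKCNF.cost_le {N K : ℕ} {φ : CNF N} (h : φ.IsKCNF K) {r : ℝ} (hr : 1 ≤ r)
    (hr2 : r ≤ 2) (w k c q : ℕ) :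
    (2 * (w * (φ.graphSize : ℝ)) + 1) * k + c * ((8 + q) * (φ.graphSize : ℝ)) ^ r + 5 ≤
      (((2 * w + 1) * k + c * (8 + q) ^ 2 + 5) * (16 * 4 ^ (K + 1)) ^ 2 : ℕ) *
        (2 : ℝ) ^ (2 / 3 * r * (N : ℝ)) * ((N : ℝ) + 1) ^ (4 * K) := by
  have hX : (1 : ℝ) ≤ φ.graphSize := by exact_mod_cast φ.one_le_graphSize
  rw [Real.mul_rpow (by positivity) (by positivity)]
  have h1 : (φ.graphSize : ℝ) ≤ (φ.graphSize : ℝ) ^ r := by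
    simpa using Real.rpow_le_rpow_of_exponent_le hX hr
  have h2 : (8 + q : ℝ) ^ r ≤ (8 + q) ^ 2 := by
    rw [← Real.rpow_natCast]
    refine Real.rpow_le_rpow_of_exponent_le ?_ (by push_cast; linarith)
    have : (0 : ℝ) ≤ q := Nat.cast_nonneg q
    linarith
  have h3 := h.graphSize_rpow_le (r := r) (by linarith) hr2
  have h4 : (1 : ℝ) ≤ (φ.graphSize : ℝ) ^ r := hX.trans h1
  generalize (φ.graphSize : ℝ) ^ r = Y at h1 h3 h4 ⊢
  generalize (φ.graphSize : ℝ) = X at hX h1 ⊢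
  generalize (8 + q : ℝ) ^ r = u at h2 ⊢
  have hX' : (w : ℝ) * X ≤ w * Y := mul_le_mul_of_nonneg_left h1 (Nat.cast_nonneg w)
  have hk : (2 * (w * X) + 1) * (k : ℝ) ≤ (2 * (w * Y) + Y) * k :=
    mul_le_mul_of_nonneg_right (by linarith) (Nat.cast_nonneg k)
  have hu : (c : ℝ) * (u * Y) ≤ c * ((8 + q) ^ 2 * Y) :=
    mul_le_mul_of_nonneg_left (mul_le_mul_of_nonneg_right h2 (by linarith)) (Nat.cast_nonneg c)
  calc (2 * (w * X) + 1) * k + c * (u * Y) + 5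
      ≤ (2 * (w * Y) + Y) * k + c * ((8 + q) ^ 2 * Y) + 5 * Y := by linarith
    _ = ((2 * w + 1) * k + c * (8 + q) ^ 2 + 5) * Y := by ring
    _ ≤ _ := mul_le_mul_of_nonneg_left h3 (by positivity)
    _ = _ := by
      push_cast
      ring

/-- Under the Strong Exponential Time Hypothesis, diameters up to `5` cannot be separated from
diameters from `8` on. -/
theorem not_sparseDiameterComputable (hSETH : SETH) {approx : ℕ → ℕ → Prop} {th : ℕ}
    (hth : Separates approx th) {s δ : ℝ} (hs : 1 < s) (hδ : 0 < δ) :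
    ¬ SparseDiameterComputable approx s (3 / 2 - δ) := by
  rintro ⟨p, c, hp⟩
  obtain ⟨r, hr1, hr2, hδr⟩ : ∃ r : ℝ, 1 ≤ r ∧ r < 3 / 2 ∧ 3 / 2 - δ ≤ r := by
    -- The exponent is raised to at least 1, so that building the graph does not dominate, and stays
    -- below 3/2.
    refine ⟨3 / 2 - min δ (1 / 2), ?_, ?_, ?_⟩
    · linarith [min_le_right δ (1 / 2)]
    · linarith [lt_min hδ (show (0 : ℝ) < 1 / 2 by norm_num)]
    · linarith [min_le_left δ (1 / 2)]
  have hp' : ∀ (n : ℕ) (G : SimpleGraph (Fin n)) (xs : List ℕ), G.Connected →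
      (G.edgeSet.ncard : ℝ) ≤ s * n → EncodesGraph G xs → WordRAM.RunsWithin p xs ((n + 2) ^ c)
        (c * (n : ℝ) ^ r) fun mem => approx G.diam (mem 0) := by
    intro n G xs hG hs hxs
    obtain ⟨s', t, he, ht, h⟩ := hp n G xs hG hs hxs
    have hn : 1 ≤ n := Fin.pos_iff_nonempty.2 hG.nonempty
    refine ⟨s', t, he, ht.trans (mul_le_mul_of_nonneg_left ?_ (Nat.cast_nonneg c)), h⟩
    exact Real.rpow_le_rpow_of_exponent_le (by exact_mod_cast hn) hδr
  obtain ⟨q, hq⟩ := exists_nat_ge (9 / (s - 1))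
  rw [div_le_iff₀' (by linarith)] at hq
  -- The savings 1 − 2r/3 are positive because r < 3/2. The clause width `K` is fixed here, before
  -- the program that depends on it.
  obtain ⟨K, hK⟩ := hSETH (1 - 2 / 3 * r) (by linarith)
  refine hK ?_
  set w := 2 * q + 2 * K + 30 with hw
  set cmd := WordRAM.Cmd.graphOfFormula K q w with hcmd
  set a := ((2 * w + 1) * cmd.cost + c * (8 + q) ^ 2 + 5) * (16 * 4 ^ (K + 1)) ^ 2 with ha
  -- One summand for each of the word-length requirements `hB₀` to `hB₃`. The factor `a`, the degree
  -- `4 * K` and the exponent `b` are then merged into the single constant that `KSATSolvable` asks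
  -- for.
  set b := (2 * w + (4 * K + 6)) * cmd.size + (10 + q + (4 * K + 6)) * c +
    (2 * (8 + q) + (4 * K + 6)) + th + 1 with hb
  clear_value a b
  refine ⟨WordRAM.satProg K q th p, a + 4 * K + b, fun N φ hφ => ?_⟩
  have hX0 := φ.one_le_graphSize
  have hbB : ∀ k < b, 2 ^ (k * (N + 1)) < 2 ^ ((a + 4 * K + b) * (N + 1)) := fun k hk =>
    Nat.pow_lt_pow_right (by omega) (Nat.mul_lt_mul_of_pos_right (by omega) (by omega))
  have hB₀ : (2 * (w * φ.graphSize)) ^ cmd.size < 2 ^ ((a + 4 * K + b) * (N + 1)) := by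
    rw [← mul_assoc]
    refine (Nat.pow_le_pow_left (hφ.mul_graphSize_le _) _).trans_lt ?_
    rw [← pow_mul, mul_right_comm]
    exact hbB _ (by omega)
  have hB₁ : ((8 + q) * φ.graphSize + 2) ^ c ≤ 2 ^ ((a + 4 * K + b) * (N + 1)) := by
    refine (Nat.pow_le_pow_left (?_ : _ ≤ (10 + q) * φ.graphSize) _).trans ?_
    · nlinarith
    refine (Nat.pow_le_pow_left (hφ.mul_graphSize_le _) _).trans ?_
    rw [← pow_mul, mul_right_comm]
    exact (hbB _ (by omega)).le
  have hB₂ : 2 * ((8 + q) * φ.graphSize) < 2 ^ ((a + 4 * K + b) * (N + 1)) := by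
    rw [← mul_assoc]
    exact (hφ.mul_graphSize_le _).trans_lt (hbB _ (by omega))
  have hB₃ : th < 2 ^ ((a + 4 * K + b) * (N + 1)) := by
    refine (Nat.lt_two_pow_self.trans_le (Nat.pow_le_pow_right (by omega) ?_)).trans
      (hbB th (by omega))
    exact Nat.le_mul_of_pos_right _ (by omega)
  obtain ⟨s', t, he, ht, h⟩ := WordRAM.runsWithin_satProg hp' hth (by linarith) hs.le hq hφ.1 rfl
    hB₀ hB₁ hB₂ hB₃
  refine ⟨s', t, he, ht.trans ?_, h⟩
  change (2 * ((2 * q + 2 * K + 30) * (φ.graphSize : ℝ)) + 1) * (cmd.cost : ℝ) +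
    c * ((8 + q) * (φ.graphSize : ℝ)) ^ r + 5 ≤ _
  have hw' : (2 * q + 2 * K + 30 : ℝ) = w := by rw [hw]; push_cast; rfl
  rw [hw', show (1 - (1 - 2 / 3 * r)) = 2 / 3 * r by ring]
  refine (hφ.cost_le hr1 (by linarith) w cmd.cost c q).trans ?_
  rw [← ha]
  have hN : (1 : ℝ) ≤ (N : ℝ) + 1 := by linarith [(Nat.cast_nonneg N : (0 : ℝ) ≤ N)]
  exact mul_le_mul (mul_le_mul_of_nonneg_right (Nat.cast_le.2 (by omega)) (by positivity))
    (pow_le_pow_right₀ hN (by omega)) (by positivity) (by positivity)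

theorem mainTheorem2 :
    -- the reduction from three orthogonal vectors to Diameter 5 versus 8
    (∃ (p : WordRAM.Prog) (c : ℕ), ∀ (n d : ℕ), 1 ≤ n → 1 ≤ d → ∀ I : OV3 n d,
      ∃ (N : ℕ) (G : SimpleGraph (Fin N)) (xs : List ℕ),
        EncodesGraph G xs ∧
        WordRAM.RunsWithin p I.encode ((n + d + 2) ^ c) (c * ((n : ℝ) ^ 2 * (d : ℝ) ^ 2))
          (fun mem => ∀ i : Fin xs.length, mem i = xs.get i) ∧
        N ≤ c * (n ^ 2 + n * d ^ 2) ∧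
        G.edgeSet.ncard ≤ c * (n ^ 2 * d ^ 2) ∧
        (¬ I.HasSolution → ∀ u v : Fin N, G.edist u v ≤ 5) ∧
        (I.HasSolution → ∃ u v : Fin N, 8 ≤ G.edist u v)) ∧
    -- the conditional lower bound for approximating the diameter of sparse graphs
    (SETH → ∀ (s δ ε : ℝ), 1 < s → 0 < δ → 0 < ε →
      ¬ SparseDiameterComputable (IsApproxBelow (8 / 5 - ε)) s (3 / 2 - δ) ∧
      ¬ SparseDiameterComputable (IsApproxAbove (8 / 5 - ε)) s (3 / 2 - δ)) := by
  refine ⟨exists_reduction_to_diameter, ?_⟩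
  intro hSETH s δ ε hs hδ hε
  exact ⟨not_sparseDiameterComputable hSETH (separates_isApproxBelow hε) hs hδ,
    not_sparseDiameterComputable hSETH (separates_isApproxAbove hε) hs hδ⟩
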